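/- An instance of matchings under preferences consists of a finite bipartite graph $G=(W\cup F,E)$ (workers and firms, together called agents) and, for every agent $x\in W\cup F$, a strict linear order $\succ_x$ on the set of neighbours of $x$. A matching is a set $M\subseteq E$ of pairwise disjoint edges; if $x$ is matched in $M$, its partner is $M(x)$. An agent $x$ prefers a matching $M$ over a matching $M'$ if $x$ is matched in $M$ and unmatched in $M'$, or if $x$ is matched in both and $M(x)\succ_x M'(x)$. The popularity margin $\Delta(M,M')$ is the number of agents that prefer $M$ over $M'$ minus the number of agents that prefer $M'$ over $M$. A matching $M$ is popular if $\Delta(M,M')\ge 0$ for every matching $M'$; it is dominant if it is popular and $\Delta(M,M')>0$ for every matching $M'$ with $|M'|>|M|$. Theorem. Each of the following two problems is solved by a (deterministic) polynomial-time algorithm. Input: a finite collection $(\mathcal I_1,\dots,\mathcal I_k)$ of instances (with $k$ part of the input), all on the same bipartite graph $G$, that differ only in the preference order of a single agent, i.e., at most one agent has preference orders that are not identical in all $k$ instances; the instances are given by the explicit preference lists of all agents. 1. Does there exist a matching that is popular for $\mathcal I_i$ for all $1\le i\le k$? 2. Does there exist a matching that is dominant for $\mathcal I_i$ for all $1\le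 i\le k$? Here the running time is the number of steps of a unit-cost random access machine with addition and subtraction as its arithmetic operations, and it is bounded by a polynomial in the length of the input. -/

import Mathlib

/-! ### Matchings under preferences -/

namespace MatchingPref

/-- The agents: `m` workers (`Sum.inl`) and `n` firms (`Sum.inr`). -/
abbrev Agent (m n : ℕ) : Type := Fin m ⊕ Fin n

/-- An instance of matchings under preferences: a bipartite graph between `m` workers and `n`
firms and, for each agent, a linear order over the agent's neighbours. The linear order is given
as the list of all neighbours, without repetition, from the most to the least preferred. -/
structure Instance (m n : ℕ) where
  edges : Finset (Fin m × Fin n)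
  workerPref : Fin m → List (Fin n)
  firmPref : Fin n → List (Fin m)
  nodup_workerPref : ∀ w, (workerPref w).Nodup
  nodup_firmPref : ∀ f, (firmPref f).Nodup
  mem_workerPref : ∀ w f, f ∈ workerPref w ↔ (w, f) ∈ edges
  mem_firmPref : ∀ f w, w ∈ firmPref f ↔ (w, f) ∈ edges

variable {m n : ℕ}

/-- The preference order of an agent, as a list of agents, best first. -/
def Instance.pref (I : Instance m n) : Agent m n → List (Agent m n)
  | Sum.inl w => (I.workerPref w).map Sum.inr
  | Sum.inr f => (I.firmPref f).map Sum.inl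

/-- `I.Prefers x y z`: both `y` and `z` are neighbours of `x`, and `y ≻ z` in the preference
order of `x`. -/
def Instance.Prefers (I : Instance m n) (x y z : Agent m n) : Prop :=
  y ∈ I.pref x ∧ z ∈ I.pref x ∧ (I.pref x).idxOf y < (I.pref x).idxOf z

/-- A matching of `I`: a set of pairwise disjoint edges. -/
def Instance.IsMatching (I : Instance m n) (M : Finset (Fin m × Fin n)) : Prop :=
  M ⊆ I.edges ∧ ∀ e ∈ M, ∀ e' ∈ M, e ≠ e' → e.1 ≠ e'.1 ∧ e.2 ≠ e'.2

/-- `MatchedTo M x y`: the agents `x` and `y` are joined by an edge of `M`. -/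
def MatchedTo (M : Finset (Fin m × Fin n)) : Agent m n → Agent m n → Prop
  | Sum.inl w, Sum.inr f => (w, f) ∈ M
  | Sum.inr f, Sum.inl w => (w, f) ∈ M
  | Sum.inl _, Sum.inl _ => False
  | Sum.inr _, Sum.inr _ => False

/-- The agent `x` is matched by `M`. -/
def IsMatched (M : Finset (Fin m × Fin n)) (x : Agent m n) : Prop :=
  ∃ y, MatchedTo M x y

/-- The agent `x` prefers the matching `M` over the matching `M'`: it is matched in `M` and
unmatched in `M'`, or matched in both with a better partner in `M`. -/
def Instance.PrefersMatching (I : Instance m n) (x : Agent m n)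
    (M M' : Finset (Fin m × Fin n)) : Prop :=
  (IsMatched M x ∧ ¬ IsMatched M' x) ∨
    ∃ y z, MatchedTo M x y ∧ MatchedTo M' x z ∧ I.Prefers x y z

open Classical in
/-- The vote of `x` between `M` and `M'`. -/
noncomputable def Instance.vote (I : Instance m n) (x : Agent m n)
    (M M' : Finset (Fin m × Fin n)) : ℤ :=
  if I.PrefersMatching x M M' then 1
  else if I.PrefersMatching x M' M then -1
  else 0

/-- The popularity margin between `M` and `M'`. -/
noncomputable def Instance.margin (I : Instance m n) (M M' : Finset (Fin m × Fin n)) : ℤ :=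
  ∑ x : Agent m n, I.vote x M M'

/-- `M` is a popular matching of `I`: it loses against no matching in a majority vote. -/
def Instance.IsPopular (I : Instance m n) (M : Finset (Fin m × Fin n)) : Prop :=
  I.IsMatching M ∧ ∀ M', I.IsMatching M' → 0 ≤ I.margin M M'

/-- `M` is a dominant matching of `I`: it is popular and defeats every larger matching. -/
def Instance.IsDominant (I : Instance m n) (M : Finset (Fin m × Fin n)) : Prop :=
  I.IsPopular M ∧ ∀ M', I.IsMatching M' → M.card < M'.card → 0 < I.margin M M'

/-- A collection of `k` instances on the same graph that differ only in the preferences of a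
single agent: at most one agent does not have the same preferences in all of them. -/
structure OneAgentCollection where
  m : ℕ
  n : ℕ
  k : ℕ
  inst : Fin k → Instance m n
  same_graph : ∀ i j, (inst i).edges = (inst j).edges
  one_agent : ∀ x y : Agent m n,
    (∃ i j, (inst i).pref x ≠ (inst j).pref x) →
    (∃ i j, (inst i).pref y ≠ (inst j).pref y) → x = y

/-- Some matching is popular in all instances of the collection. -/
def OneAgentCollection.HasCommonPopular (C : OneAgentCollection) : Prop :=
  ∃ M : Finset (Fin C.m × Fin C.n), ∀ i, (C.inst i).IsPopular M

/-- Some matching is dominant in all instances of the collection. -/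
def OneAgentCollection.HasCommonDominant (C : OneAgentCollection) : Prop :=
  ∃ M : Finset (Fin C.m × Fin C.n), ∀ i, (C.inst i).IsDominant M

/-- A list of indices, preceded by its length. -/
def encodeList {r : ℕ} (l : List (Fin r)) : List ℕ :=
  l.length :: l.map Fin.val

/-- An instance, written as the preference lists of all workers, then of all firms. -/
def Instance.encode (I : Instance m n) : List ℕ :=
  (List.ofFn fun w => encodeList (I.workerPref w)).flatten ++
    (List.ofFn fun f => encodeList (I.firmPref f)).flatten

/-- The input given to an algorithm: the three numbers `m`, `n`, `k`, then the `k` instances one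
after the other. For `k > 0` its length is `3 + k * (m + n + 2 * |E|)`. -/
def OneAgentCollection.encode (C : OneAgentCollection) : List ℕ :=
  C.m :: C.n :: C.k :: (List.ofFn fun i => (C.inst i).encode).flatten

end MatchingPref

/-! ### Random access machines -/

namespace RAM

/-- Expressions: constants, registers, indirect reads from a memory, sums and truncated
differences. There is no multiplication, so that in `t` steps numbers grow by `O(t)` bits only and
unit-cost polynomial time is the same as polynomial time on Turing machines. -/
inductive Expr where
  | const (c : ℕ)
  | reg (x : ℕ)
  | load (a : ℕ) (i : Expr)
  | add (e₁ e₂ : Expr)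
  | sub (e₁ e₂ : Expr)

/-- The programs of a random access machine, in structured form. A program is a finite object and
mentions finitely many registers `x` and finitely many memories `a`; the cells of a memory are
addressed by natural numbers that are computed at run time. -/
inductive Cmd where
  | skip
  | assign (x : ℕ) (e : Expr)
  | store (a : ℕ) (i e : Expr)
  | seq (c₁ c₂ : Cmd)
  | ite (e : Expr) (c₁ c₂ : Cmd)
  | loop (e : Expr) (c : Cmd)

/-- `reg x` is the content of register `x`, and `mem a i` that of cell `i` of memory `a`. -/
structure State where
  reg : ℕ → ℕ
  mem : ℕ → ℕ → ℕ

/-- The value of an expression. -/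
def Expr.eval (s : State) : Expr → ℕ
  | .const c => c
  | .reg x => s.reg x
  | .load a i => s.mem a (i.eval s)
  | .add e₁ e₂ => e₁.eval s + e₂.eval s
  | .sub e₁ e₂ => e₁.eval s - e₂.eval s

/-- `Exec c s t s'`: the program `c`, started in state `s`, halts in state `s'` after exactly `t`
steps. Every elementary command and every evaluation of a guard (true iff nonzero) is one step;
the expressions of a fixed program have bounded size. `loop e c` is `while e ≠ 0 do c`. -/
inductive Exec : Cmd → State → ℕ → State → Prop where
  | skip (s : State) : Exec .skip s 1 s
  | assign (x : ℕ) (e : Expr) (s : State) :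
      Exec (.assign x e) s 1 ⟨Function.update s.reg x (e.eval s), s.mem⟩
  | store (a : ℕ) (i e : Expr) (s : State) :
      Exec (.store a i e) s 1
        ⟨s.reg, Function.update s.mem a (Function.update (s.mem a) (i.eval s) (e.eval s))⟩
  | seq {c₁ c₂ : Cmd} {s s₁ s₂ : State} {t₁ t₂ : ℕ} :
      Exec c₁ s t₁ s₁ → Exec c₂ s₁ t₂ s₂ → Exec (.seq c₁ c₂) s (t₁ + t₂) s₂
  | ite_true {e : Expr} {c₁ c₂ : Cmd} {s s' : State} {t : ℕ} :
      e.eval s ≠ 0 → Exec c₁ s t s' → Exec (.ite e c₁ c₂) s (t + 1) s'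
  | ite_false {e : Expr} {c₁ c₂ : Cmd} {s s' : State} {t : ℕ} :
      e.eval s = 0 → Exec c₂ s t s' → Exec (.ite e c₁ c₂) s (t + 1) s'
  | loop_true {e : Expr} {c : Cmd} {s s₁ s₂ : State} {t₁ t₂ : ℕ} :
      e.eval s ≠ 0 → Exec c s t₁ s₁ → Exec (.loop e c) s₁ t₂ s₂ →
        Exec (.loop e c) s (t₁ + t₂ + 1) s₂
  | loop_false {e : Expr} {c : Cmd} {s : State} :
      e.eval s = 0 → Exec (.loop e c) s 1 s

/-- The initial state on input `l`: register `0` holds the length of `l`, memory `0` holds the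
entries of `l` from cell `0` on, and everything else is `0`. -/
def initState (l : List ℕ) : State where
  reg := Function.update (fun _ => 0) 0 l.length
  mem := Function.update (fun _ _ => 0) 0 (fun i => l.getD i 0)

/-- The problem `P`, with inputs `a : α` written as lists of numbers `enc a`, is solved by a
polynomial-time algorithm: one program halts on every input within a number of steps that is
polynomial in the length of the list (hence also in its number of bits), with `1` in register `0`
if `P a` holds and with `0` in it otherwise. -/
def DecidesInPolyTime {α : Type} (enc : α → List ℕ) (P : α → Prop) : Prop :=
  ∃ (c : Cmd) (p : Polynomial ℕ), ∀ a : α, ∃ (t : ℕ) (s : State),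
    Exec c (initState (enc a)) t s ∧ t ≤ p.eval (enc a).length ∧
      (P a → s.reg 0 = 1) ∧ (¬ P a → s.reg 0 = 0)

end RAM

/-! Popularity is turned into a dual certificate, certificates into stable matchings, and the family
of instances into one hybrid instance; the resulting question is answered by deferred acceptance.

Certificates. The margin of `M` against `N` is, up to sign, the weight of `N` in an assignment
problem whose edge weights are the votes of the endpoints against `M` (`Instance.margin_eq`). By
integral duality (`exists_dual`), `M` is popular exactly if it has an `IsWitness`, whose values lie
in {-1, 0, 1}. It is dominant exactly if the values can be chosen nonzero at all matched agents
(`IsWitness.totalWeight_neg`, `exists_isWitness_ne_zero`).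

Stable matchings. A stable matching has the certificate 0. If every edge is doubled, with one copy
ranked first by the workers and the other by the firms, then stable sets of the doubled system have
certificates that are 1 or -1 on matched agents. Conversely, the edges of a popular matching with
certificate 0 extend to a stable matching, and the remaining edges extend to a two-level stable set
(`IsWitness.exists_isStable_one`, `IsWitness.exists_isStable_two`). Hence, if some popular matching
uses a given edge, so does a popular matching that comes from a stable set with one or two levels.

Many instances. Fix the partner of the varying agent, or the fact that it is unmatched. In the
hybrid instance the agent ranks above this partner everyone whom it prefers to the partner in some
instance. The hybrid vote for an edge is then the maximum of its votes over all instances. A rival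
matching has at most one edge at the varying agent, so a single instance attains these maxima on the
whole rival (`exists_edgeGain_ge`). Therefore being popular or dominant in all instances is the same
as being so in the hybrid.

Forcing. It remains to decide, for each pair `x` of agents and each level, whether there is a stable
set in which these agents have exactly the prescribed contract. The agents are removed, and the
partners of the contracts that threaten the prescribed one are made to insist on something better.
All stable sets of the truncated system cover the same agents (`IsStable.exists_eq_ag_of_side`), so
one stable set tells whether all threats are averted (`exists_isStable_forced_iff`).

Running time. Relations defined by quantification over numbers below the input length are evaluated
in polynomial time, and so are fixpoints of monotone definable operators (`exists_cmd_fixpoint`).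
Deferred acceptance is such a fixpoint, computed for all choices of the forced contract at once. -/

/-! ### Stable sets of contracts

A contract system has two sides, indexed by `Bool`: the contract `c` involves the agent `ag s c` on
side `s`, which ranks it by `rk s c` (lower is better). -/

namespace Contracts

variable {C Γ : Type*} [LinearOrder Γ]

/-- No agent is indifferent between two of its contracts in `A`. -/
def RankInj (ag : Bool → C → ℕ) (rk : Bool → C → Γ) (A : Set C) : Prop :=
  ∀ c ∈ A, ∀ d ∈ A, ∀ s, ag s c = ag s d → rk s c = rk s d → c = d

/-- The contract `d` is weakly worse than a contract of `S` for one of its agents. -/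
def Dominates (ag : Bool → C → ℕ) (rk : Bool → C → Γ) (S : Set C) (d : C) : Prop :=
  ∃ c ∈ S, ∃ s, ag s c = ag s d ∧ rk s c ≤ rk s d

/-- Every agent has at most one contract in `S`. -/
def IsDisjoint (ag : Bool → C → ℕ) (S : Set C) : Prop :=
  ∀ c ∈ S, ∀ d ∈ S, ∀ s, ag s c = ag s d → c = d

/-- Stable sets of contracts: no contract of `A` blocks. -/
structure IsStable (ag : Bool → C → ℕ) (rk : Bool → C → Γ) (A S : Set C) : Prop where
  subset : S ⊆ A
  disjoint : IsDisjoint ag S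
  dominates : ∀ d ∈ A, Dominates ag rk S d

/-- All contracts of `A` that the `false`-agent of `c` prefers to `c` are in `D`. -/
def Proposed (ag : Bool → C → ℕ) (rk : Bool → C → Γ) (A : Set C) (D : C → Prop) (c : C) : Prop :=
  ∀ d ∈ A, ag false d = ag false c → rk false d < rk false c → D d

/-- The `true`-agent of `c` has been proposed a better contract. -/
def Rejected (ag : Bool → C → ℕ) (rk : Bool → C → Γ) (A : Set C) (D : C → Prop) (c : C) : Prop :=
  ∃ d ∈ A, ag true d = ag true c ∧ rk true d < rk true c ∧ Proposed ag rk A D d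

/-- The contracts that are proposed and not rejected. -/
def held (ag : Bool → C → ℕ) (rk : Bool → C → Γ) (A : Set C) (D : C → Prop) : Set C :=
  {c | c ∈ A ∧ ¬ D c ∧ Proposed ag rk A D c}

variable {ag : Bool → C → ℕ} {rk : Bool → C → Γ} {A : Set C}

/-- If `d` is rejected, the best contract proposed to its `true`-agent is held; if not, the best
unrejected contract of its `false`-agent is proposed and held. Any fixpoint will do, so the
algorithm need not know that it has reached the least one. -/
theorem isStable_held (hA : A.Finite) (hinj : RankInj ag rk A) {D : C → Prop}
    (hD : ∀ c ∈ A, D c ↔ Rejected ag rk A D c) : IsStable ag rk A (held ag rk A D) := by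
  refine ⟨fun c hc => hc.1, ?_, ?_⟩
  · have key : ∀ c ∈ held ag rk A D, ∀ d ∈ held ag rk A D, ∀ s, ag s c = ag s d →
        ¬ rk s c < rk s d := by
      intro c hc d hd s hs hlt
      cases s with
      | false => exact hc.2.1 (hd.2.2 c hc.1 hs hlt)
      | true => exact hd.2.1 ((hD d hd.1).2 ⟨c, hc.1, hs, hlt, hc.2.2⟩)
    intro c hc d hd s hs
    exact hinj c hc.1 d hd.1 s hs
      (le_antisymm (not_lt.1 (key d hd c hc s hs.symm)) (not_lt.1 (key c hc d hd s hs)))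
  · intro d hd
    by_cases hDd : D d
    · obtain ⟨c, hc, hcd, hlt, hprop⟩ := (hD d hd).1 hDd
      obtain ⟨b, ⟨hbA, hbd, hbp⟩, hmin⟩ := Set.exists_min_image
        {c | c ∈ A ∧ ag true c = ag true d ∧ Proposed ag rk A D c} (rk true)
        (hA.subset fun c hc => hc.1) ⟨c, hc, hcd, hprop⟩
      refine ⟨b, ⟨hbA, fun hDb => ?_, hbp⟩, true, hbd, (hmin c ⟨hc, hcd, hprop⟩).trans hlt.le⟩
      obtain ⟨a, ha, hab, halt, hap⟩ := (hD b hbA).1 hDb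
      exact absurd (hmin a ⟨ha, hab.trans hbd, hap⟩) (not_le.2 halt)
    · obtain ⟨b, ⟨hbA, hbd, hbD⟩, hmin⟩ := Set.exists_min_image
        {c | c ∈ A ∧ ag false c = ag false d ∧ ¬ D c} (rk false)
        (hA.subset fun c hc => hc.1) ⟨d, hd, rfl, hDd⟩
      refine ⟨b, ⟨hbA, hbD, fun a ha hab hlt => ?_⟩, false, hbd, hmin d ⟨hd, rfl, hDd⟩⟩
      by_contra hDa
      exact absurd (hmin a ⟨ha, hab.trans hbd, hDa⟩) (not_le.2 hlt)

/-- Rejection is monotone in the set of rejected contracts, so Knaster–Tarski provides a fixpoint.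
-/
theorem exists_isStable (hA : A.Finite) (hinj : RankInj ag rk A) : ∃ S, IsStable ag rk A S := by
  let F : (C → Prop) →o (C → Prop) :=
    ⟨fun D => Rejected ag rk A D, by
      rintro D D' h c ⟨d, hd, h1, h2, h3⟩
      exact ⟨d, hd, h1, h2, fun e he h4 h5 => h e (h3 e he h4 h5)⟩⟩
  refine ⟨_, isStable_held hA hinj (D := F.lfp) fun c _ => ?_⟩
  have h : Rejected ag rk A F.lfp c = F.lfp c := congrFun F.map_lfp c
  rw [h]

/-- The rural hospitals theorem. Let `X` be the contracts of `S` whose agent on side `s` strictly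
prefers `S`, and `Y` those of `T` whose agent on the other side strictly prefers `T`. Stability maps
`X` injectively into `Y` and `Y` injectively into `X`, so by finiteness the second map is onto. A
contract of `S` whose `s`-agent has nothing in `T` would be in `X` but not in the image. -/
theorem IsStable.exists_eq_ag_of_side {S T : Set C} (hA : A.Finite) (hinj : RankInj ag rk A)
    (hS : IsStable ag rk A S) (hT : IsStable ag rk A T) (s : Bool) {c : C} (hc : c ∈ S) :
    ∃ d ∈ T, ag s d = ag s c := by
  by_contra hno
  push Not at hno
  set X : Set C := {c | c ∈ S ∧ ∀ d ∈ T, ag s d = ag s c → rk s c < rk s d} with hX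
  set Y : Set C := {d | d ∈ T ∧ ∀ c ∈ S, ag (!s) c = ag (!s) d → rk (!s) d < rk (!s) c} with hY
  have hXfin : X.Finite := hA.subset fun c hc => hS.subset hc.1
  have hYfin : Y.Finite := hA.subset fun c hc => hT.subset hc.1
  have other : ∀ (U : Set C) (s : Bool) (e : C), Dominates ag rk U e →
      (∀ d ∈ U, ag s d = ag s e → rk s e < rk s d) →
      ∃ d ∈ U, ag (!s) d = ag (!s) e ∧ rk (!s) d ≤ rk (!s) e := by
    rintro U s e ⟨d, hd, s', h1, h2⟩ h
    by_cases hs : s' = s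
    · subst hs
      exact absurd (h d hd h1) (not_lt.2 h2)
    · have : s' = !s := by cases s <;> cases s' <;> simp_all
      subst this
      exact ⟨d, hd, h1, h2⟩
  have hXY : ∀ c ∈ X, ∃ d ∈ Y, ag (!s) d = ag (!s) c := by
    rintro c ⟨hcS, hcT⟩
    obtain ⟨d, hd, h1, h2⟩ := other T s c (hT.dominates c (hS.subset hcS)) hcT
    refine ⟨d, ⟨hd, fun e he hed => ?_⟩, h1⟩
    obtain rfl := hS.disjoint e he c hcS (!s) (hed.trans h1)
    refine lt_of_le_of_ne h2 fun heq => ?_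
    obtain rfl := hinj d (hT.subset hd) e (hS.subset he) _ h1 heq
    exact lt_irrefl _ (hcT d hd rfl)
  have hYX : ∀ d ∈ Y, ∃ c ∈ X, ag s c = ag s d := by
    rintro d ⟨hdT, hdS⟩
    obtain ⟨c, hc, h1, h2⟩ := other S (!s) d (hS.dominates d (hT.subset hdT)) hdS
    rw [Bool.not_not] at h1 h2
    refine ⟨c, ⟨hc, fun e he hed => ?_⟩, h1⟩
    obtain rfl := hT.disjoint e he d hdT s (hed.trans h1)
    refine lt_of_le_of_ne h2 fun heq => ?_
    obtain rfl := hinj c (hS.subset hc) e (hT.subset he) _ h1 heq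
    exact lt_irrefl _ (hdS c hc rfl)
  choose! f hfY hf using hXY
  choose! g hgX hg using hYX
  have hfinj : Set.InjOn f X := fun a ha b hb hab =>
    hS.disjoint a ha.1 b hb.1 (!s) (by rw [← hf a ha, ← hf b hb, hab])
  have hginj : Set.InjOn g Y := fun a ha b hb hab =>
    hT.disjoint a ha.1 b hb.1 s (by rw [← hg a ha, ← hg b hb, hab])
  have hcard : X.ncard ≤ Y.ncard := Set.ncard_le_ncard_of_injOn f hfY hfinj hYfin
  have himg : g '' Y = X := by
    refine Set.eq_of_subset_of_ncard_le ?_ ?_ hXfin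
    · rintro _ ⟨d, hd, rfl⟩
      exact hgX d hd
    · rw [hginj.ncard_image]
      exact hcard
  have hcX : c ∈ X := ⟨hc, fun d hd h => absurd h (hno d hd)⟩
  rw [← himg] at hcX
  obtain ⟨d, hd, rfl⟩ := hcX
  exact hno d hd.1 (hg d hd).symm

/-- The contract `c` involves one of the agents `x false`, `x true`. -/
def Touches (ag : Bool → C → ℕ) (x : Bool → ℕ) (c : C) : Prop :=
  ∃ s, ag s c = x s

/-- The contracts of the agents `x` that are not dominated by `K`. -/
def Threat (ag : Bool → C → ℕ) (rk : Bool → C → Γ) (A : Set C) (x : Bool → ℕ) (K : Set C)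
    (d : C) : Prop :=
  d ∈ A ∧ Touches ag x d ∧ ¬ Dominates ag rk K d

/-- The contracts that remain when the agents `x` are removed and the partners of the threats
insist on something better than the threat. -/
def truncation (ag : Bool → C → ℕ) (rk : Bool → C → Γ) (A : Set C) (x : Bool → ℕ) (K : Set C) :
    Set C :=
  {c | c ∈ A ∧ ¬ Touches ag x c ∧
    ∀ d, Threat ag rk A x K d → ∀ s, ag s c = ag s d → rk s c < rk s d}

/-- Stable sets in which the agents `x` have exactly the contracts `K`. -/
theorem exists_isStable_forced_iff (hA : A.Finite) (hinj : RankInj ag rk A) {x : Bool → ℕ}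
    {K : Set C} (hKA : K ⊆ A) (hKx : ∀ c ∈ K, ∀ s, ag s c = x s) (hK : K.Subsingleton)
    {N : Set C} (hN : IsStable ag rk (truncation ag rk A x K) N) :
    (∃ S, IsStable ag rk A S ∧ ∀ c, c ∈ K ↔ c ∈ S ∧ Touches ag x c) ↔
      ∀ d, Threat ag rk A x K d → ∃ c ∈ N, ∃ s, ag s c = ag s d := by
  -- A threat touches `x`, so at most one of its agents is outside `x`.
  have houter : ∀ d, Threat ag rk A x K d → ∀ s, ag s d ≠ x s → ag (!s) d = x (!s) := by
    rintro d ⟨hdA, ⟨s', hs'⟩, hdK⟩ s hs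
    have : s' ≠ s := by rintro rfl; exact hs hs'
    have : s' = !s := by cases s <;> cases s' <;> simp_all
    rw [← this, hs']
  have hKdom : ∀ d, ¬ Touches ag x d → ¬ Dominates ag rk K d := by
    rintro d hd ⟨c, hc, s, h1, -⟩
    exact hd ⟨s, h1.symm.trans (hKx c hc s)⟩
  constructor
  · rintro ⟨S, hS, hSK⟩ d hd
    set S' : Set C := {c | c ∈ S ∧ ¬ Touches ag x c} with hS'
    have hsplit : ∀ e, Dominates ag rk S e → ¬ Dominates ag rk K e → Dominates ag rk S' e := by
      rintro e ⟨c, hc, s, h1, h2⟩ he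
      by_cases hcx : Touches ag x c
      · exact absurd ⟨c, (hSK c).2 ⟨hc, hcx⟩, s, h1, h2⟩ he
      · exact ⟨c, ⟨hc, hcx⟩, s, h1, h2⟩
    have hthreat : ∀ e, Threat ag rk A x K e → ∃ c ∈ S', ∃ s, ag s c = ag s e ∧
        rk s c < rk s e := by
      intro e he
      obtain ⟨c, hc, s, h1, h2⟩ := hsplit e (hS.dominates e he.1) he.2.2
      refine ⟨c, hc, s, h1, lt_of_le_of_ne h2 fun heq => hc.2 ?_⟩
      rw [hinj c (hS.subset hc.1) e he.1 s h1 heq]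
      exact he.2.1
    have hstab : IsStable ag rk (truncation ag rk A x K) S' := by
      refine ⟨?_, fun c hc d hd => hS.disjoint c hc.1 d hd.1, ?_⟩
      · rintro c ⟨hc, hcx⟩
        refine ⟨hS.subset hc, hcx, fun e he s hse => ?_⟩
        obtain ⟨b, hb, s', h1, h2⟩ := hthreat e he
        have hs : s' = s := by
          by_contra hne
          have h3 : ag s e ≠ x s := fun h => hcx ⟨s, hse.trans h⟩
          have h4 := houter e he s h3
          have h5 : s' = !s := by cases s <;> cases s' <;> simp_all
          exact hb.2 ⟨s', by rw [h1, h5, h4]⟩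
        subst hs
        rw [hS.disjoint c hc b hb.1 s' (hse.trans h1.symm)]
        exact h2
      · intro e he
        exact hsplit e (hS.dominates e he.1) (hKdom e he.2.1)
    obtain ⟨c, hc, s, h1, -⟩ := hthreat d hd
    have hfin : (truncation ag rk A x K).Finite := hA.subset fun c hc => hc.1
    have hinj' : RankInj ag rk (truncation ag rk A x K) := fun a ha b hb =>
      hinj a ha.1 b hb.1
    -- The part of `S` away from `x` is stable in the truncation, so it covers the same agents as
    -- `N`.
    obtain ⟨b, hb, h2⟩ := hstab.exists_eq_ag_of_side hfin hinj' hN s hc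
    exact ⟨b, hb, s, h2.trans h1⟩
  · intro h
    refine ⟨N ∪ K, ⟨?_, ?_, ?_⟩, fun c => ?_⟩
    · exact Set.union_subset (fun c hc => (hN.subset hc).1) hKA
    · rintro c (hc | hc) d (hd | hd) s hs
      · exact hN.disjoint c hc d hd s hs
      · exact absurd ⟨s, hs.trans (hKx d hd s)⟩ (hN.subset hc).2.1
      · exact absurd ⟨s, hs.symm.trans (hKx c hc s)⟩ (hN.subset hd).2.1
      · exact hK hc hd
    · intro c hc
      have mono : ∀ (U : Set C), U ⊆ N ∪ K → Dominates ag rk U c → Dominates ag rk (N ∪ K) c := by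
        rintro U hU ⟨d, hd, h⟩
        exact ⟨d, hU hd, h⟩
      by_cases hcK : Dominates ag rk K c
      · exact mono K Set.subset_union_right hcK
      by_cases hct : c ∈ truncation ag rk A x K
      · exact mono N Set.subset_union_left (hN.dominates c hct)
      -- Contracts of the truncation beat every threat with which they share an agent, so covering
      -- that agent is enough.
      have strict : ∀ d, Threat ag rk A x K d → ∃ b ∈ N, ∃ s, ag s b = ag s d ∧
          rk s b < rk s d := by
        intro d hd
        obtain ⟨b, hb, s, h1⟩ := h d hd
        exact ⟨b, hb, s, h1, (hN.subset hb).2.2 d hd s h1⟩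
      by_cases hcx : Touches ag x c
      · obtain ⟨b, hb, s, h1, h2⟩ := strict c ⟨hc, hcx, hcK⟩
        exact ⟨b, Or.inl hb, s, h1, h2.le⟩
      · have : ∃ d, Threat ag rk A x K d ∧ ∃ s, ag s c = ag s d ∧ rk s d ≤ rk s c := by
          by_contra hno
          push Not at hno
          exact hct ⟨hc, hcx, fun d hd s hs => hno d hd s hs⟩
        obtain ⟨d, hd, s, h1, h2⟩ := this
        obtain ⟨b, hb, s', h3, h4⟩ := strict d hd
        have hs : s' = s := by
          by_contra hne
          have h5 : ag s d ≠ x s := fun h => hcx ⟨s, h1.trans h⟩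
          have h6 := houter d hd s h5
          have h7 : s' = !s := by cases s <;> cases s' <;> simp_all
          exact (hN.subset hb).2.1 ⟨s', by rw [h3, h7, h6]⟩
        subst hs
        exact ⟨b, Or.inl hb, s', h3.trans h1.symm, h4.le.trans h2⟩
    · constructor
      · exact fun hc => ⟨Or.inr hc, true, hKx c hc true⟩
      · rintro ⟨hc | hc, hcx⟩
        · exact absurd hcx (hN.subset hc).2.1
        · exact hc

end Contracts

/-! ### Potentials -/

section Potential

variable {V : Type*}

/-- The total weight of the steps of a walk. -/
def walkWeight (c : V → V → ℤ) : List V → ℤ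
  | a :: b :: l => c a b + walkWeight c (b :: l)
  | _ => 0

theorem walkWeight_append_cons (c : V → V → ℤ) (l : List V) (v : V) (r : List V) :
    walkWeight c (l ++ v :: r) = walkWeight c (l ++ [v]) + walkWeight c (v :: r) := by
  induction l with
  | nil => simp [walkWeight]
  | cons a l ih =>
    cases l with
    | nil => simp [walkWeight]
    | cons b l =>
      simp only [List.cons_append, walkWeight] at ih ⊢
      rw [ih, add_assoc]

theorem walkWeight_eq_sum_zipWith (c : V → V → ℤ) (v : V) (b : List V) (u : V) :
    walkWeight c (v :: (b ++ [u])) = (List.zipWith c (v :: b) (b ++ [u])).sum := by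
  induction b generalizing v with
  | nil => simp [walkWeight]
  | cons a b ih => simp [walkWeight, ih a]

theorem List.exists_eq_append_of_not_nodup {l : List V} (h : ¬ l.Nodup) :
    ∃ (a : List V) (v : V) (b r : List V), l = a ++ v :: (b ++ v :: r) ∧ (v :: b).Nodup := by
  induction l with
  | nil => simp at h
  | cons x l ih =>
    by_cases hl : l.Nodup
    · have hx : x ∈ l := by
        by_contra hx
        exact h (List.nodup_cons.2 ⟨hx, hl⟩)
      obtain ⟨b, r, rfl⟩ := List.append_of_mem hx
      refine ⟨[], x, b, r, rfl, List.nodup_cons.2 ⟨fun hb => ?_, hl.of_append_left⟩⟩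
      exact (List.nodup_append.1 hl).2.2 x hb x List.mem_cons_self rfl
    · obtain ⟨a, v, b, r, rfl, hb⟩ := ih hl
      exact ⟨x :: a, v, b, r, rfl, hb⟩

theorem List.Nodup.map_formPerm [DecidableEq V] {l : List V} (h : l.Nodup) :
    l.map l.formPerm = l.rotate 1 := by
  apply List.ext_getElem (by simp)
  intro i h1 h2
  rw [List.getElem_map, List.formPerm_apply_getElem _ h, List.getElem_rotate]

variable [Fintype V] [DecidableEq V]

/-- A simple closed walk is the cyclic permutation `formPerm` of its vertices; all other vertices
are fixed and contribute nothing. -/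
theorem walkWeight_cycle_le {c : V → V → ℤ} (h0 : ∀ v, c v v = 0)
    (h : ∀ σ : Equiv.Perm V, ∑ v, c v (σ v) ≤ 0) {v : V} {b : List V} (hb : (v :: b).Nodup) :
    walkWeight c (v :: (b ++ [v])) ≤ 0 := by
  have h1 := hb.map_formPerm
  rw [List.rotate_cons_succ, List.rotate_zero] at h1
  rw [walkWeight_eq_sum_zipWith, ← h1, List.zipWith_map_right, List.zipWith_self]
  refine le_of_eq_of_le ?_ (h (v :: b).formPerm)
  rw [← List.sum_toFinset _ hb]
  refine Finset.sum_subset (Finset.subset_univ _) fun u _ hu => ?_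
  rw [List.formPerm_apply_of_notMem (by simpa using hu), h0]

/-- Cutting a simple cycle out of a walk does not lower its weight, and a walk without repetitions
has at most as many vertices as there are in `V`. -/
theorem walkWeight_le {c : V → V → ℤ} (h0 : ∀ v, c v v = 0)
    (h : ∀ σ : Equiv.Perm V, ∑ v, c v (σ v) ≤ 0) {B : ℤ} (hB0 : 0 ≤ B) (hB : ∀ u v, c u v ≤ B)
    (l : List V) : walkWeight c l ≤ Fintype.card V * B := by
  have hlen : ∀ l : List V, walkWeight c l ≤ l.length * B := by
    intro l
    induction l with
    | nil => simp [walkWeight]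
    | cons a l ih =>
      cases l with
      | nil => simpa [walkWeight] using hB0
      | cons b l =>
        simp only [walkWeight, List.length_cons, Nat.cast_add, Nat.cast_one] at ih ⊢
        nlinarith [hB a b]
  induction hn : l.length using Nat.strong_induction_on generalizing l with
  | _ n ih =>
    by_cases hl : l.Nodup
    · refine (hlen l).trans (mul_le_mul_of_nonneg_right ?_ hB0)
      exact_mod_cast hl.length_le_card
    · obtain ⟨a, v, b, r, rfl, hb⟩ := List.exists_eq_append_of_not_nodup hl
      have h1 := ih (a ++ v :: r).length (by rw [← hn]; simp) _ rfl
      have h2 := walkWeight_cycle_le h0 h hb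
      have h3 := walkWeight_append_cons c (v :: b) v r
      rw [walkWeight_append_cons] at h1 ⊢
      simp only [List.cons_append] at h3
      rw [h3]
      linarith

/-- If no permutation has positive weight, the weights are bounded by differences of a potential. -/
theorem exists_potential (c : V → V → ℤ) (h0 : ∀ v, c v v = 0)
    (h : ∀ σ : Equiv.Perm V, ∑ v, c v (σ v) ≤ 0) : ∃ p : V → ℤ, ∀ u v, c u v ≤ p u - p v := by
  set B : ℤ := ∑ u, ∑ v, |c u v| with hB
  have hcB : ∀ u v, c u v ≤ B := fun u v =>
    (le_abs_self _).trans <| (Finset.single_le_sum (f := fun v => |c u v|)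
      (fun _ _ => abs_nonneg _) (Finset.mem_univ v)).trans <|
      Finset.single_le_sum (f := fun u => ∑ v, |c u v|)
        (fun _ _ => Finset.sum_nonneg fun _ _ => abs_nonneg _) (Finset.mem_univ u)
  have hB0 : 0 ≤ B := Finset.sum_nonneg fun _ _ => Finset.sum_nonneg fun _ _ => abs_nonneg _
  have hbdd : ∀ u, BddAbove (Set.range fun l => walkWeight c (u :: l)) := fun u =>
    ⟨_, by rintro _ ⟨l, rfl⟩; exact walkWeight_le h0 h hB0 hcB _⟩
  -- The potential of `u` is the largest weight of a walk from `u`. Putting the step from `u` to `v`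
  -- before an optimal walk from `v` gives the inequality.
  refine ⟨fun u => sSup (Set.range fun l => walkWeight c (u :: l)), fun u v => ?_⟩
  obtain ⟨l, hl⟩ := Int.csSup_mem (Set.range_nonempty fun l => walkWeight c (v :: l)) (hbdd v)
  have := le_csSup (hbdd u) ⟨v :: l, rfl⟩
  simp only [walkWeight] at this hl
  linarith

end Potential

/-! ### Integral duality for matchings, through an assignment problem. -/

namespace MatchingPref

open Contracts

variable {m n : ℕ}

/-- The index of the worker (side `false`) or the firm (side `true`) of an edge. -/
def end' : Bool → Fin m × Fin n → ℕ
  | false, e => e.1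
  | true, e => e.2

/-- No two edges of `M` share an agent. -/
abbrev IsDisjointEdges (M : Finset (Fin m × Fin n)) : Prop :=
  IsDisjoint (C := Fin m × Fin n) end' M

/-- The agent `z` of side `s` is an endpoint of an edge of `M`. -/
def Covers (M : Finset (Fin m × Fin n)) (s : Bool) (z : ℕ) : Prop :=
  ∃ e ∈ M, end' s e = z

theorem end'_ext {e d : Fin m × Fin n} (h : ∀ s, end' s e = end' s d) : e = d :=
  Prod.ext (Fin.ext (h false)) (Fin.ext (h true))

theorem exists_partner_perm {M : Finset (Fin m × Fin n)} (hM : IsDisjointEdges M) :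
    ∃ μ : Equiv.Perm (Agent m n), (∀ w f, μ (.inl w) = .inr f ↔ (w, f) ∈ M) ∧
      (∀ w f, μ (.inr f) = .inl w ↔ (w, f) ∈ M) ∧ (∀ w w', μ (.inl w) = .inl w' → w' = w) ∧
      ∀ f f', μ (.inr f) = .inr f' → f' = f := by
  classical
  have hw : ∀ {w f f'}, (w, f) ∈ M → (w, f') ∈ M → f = f' := fun h h' =>
    congrArg Prod.snd (hM _ h _ h' false rfl)
  have hf : ∀ {w w' f}, (w, f) ∈ M → (w', f) ∈ M → w = w' := fun h h' =>
    congrArg Prod.fst (hM _ h _ h' true rfl)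
  let g : Agent m n → Agent m n := Sum.elim
    (fun w => if h : ∃ f, (w, f) ∈ M then .inr h.choose else .inl w)
    (fun f => if h : ∃ w, (w, f) ∈ M then .inl h.choose else .inr f)
  have g1 : ∀ {w f}, (w, f) ∈ M → g (.inl w) = .inr f := by
    intro w f h
    have hex : ∃ f, (w, f) ∈ M := ⟨f, h⟩
    simp only [g, Sum.elim_inl, dif_pos hex, hw hex.choose_spec h]
  have g2 : ∀ {w f}, (w, f) ∈ M → g (.inr f) = .inl w := by
    intro w f h
    have hex : ∃ w, (w, f) ∈ M := ⟨w, h⟩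
    simp only [g, Sum.elim_inr, dif_pos hex, hf hex.choose_spec h]
  have g3 : ∀ {w}, (¬ ∃ f, (w, f) ∈ M) → g (.inl w) = .inl w := fun h => by
    simp only [g, Sum.elim_inl, dif_neg h]
  have g4 : ∀ {f}, (¬ ∃ w, (w, f) ∈ M) → g (.inr f) = .inr f := fun h => by
    simp only [g, Sum.elim_inr, dif_neg h]
  have ginv : Function.Involutive g := by
    rintro (w | f)
    · by_cases h : ∃ f, (w, f) ∈ M
      · obtain ⟨f, h⟩ := h
        rw [g1 h, g2 h]
      · rw [g3 h, g3 h]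
    · by_cases h : ∃ w, (w, f) ∈ M
      · obtain ⟨w, h⟩ := h
        rw [g2 h, g1 h]
      · rw [g4 h, g4 h]
  refine ⟨ginv.toPerm, fun w f => ⟨fun h => ?_, g1⟩, fun w f => ⟨fun h => ?_, g2⟩,
    fun w w' h => ?_, fun f f' h => ?_⟩ <;>
    rw [Function.Involutive.coe_toPerm] at h
  · by_cases hex : ∃ f, (w, f) ∈ M
    · obtain ⟨f', h'⟩ := hex
      rw [g1 h'] at h
      rwa [← Sum.inr_injective h]
    · rw [g3 hex] at h
      cases h
  · by_cases hex : ∃ w, (w, f) ∈ M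
    · obtain ⟨w', h'⟩ := hex
      rw [g2 h'] at h
      rwa [← Sum.inl_injective h]
    · rw [g4 hex] at h
      cases h
  · by_cases hex : ∃ f, (w, f) ∈ M
    · obtain ⟨f', h'⟩ := hex
      rw [g1 h'] at h
      cases h
    · rw [g3 hex] at h
      exact (Sum.inl_injective h).symm
  · by_cases hex : ∃ w, (w, f) ∈ M
    · obtain ⟨w', h'⟩ := hex
      rw [g2 h'] at h
      cases h
    · rw [g4 hex] at h
      exact (Sum.inr_injective h).symm

open Classical in
/-- The weight of a matching `N`: edge weights, minus `K` for every agent that is covered by `M`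
and not by `N`. -/
noncomputable def totalWeight (wt : Fin m × Fin n → ℤ) (K : ℤ) (M N : Finset (Fin m × Fin n)) : ℤ :=
  ∑ e ∈ N, wt e - ∑ s : Bool, ∑ e ∈ M, if Covers N s (end' s e) then 0 else K

open Classical in
/-- The weights of the assignment problem on the doubled set of agents. -/
noncomputable def assignWeight (E M : Finset (Fin m × Fin n)) (wt : Fin m × Fin n → ℤ) (K B : ℤ) :
    Agent m n → Agent m n → ℤ
  | .inl w, .inr f => if (w, f) ∈ E then wt (w, f) else -B
  | .inl w, .inl w' => if w' = w then (if Covers M false w then -K else 0) else -B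
  | .inr f, .inr f' => if f' = f then (if Covers M true f then -K else 0) else -B
  | .inr _, .inl _ => 0

/-- The permutation `τ` assigns no forbidden pair. -/
def Admissible (E : Finset (Fin m × Fin n)) (τ : Equiv.Perm (Agent m n)) : Prop :=
  (∀ w f, τ (.inl w) = .inr f → (w, f) ∈ E) ∧ (∀ w w', τ (.inl w) = .inl w' → w' = w) ∧
    ∀ f f', τ (.inr f) = .inr f' → f' = f

open Classical in
/-- The edges that `τ` assigns. -/
noncomputable def permEdges (τ : Equiv.Perm (Agent m n)) : Finset (Fin m × Fin n) :=
  {e | τ (.inl e.1) = .inr e.2}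

theorem mem_permEdges {τ : Equiv.Perm (Agent m n)} {w : Fin m} {f : Fin n} :
    (w, f) ∈ permEdges τ ↔ τ (.inl w) = .inr f := by
  simp [permEdges]

theorem isDisjointEdges_permEdges (τ : Equiv.Perm (Agent m n)) : IsDisjointEdges (permEdges τ) := by
  rintro ⟨w, f⟩ h ⟨w', f'⟩ h' s hs
  have h1 := mem_permEdges.1 h
  have h2 := mem_permEdges.1 h'
  cases s with
  | false =>
    obtain rfl : w = w' := Fin.ext hs
    rw [h1] at h2
    rw [Sum.inr_injective h2]
  | true =>
    obtain rfl : f = f' := Fin.ext hs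
    rw [← h1] at h2
    rw [Sum.inl_injective (τ.injective h2)]

theorem covers_false {M : Finset (Fin m × Fin n)} {w : Fin m} :
    Covers M false w ↔ ∃ f, (w, f) ∈ M := by
  constructor
  · rintro ⟨⟨w', f⟩, h, hw⟩
    obtain rfl : w' = w := Fin.ext hw
    exact ⟨f, h⟩
  · rintro ⟨f, h⟩
    exact ⟨_, h, rfl⟩

theorem covers_true {M : Finset (Fin m × Fin n)} {f : Fin n} :
    Covers M true f ↔ ∃ w, (w, f) ∈ M := by
  constructor
  · rintro ⟨⟨w, f'⟩, h, hf⟩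
    obtain rfl : f' = f := Fin.ext hf
    exact ⟨w, h⟩
  · rintro ⟨w, h⟩
    exact ⟨_, h, rfl⟩

/-- A sum over the workers covered by a matching. -/
theorem sum_covers_false {M : Finset (Fin m × Fin n)} (hM : IsDisjointEdges M)
    (g : Fin m → ℤ) [∀ w : Fin m, Decidable (Covers M false w)] :
    ∑ w : Fin m, (if Covers M false w then g w else 0) = ∑ e ∈ M, g e.1 := by
  classical
  rw [← Finset.sum_filter, ← Finset.sum_image (s := M) (g := Prod.fst) (f := g)]
  · congr 1
    ext w
    simp [covers_false]
  · intro e he d hd h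
    exact hM e he d hd false (congrArg Fin.val h)

theorem sum_covers_true {M : Finset (Fin m × Fin n)} (hM : IsDisjointEdges M)
    (g : Fin n → ℤ) [∀ f : Fin n, Decidable (Covers M true f)] :
    ∑ f : Fin n, (if Covers M true f then g f else 0) = ∑ e ∈ M, g e.2 := by
  classical
  rw [← Finset.sum_filter, ← Finset.sum_image (s := M) (g := Prod.snd) (f := g)]
  · congr 1
    ext f
    simp [covers_true]
  · intro e he d hd h
    exact hM e he d hd true (congrArg Fin.val h)

-- Admissible permutations encode matchings: a worker or firm row in its own column means an
-- unmatched agent, and the firm rows of matched firms fill the columns of matched workers at no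
-- cost.
open Classical in
theorem sum_assignWeight {E M : Finset (Fin m × Fin n)} (hM : IsDisjointEdges M)
    (wt : Fin m × Fin n → ℤ) (K B : ℤ) {τ : Equiv.Perm (Agent m n)} (hτ : Admissible E τ) :
    ∑ u, assignWeight E M wt K B u (τ u) = totalWeight wt K M (permEdges τ) := by
  obtain ⟨h1, h2, h3⟩ := hτ
  have hdis := isDisjointEdges_permEdges τ
  have hw : ∀ w, assignWeight E M wt K B (.inl w) (τ (.inl w)) =
      (∑ f, if (w, f) ∈ permEdges τ then wt (w, f) else 0) -
        if Covers M false w then (if Covers (permEdges τ) false w then 0 else K) else 0 := by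
    intro w
    cases h : τ (.inl w) with
    | inl w' =>
      obtain rfl := h2 _ _ h
      have hno : ∀ f, (w', f) ∉ permEdges τ := fun f hf => by
        rw [mem_permEdges, h] at hf
        cases hf
      simp only [assignWeight, hno, covers_false, exists_false, if_true, if_false,
        Finset.sum_const_zero]
      split_ifs <;> simp
    | inr f =>
      have hmem : ∀ f', (w, f') ∈ permEdges τ ↔ f' = f := fun f' => by
        rw [mem_permEdges, h, Sum.inr.injEq, eq_comm]
      simp [assignWeight, hmem, covers_false, h1 _ _ h]
  have hf : ∀ f, assignWeight E M wt K B (.inr f) (τ (.inr f)) =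
      -if Covers M true f then (if Covers (permEdges τ) true f then 0 else K) else 0 := by
    intro f
    cases h : τ (.inr f) with
    | inl w =>
      have hc : Covers (permEdges τ) true f := by
        obtain ⟨u, hu⟩ := τ.surjective (.inr f)
        cases u with
        | inl w => exact covers_true.2 ⟨w, mem_permEdges.2 hu⟩
        | inr f' =>
          obtain rfl := h3 _ _ hu
          rw [h] at hu
          cases hu
      simp [assignWeight, hc]
    | inr f' =>
      obtain rfl := h3 _ _ h
      have hc : ¬ Covers (permEdges τ) true f' := fun hc => by
        obtain ⟨w, hw⟩ := covers_true.1 hc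
        rw [mem_permEdges, ← h] at hw
        cases τ.injective hw
      simp only [assignWeight, hc, if_true, if_false]
      split_ifs <;> simp
  rw [Fintype.sum_sum_type, Finset.sum_congr rfl fun w _ => hw w, Finset.sum_congr rfl fun f _ => hf f,
    Finset.sum_sub_distrib, Finset.sum_neg_distrib, sum_covers_false hM, sum_covers_true hM,
    totalWeight, Fintype.sum_bool, ← Fintype.sum_prod_type' (f := fun w f =>
      if (w, f) ∈ permEdges τ then wt (w, f) else 0), Finset.sum_ite_mem, Finset.univ_inter]
  have key : ∀ a b c : ℤ, a - b + -c = a - (c + b) := fun a b c => by ring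
  exact key _ _ _

theorem totalWeight_self (wt : Fin m × Fin n → ℤ) (K : ℤ) (M : Finset (Fin m × Fin n)) :
    totalWeight wt K M M = ∑ e ∈ M, wt e := by
  have : ∀ s : Bool, ∀ e ∈ M, Covers M s (end' s e) := fun s e he => ⟨e, he, rfl⟩
  simp +contextual [totalWeight, this]

/-- Linear programming duality for matchings. -/
theorem exists_dual {E M : Finset (Fin m × Fin n)} (hME : M ⊆ E) (hM : IsDisjointEdges M)
    (wt : Fin m × Fin n → ℤ) {K : ℤ} (hK : 0 ≤ K)
    (hopt : ∀ N ⊆ E, IsDisjointEdges N → totalWeight wt K M N ≤ ∑ e ∈ M, wt e) :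
    ∃ y : Bool → ℕ → ℤ, (∀ e ∈ E, wt e ≤ y false (end' false e) + y true (end' true e)) ∧
      (∀ e ∈ M, y false (end' false e) + y true (end' true e) = wt e) ∧
      (∀ s z, -K ≤ y s z) ∧ ∀ s z, ¬ Covers M s z → y s z = 0 := by
  classical
  obtain ⟨μ, μ1, μ2, μ3, μ4⟩ := exists_partner_perm hM
  set W := ∑ e ∈ M, wt e with hW
  set Y := ∑ e, |wt e| with hY
  have hY0 : 0 ≤ Y := Finset.sum_nonneg fun _ _ => abs_nonneg _
  -- One forbidden pair costs `B`. This outweighs all other entries, each at most `Y`, and leaves a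
  -- total of at most `-|W|`.
  set B := Fintype.card (Agent m n) * Y + |W| with hB
  set c0 := assignWeight E M wt K B with hc0
  have hB0 : 0 ≤ B := by positivity
  have hc0Y : ∀ u v, c0 u v ≤ Y := by
    have hwt : ∀ e, wt e ≤ Y := fun e => (le_abs_self _).trans
      (Finset.single_le_sum (f := fun e => |wt e|) (fun _ _ => abs_nonneg _) (Finset.mem_univ e))
    rintro (u | u) (v | v) <;> simp only [hc0, assignWeight] <;> (try split_ifs) <;>
      first | exact hwt _ | linarith
  have hperm : ∀ τ : Equiv.Perm (Agent m n), ∑ u, c0 u (τ u) ≤ W := by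
    intro τ
    by_cases hτ : Admissible E τ
    · rw [hc0, sum_assignWeight hM wt K B hτ]
      refine hopt _ (fun e he => ?_) (isDisjointEdges_permEdges τ)
      exact hτ.1 _ _ (mem_permEdges.1 he)
    · have : ∃ u, c0 u (τ u) = -B := by
        by_contra hno
        push Not at hno
        refine hτ ⟨fun w f h => ?_, fun w w' h => ?_, fun f f' h => ?_⟩
        · by_contra hE
          exact hno (.inl w) (by rw [h]; simp only [hc0, assignWeight, if_neg hE])
        · by_contra hE
          exact hno (.inl w) (by rw [h]; simp only [hc0, assignWeight, if_neg hE])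
        · by_contra hE
          exact hno (.inr f) (by rw [h]; simp only [hc0, assignWeight, if_neg hE])
      obtain ⟨u, hu⟩ := this
      rw [← Finset.add_sum_erase _ _ (Finset.mem_univ u), hu]
      have h1 : ∑ v ∈ Finset.univ.erase u, c0 v (τ v) ≤ Fintype.card (Agent m n) * Y := by
        refine (Finset.sum_le_card_nsmul _ _ Y fun v _ => hc0Y v _).trans ?_
        rw [nsmul_eq_mul]
        refine mul_le_mul_of_nonneg_right ?_ hY0
        exact_mod_cast Finset.card_le_univ _
      have := neg_abs_le W
      linarith
  have hμadm : Admissible E μ := ⟨fun w f h => hME ((μ1 w f).1 h), μ3, μ4⟩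
  have hμW : ∑ u, c0 u (μ u) = W := by
    rw [hc0, sum_assignWeight hM wt K B hμadm]
    have : permEdges μ = M := by
      ext ⟨w, f⟩
      rw [mem_permEdges, μ1]
    rw [this, totalWeight_self]
  -- The step from `u` to `v` lets row `u` take the column that `μ` gives to row `v`. A permutation
  -- of the rows cannot gain because `μ` is optimal. The potential is the dual of the rows, and `c0
  -- v (μ v) - p v` is the dual of the column `μ v`.
  obtain ⟨p, hp⟩ := exists_potential (fun u v => c0 u (μ v) - c0 v (μ v)) (fun v => sub_self _) (by
    intro σ
    have h1 : ∑ v, c0 (σ v) (μ (σ v)) = ∑ v, c0 v (μ v) := Equiv.sum_comp σ fun v => c0 v (μ v)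
    have h2 := hperm (σ.trans μ)
    simp only [Equiv.trans_apply] at h2
    rw [Finset.sum_sub_distrib, h1, hμW]
    linarith)
  have hunW : ∀ w : Fin m, ¬ Covers M false w → μ (.inl w) = .inl w := by
    intro w hw
    cases h : μ (.inl w) with
    | inl w' => rw [μ3 _ _ h]
    | inr f => exact absurd (covers_false.2 ⟨f, (μ1 _ _).1 h⟩) hw
  have hunF : ∀ f : Fin n, ¬ Covers M true f → μ (.inr f) = .inr f := by
    intro f hf
    cases h : μ (.inr f) with
    | inl w => exact absurd (covers_true.2 ⟨w, (μ2 _ _).1 h⟩) hf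
    | inr f' => rw [μ4 _ _ h]
  -- Firm rows meet worker columns in entries 0, which separates the two families of duals. Shifting
  -- row duals by `-a` and column duals by `a` makes firm rows and worker columns nonnegative, and
  -- zero at matched agents. One value per agent remains: the row of a worker and the column of a
  -- firm.
  obtain ⟨a, ha1, ha2⟩ : ∃ a : ℤ, (∀ w, p (μ (.inl w)) ≤ a) ∧ ∀ f, a ≤ p (.inr f) := by
    have key : ∀ w f, p (μ (.inl w)) ≤ p (.inr f) := by
      intro w f
      by_cases hw : Covers M false w
      · obtain ⟨f', hf'⟩ := covers_false.1 hw
        have := hp (.inr f) (.inr f')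
        rw [(μ1 _ _).2 hf']
        rw [(μ2 _ _).2 hf'] at this
        simp only [hc0, assignWeight] at this
        linarith
      · have := hp (.inr f) (.inl w)
        rw [hunW w hw] at this ⊢
        simp only [hc0, assignWeight, if_neg hw] at this
        simp at this
        linarith
    rcases isEmpty_or_nonempty (Fin n) with hn | hn
    · rcases isEmpty_or_nonempty (Fin m) with hm | hm
      · exact ⟨0, fun w => hm.elim w, fun f => hn.elim f⟩
      · obtain ⟨w, hw⟩ := Finite.exists_max fun w : Fin m => p (μ (.inl w))
        exact ⟨_, hw, fun f => hn.elim f⟩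
    · obtain ⟨f, hf⟩ := Finite.exists_min fun f : Fin n => p (.inr f)
      exact ⟨_, fun w => key w f, hf⟩
  have hMa : ∀ {w f}, (w, f) ∈ M → p (.inr f) = a := fun {w f} h => by
    have := ha1 w
    rw [(μ1 _ _).2 h] at this
    exact le_antisymm this (ha2 f)
  have hcE : ∀ {w f}, (w, f) ∈ E → c0 (.inl w) (.inr f) = wt (w, f) := fun {w f} h => by
    simp only [hc0, assignWeight, if_pos h]
  let yW : Fin m → ℤ := fun w => if Covers M false w then p (.inl w) - a else 0
  let yF : Fin n → ℤ := fun f =>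
    if Covers M true f then c0 (μ (.inr f)) (.inr f) - p (μ (.inr f)) + a else 0
  let y : Bool → ℕ → ℤ := fun s z => match s with
    | false => if h : z < m then yW ⟨z, h⟩ else 0
    | true => if h : z < n then yF ⟨z, h⟩ else 0
  have hyW : ∀ e : Fin m × Fin n, y false (end' false e) = yW e.1 := fun e => by
    simp [y, end']
  have hyF : ∀ e : Fin m × Fin n, y true (end' true e) = yF e.2 := fun e => by
    simp [y, end']
  have yW1 : ∀ {w f}, (w, f) ∈ M → yW w = p (.inl w) - a := fun {w f} h =>
    if_pos (covers_false.2 ⟨f, h⟩)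
  have yF1 : ∀ {w f}, (w, f) ∈ M → yF f = wt (w, f) - p (.inl w) + a := fun {w f} h => by
    simp only [yF]
    rw [if_pos (covers_true.2 ⟨w, h⟩), (μ2 _ _).2 h, hcE (hME h)]
  refine ⟨y, ?_, ?_, ?_, ?_⟩
  · rintro ⟨w, f⟩ he
    rw [hyW, hyF]
    change _ ≤ yW w + yF f
    by_cases hw : Covers M false w
    · obtain ⟨f', hf'⟩ := covers_false.1 hw
      rw [yW1 hf']
      by_cases hf : Covers M true f
      · obtain ⟨w', hw'⟩ := covers_true.1 hf
        have := hp (.inl w) (.inl w')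
        rw [(μ1 _ _).2 hw', hcE he, hcE (hME hw')] at this
        rw [yF1 hw']
        linarith
      · have := hp (.inl w) (.inr f)
        rw [hunF f hf, hcE he] at this
        simp only [hc0, assignWeight, if_neg hf, if_true] at this
        have h2 : yF f = 0 := if_neg hf
        have := ha2 f
        rw [h2]
        linarith
    · have h1 : yW w = 0 := if_neg hw
      have h2 := ha1 w
      rw [hunW w hw] at h2
      rw [h1]
      by_cases hf : Covers M true f
      · obtain ⟨w', hw'⟩ := covers_true.1 hf
        have := hp (.inl w) (.inl w')
        rw [(μ1 _ _).2 hw', hcE he, hcE (hME hw')] at this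
        rw [yF1 hw']
        linarith
      · have := hp (.inl w) (.inr f)
        rw [hunF f hf, hcE he] at this
        simp only [hc0, assignWeight, if_neg hf, if_true] at this
        have h2 : yF f = 0 := if_neg hf
        have := ha2 f
        rw [h2]
        linarith
  · rintro ⟨w, f⟩ he
    rw [hyW, hyF, yW1 he, yF1 he]
    ring
  · intro s z
    have hcov : ∀ {w f}, (w, f) ∈ M → -K ≤ yW w ∧ -K ≤ yF f := by
      intro w f h
      have h3 := hMa h
      have h4 := hp (.inl w) (.inr f)
      have h5 := hp (.inr f) (.inl w)
      rw [(μ2 _ _).2 h] at h4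
      rw [(μ1 _ _).2 h, hcE (hME h)] at h5
      simp only [hc0, assignWeight, if_pos (covers_false.2 ⟨f, h⟩), if_true] at h4
      simp only [hc0, assignWeight, if_pos (covers_true.2 ⟨w, h⟩), if_true] at h5
      rw [yW1 h, yF1 h]
      constructor <;> linarith
    cases s with
    | false =>
      by_cases hz : z < m
      · simp only [y, dif_pos hz]
        by_cases hw : Covers M false (⟨z, hz⟩ : Fin m)
        · obtain ⟨f, hf⟩ := covers_false.1 hw
          exact (hcov hf).1
        · simp only [yW, if_neg hw]
          linarith
      · simp only [y, dif_neg hz]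
        linarith
    | true =>
      by_cases hz : z < n
      · simp only [y, dif_pos hz]
        by_cases hw : Covers M true (⟨z, hz⟩ : Fin n)
        · obtain ⟨w, hw⟩ := covers_true.1 hw
          exact (hcov hw).2
        · simp only [yF, if_neg hw]
          linarith
      · simp only [y, dif_neg hz]
        linarith
  · intro s z hz
    cases s with
    | false =>
      by_cases h : z < m
      · simp only [y, dif_pos h]
        exact if_neg hz
      · simp only [y, dif_neg h]
    | true =>
      by_cases h : z < n
      · simp only [y, dif_pos h]
        exact if_neg hz
      · simp only [y, dif_neg h]

end MatchingPref

/-! ### Votes and the popularity margin as the weight of a matching. -/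

namespace MatchingPref

open Contracts

variable {m n : ℕ}

theorem idxOf_map_eq {α β : Type*} [BEq α] [BEq β] {g : α → β}
    (hg : ∀ a b, (g a == g b) = (a == b)) (l : List α) (a : α) :
    (l.map g).idxOf (g a) = l.idxOf a := by
  induction l with
  | nil => rfl
  | cons b l ih => simp only [List.map_cons, List.idxOf_cons, ih, hg]

theorem idxOf_map_inl (l : List (Fin m)) (a : Fin m) :
    (l.map (Sum.inl : Fin m → Agent m n)).idxOf (Sum.inl a) = l.idxOf a :=
  idxOf_map_eq (g := (Sum.inl : Fin m → Agent m n)) (fun _ _ => rfl) l a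

theorem idxOf_map_inr (l : List (Fin n)) (a : Fin n) :
    (l.map (Sum.inr : Fin n → Agent m n)).idxOf (Sum.inr a) = l.idxOf a :=
  idxOf_map_eq (g := (Sum.inr : Fin n → Agent m n)) (fun _ _ => rfl) l a

section Votes

variable {Γ : Type*} [LinearOrder Γ]

open Classical in
/-- The vote of the agent of `e` on side `s` for `e` against its partner in `M`. -/
noncomputable def edgeVote (rk : Bool → Fin m × Fin n → Γ) (M : Finset (Fin m × Fin n)) (s : Bool)
    (e : Fin m × Fin n) : ℤ :=
  if ∃ d ∈ M, end' s d = end' s e ∧ rk s d < rk s e then -1 else if e ∈ M then 0 else 1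

/-- The votes of both endpoints of `e` for `e` against their partners in `M`. -/
noncomputable def edgeGain (rk : Bool → Fin m × Fin n → Γ) (M : Finset (Fin m × Fin n))
    (e : Fin m × Fin n) : ℤ :=
  edgeVote rk M false e + edgeVote rk M true e

variable {rk : Bool → Fin m × Fin n → Γ} {M E : Finset (Fin m × Fin n)}

theorem edgeVote_eq_neg_one {s : Bool} {e d : Fin m × Fin n} (hd : d ∈ M)
    (h : end' s d = end' s e) (hlt : rk s d < rk s e) : edgeVote rk M s e = -1 :=
  if_pos ⟨d, hd, h, hlt⟩

theorem edgeVote_of_mem (hM : IsDisjointEdges M) {s : Bool} {e : Fin m × Fin n} (he : e ∈ M) :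
    edgeVote rk M s e = 0 := by
  rw [edgeVote, if_neg, if_pos he]
  rintro ⟨d, hd, h, hlt⟩
  rw [hM d hd e he s h] at hlt
  exact lt_irrefl _ hlt

theorem edgeGain_of_mem (hM : IsDisjointEdges M) {e : Fin m × Fin n} (he : e ∈ M) :
    edgeGain rk M e = 0 := by
  rw [edgeGain, edgeVote_of_mem hM he, edgeVote_of_mem hM he, add_zero]

theorem edgeVote_of_not_mem {s : Bool} {e : Fin m × Fin n} (he : e ∉ M) :
    edgeVote rk M s e = 1 ∨ edgeVote rk M s e = -1 := by
  rw [edgeVote, if_neg he]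
  split_ifs <;> simp

theorem edgeVote_eq_one {s : Bool} {e : Fin m × Fin n} (he : e ∉ M)
    (h : ∀ d ∈ M, end' s d = end' s e → ¬ rk s d < rk s e) : edgeVote rk M s e = 1 := by
  rw [edgeVote, if_neg, if_neg he]
  rintro ⟨d, hd, h1, h2⟩
  exact h d hd h1 h2

theorem exists_of_edgeVote_neg {s : Bool} {e : Fin m × Fin n} (h : edgeVote rk M s e = -1) :
    ∃ d ∈ M, end' s d = end' s e ∧ rk s d < rk s e := by
  by_contra hno
  rw [edgeVote, if_neg hno] at h
  split_ifs at h

theorem edgeVote_le_one (s : Bool) (e : Fin m × Fin n) : edgeVote rk M s e ≤ 1 := by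
  rw [edgeVote]
  split_ifs <;> simp

theorem not_mem_of_not_covers {s : Bool} {e : Fin m × Fin n} (h : ¬ Covers M s (end' s e)) :
    e ∉ M :=
  fun he => h ⟨e, he, rfl⟩

theorem edgeVote_of_not_covers {s : Bool} {e : Fin m × Fin n} (h : ¬ Covers M s (end' s e)) :
    edgeVote rk M s e = 1 :=
  edgeVote_eq_one (not_mem_of_not_covers h) fun d hd h1 _ => h ⟨d, hd, h1⟩

end Votes

/-- The position of the edge in the preference list of its endpoint on side `s`. -/
def Instance.rank (I : Instance m n) : Bool → Fin m × Fin n → ℕ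
  | false, e => (I.workerPref e.1).idxOf e.2
  | true, e => (I.firmPref e.2).idxOf e.1

theorem Instance.rank_inj (I : Instance m n) {e d : Fin m × Fin n} (he : e ∈ I.edges) {s : Bool}
    (h : end' s e = end' s d) (hr : I.rank s e = I.rank s d) : e = d := by
  obtain ⟨w, f⟩ := e
  obtain ⟨w', f'⟩ := d
  cases s with
  | false =>
    obtain rfl : w = w' := Fin.ext h
    rw [(List.idxOf_inj ((I.mem_workerPref w f).2 he)).1 hr]
  | true =>
    obtain rfl : f = f' := Fin.ext h
    rw [(List.idxOf_inj ((I.mem_firmPref f w).2 he)).1 hr]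

/-- The side and the index of an agent. -/
def agentCode : Agent m n → Bool × ℕ
  | .inl w => (false, w)
  | .inr f => (true, f)

theorem Instance.isMatching_iff {I : Instance m n} {M : Finset (Fin m × Fin n)} :
    I.IsMatching M ↔ M ⊆ I.edges ∧ IsDisjointEdges M := by
  refine and_congr_right fun _ => ⟨fun h e he d hd s hs => ?_, fun h e he d hd hne => ⟨?_, ?_⟩⟩
  · by_contra hne
    cases s with
    | false => exact (h e he d hd hne).1 (Fin.ext hs)
    | true => exact (h e he d hd hne).2 (Fin.ext hs)
  · exact fun h1 => hne (h e he d hd false (congrArg Fin.val h1))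
  · exact fun h1 => hne (h e he d hd true (congrArg Fin.val h1))

theorem isMatched_iff {M : Finset (Fin m × Fin n)} {x : Agent m n} :
    IsMatched M x ↔ Covers M (agentCode x).1 (agentCode x).2 := by
  cases x with
  | inl w =>
    rw [agentCode, covers_false]
    constructor
    · rintro ⟨y | f, h⟩
      · cases h
      · exact ⟨f, h⟩
    · rintro ⟨f, h⟩
      exact ⟨.inr f, h⟩
  | inr f =>
    rw [agentCode, covers_true]
    constructor
    · rintro ⟨w | y, h⟩
      · exact ⟨w, h⟩
      · cases h
    · rintro ⟨w, h⟩
      exact ⟨.inl w, h⟩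

theorem Instance.prefersMatching_iff {I : Instance m n} {M N : Finset (Fin m × Fin n)}
    (hM : M ⊆ I.edges) (hN : N ⊆ I.edges) {x : Agent m n} {s : Bool} {z : ℕ}
    (hx : agentCode x = (s, z)) :
    I.PrefersMatching x M N ↔ (Covers M s z ∧ ¬ Covers N s z) ∨
      ∃ e ∈ M, ∃ d ∈ N, end' s e = z ∧ end' s d = z ∧ I.rank s e < I.rank s d := by
  rw [Instance.PrefersMatching, isMatched_iff, isMatched_iff, hx]
  refine or_congr_right ?_
  cases x with
  | inl w =>
    cases hx
    constructor
    · rintro ⟨y | f, y' | f', h, h', hp⟩ <;> try first | cases h | cases h'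
      refine ⟨_, h, _, h', rfl, rfl, ?_⟩
      have := hp.2.2
      simpa only [Instance.pref, Instance.rank, idxOf_map_inr] using this
    · rintro ⟨⟨w1, f⟩, h, ⟨w2, f'⟩, h', h1, h2, hlt⟩
      obtain rfl : w1 = w := Fin.ext h1
      obtain rfl : w2 = w1 := Fin.ext h2
      refine ⟨.inr f, .inr f', h, h', ?_, ?_, ?_⟩
      · exact List.mem_map_of_mem ((I.mem_workerPref _ _).2 (hM h))
      · exact List.mem_map_of_mem ((I.mem_workerPref _ _).2 (hN h'))
      · simpa only [Instance.pref, Instance.rank, idxOf_map_inr] using hlt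
  | inr f =>
    cases hx
    constructor
    · rintro ⟨w | y, w' | y', h, h', hp⟩ <;> try first | cases h | cases h'
      refine ⟨_, h, _, h', rfl, rfl, ?_⟩
      have := hp.2.2
      simpa only [Instance.pref, Instance.rank, idxOf_map_inl] using this
    · rintro ⟨⟨w, f1⟩, h, ⟨w', f2⟩, h', h1, h2, hlt⟩
      obtain rfl : f1 = f := Fin.ext h1
      obtain rfl : f2 = f1 := Fin.ext h2
      refine ⟨.inl w, .inl w', h, h', ?_, ?_, ?_⟩
      · exact List.mem_map_of_mem ((I.mem_firmPref _ _).2 (hM h))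
      · exact List.mem_map_of_mem ((I.mem_firmPref _ _).2 (hN h'))
      · simpa only [Instance.pref, Instance.rank, idxOf_map_inl] using hlt

-- Splits the vote by the situation under `N`: an agent that loses its partner votes 1 for `M`, and
-- an agent with an edge in `N` casts the opposite of the vote for that edge. The second kind is
-- charged to the edges of `N`, the first becomes the penalty in `totalWeight`.
open Classical in
theorem Instance.vote_eq {I : Instance m n} {M N : Finset (Fin m × Fin n)}
    (hM : I.IsMatching M) (hN : I.IsMatching N) {x : Agent m n} {s : Bool} {z : ℕ}
    (hx : agentCode x = (s, z)) :
    I.vote x M N = (if Covers M s z then (if Covers N s z then 0 else 1) else 0) -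
      ∑ e ∈ N, if end' s e = z then edgeVote I.rank M s e else 0 := by
  obtain ⟨hME, hMd⟩ := isMatching_iff.1 hM
  obtain ⟨hNE, hNd⟩ := isMatching_iff.1 hN
  rw [Instance.vote, prefersMatching_iff hME hNE hx, prefersMatching_iff hNE hME hx]
  by_cases hNz : Covers N s z
  · obtain ⟨d, hd, hdz⟩ := hNz
    have hsum : (∑ e ∈ N, if end' s e = z then edgeVote I.rank M s e else 0) =
        edgeVote I.rank M s d := by
      rw [Finset.sum_eq_single_of_mem d hd, if_pos hdz]
      intro e he hne
      rw [if_neg]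
      exact fun h => hne (hNd e he d hd s (h.trans hdz.symm))
    have hcN : Covers N s z := ⟨d, hd, hdz⟩
    rw [hsum]
    by_cases hMz : Covers M s z
    · obtain ⟨e, he, hez⟩ := hMz
      have hcM : Covers M s z := ⟨e, he, hez⟩
      have key1 : (∃ e' ∈ M, ∃ d' ∈ N, end' s e' = z ∧ end' s d' = z ∧
          I.rank s e' < I.rank s d') ↔ I.rank s e < I.rank s d := by
        constructor
        · rintro ⟨e', he', d', hd', h1, h2, h3⟩
          rwa [hMd e' he' e he s (h1.trans hez.symm), hNd d' hd' d hd s (h2.trans hdz.symm)] at h3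
        · exact fun h => ⟨e, he, d, hd, hez, hdz, h⟩
      have key2 : (∃ d' ∈ N, ∃ e' ∈ M, end' s d' = z ∧ end' s e' = z ∧
          I.rank s d' < I.rank s e') ↔ I.rank s d < I.rank s e := by
        constructor
        · rintro ⟨d', hd', e', he', h2, h1, h3⟩
          rwa [hMd e' he' e he s (h1.trans hez.symm), hNd d' hd' d hd s (h2.trans hdz.symm)] at h3
        · exact fun h => ⟨d, hd, e, he, hdz, hez, h⟩
      rw [key1, key2]
      rcases lt_trichotomy (I.rank s e) (I.rank s d) with h | h | h
      · rw [edgeVote_eq_neg_one he (hez.trans hdz.symm) h]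
        simp [hcM, hcN, h]
      · obtain rfl := I.rank_inj (hME he) (hez.trans hdz.symm) h
        rw [edgeVote_of_mem hMd he]
        simp [hcM, hcN]
      · rw [edgeVote_eq_one]
        · simp [hcM, hcN, h, h.le]
        · intro hdM
          rw [hMd d hdM e he s (hdz.trans hez.symm)] at h
          exact lt_irrefl _ h
        · intro e' he' h1
          rw [hMd e' he' e he s ((h1.trans hdz).trans hez.symm)]
          exact not_lt.2 h.le
    · rw [edgeVote_of_not_covers (by rwa [hdz])]
      have : ∀ e ∈ M, end' s e ≠ z := fun e he h => hMz ⟨e, he, h⟩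
      rw [if_neg, if_pos (Or.inl ⟨hcN, hMz⟩), if_neg hMz]
      · simp
      · rintro (⟨h, -⟩ | ⟨e, he, _, _, h, -⟩)
        · exact hMz h
        · exact this e he h
  · have hsum : (∑ e ∈ N, if end' s e = z then edgeVote I.rank M s e else 0) = 0 :=
      Finset.sum_eq_zero fun e he => if_neg fun h => hNz ⟨e, he, h⟩
    have hno : ∀ e ∈ N, end' s e ≠ z := fun e he h => hNz ⟨e, he, h⟩
    rw [hsum]
    by_cases hMz : Covers M s z
    · simp [hMz, hNz]
    · rw [if_neg, if_neg, if_neg hMz, sub_zero]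
      · rintro (⟨h, -⟩ | ⟨e, he, _, _, h, -⟩)
        · exact hNz h
        · exact hno e he h
      · rintro (⟨h, -⟩ | ⟨_, _, e, he, _, h, -⟩)
        · exact hMz h
        · exact hno e he h

theorem Instance.margin_eq {I : Instance m n} {M N : Finset (Fin m × Fin n)}
    (hM : I.IsMatching M) (hN : I.IsMatching N) :
    I.margin M N = -totalWeight (edgeGain I.rank M) 1 M N := by
  classical
  obtain ⟨hME, hMd⟩ := isMatching_iff.1 hM
  have h1 : ∀ w : Fin m, I.vote (.inl w) M N =
      (if Covers M false w then (if Covers N false w then 0 else 1) else 0) -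
        ∑ e ∈ N, if w = e.1 then edgeVote I.rank M false e else 0 := by
    intro w
    rw [I.vote_eq hM hN (s := false) (z := w) rfl]
    simp only [end', Fin.ext_iff, eq_comm]
  have h2 : ∀ f : Fin n, I.vote (.inr f) M N =
      (if Covers M true f then (if Covers N true f then 0 else 1) else 0) -
        ∑ e ∈ N, if f = e.2 then edgeVote I.rank M true e else 0 := by
    intro w
    rw [I.vote_eq hM hN (s := true) (z := w) rfl]
    simp only [end', Fin.ext_iff, eq_comm]
  rw [Instance.margin, Fintype.sum_sum_type, Finset.sum_congr rfl fun w _ => h1 w,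
    Finset.sum_congr rfl fun f _ => h2 f, Finset.sum_sub_distrib, Finset.sum_sub_distrib,
    sum_covers_false hMd, sum_covers_true hMd, Finset.sum_comm (t := N),
    Finset.sum_comm (t := N)]
  simp only [Finset.sum_ite_eq', Finset.mem_univ, if_true]
  rw [totalWeight, Fintype.sum_bool]
  simp only [edgeGain, Finset.sum_add_distrib]
  have key : ∀ a b c d : ℤ, a - b + (c - d) = -(b + d - (c + a)) := fun a b c d => by ring
  rw [key]
  congr!

end MatchingPref

/-! ### Dual certificates of popularity and dominance. -/

namespace MatchingPref

open Contracts

variable {m n : ℕ}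

section Witness

variable {Γ : Type*} [LinearOrder Γ] {rk : Bool → Fin m × Fin n → Γ}
  {E M N : Finset (Fin m × Fin n)}

/-- The sum of `α` over the endpoints of `e`. -/
def endSum (α : Bool → ℕ → ℤ) (e : Fin m × Fin n) : ℤ :=
  α false (end' false e) + α true (end' true e)

/-- A dual certificate for the popularity of `M`. -/
structure IsWitness (rk : Bool → Fin m × Fin n → Γ) (E M : Finset (Fin m × Fin n))
    (α : Bool → ℕ → ℤ) : Prop where
  gain_le : ∀ e ∈ E, edgeGain rk M e ≤ endSum α e
  endSum_eq_zero : ∀ e ∈ M, endSum α e = 0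
  neg_one_le : ∀ s z, -1 ≤ α s z
  eq_zero : ∀ s z, ¬ Covers M s z → α s z = 0

theorem sum_end_image {M : Finset (Fin m × Fin n)} (hM : IsDisjointEdges M) (s : Bool)
    (g : ℕ → ℤ) : ∑ z ∈ M.image (end' s), g z = ∑ e ∈ M, g (end' s e) :=
  Finset.sum_image fun e he d hd h => hM e he d hd s h

/-- Weak duality with the slack kept. The certificate sums to 0 over `M`; agents outside `M` have
value 0, and an agent that only `M` covers has value at least -1, which the penalty 1 absorbs. -/
theorem IsWitness.totalWeight_le {α : Bool → ℕ → ℤ} (hα : IsWitness rk E M α)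
    (hM : IsDisjointEdges M) (hN : IsDisjointEdges N) :
    totalWeight (edgeGain rk M) 1 M N ≤ ∑ e ∈ N, (edgeGain rk M e - endSum α e) := by
  classical
  have side : ∀ s, ∑ e ∈ N, α s (end' s e) ≤
      ∑ e ∈ M, α s (end' s e) + ∑ e ∈ M, if Covers N s (end' s e) then 0 else 1 := by
    intro s
    have hcov : ∀ (U : Finset (Fin m × Fin n)) z, z ∈ U.image (end' s) ↔ Covers U s z := by
      intro U z
      simp [Covers, Finset.mem_image]
    rw [← sum_end_image hN s, ← sum_end_image hM s,
      ← sum_end_image hM s fun z => if Covers N s z then 0 else 1, ← Finset.sum_add_distrib]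
    have h1 : ∑ z ∈ N.image (end' s), α s z =
        ∑ z ∈ N.image (end' s) ∩ M.image (end' s), α s z := by
      refine (Finset.sum_subset Finset.inter_subset_left fun z hz hz' => hα.eq_zero s z ?_).symm
      rw [← hcov]
      exact fun h => hz' (Finset.mem_inter.2 ⟨hz, h⟩)
    rw [h1, Finset.inter_comm, ← Finset.sum_ite_mem]
    refine Finset.sum_le_sum fun z _ => ?_
    simp only [hcov]
    have := hα.neg_one_le s z
    split_ifs <;> linarith
  have h0 : ∑ e ∈ M, α false (end' false e) + ∑ e ∈ M, α true (end' true e) = 0 := by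
    rw [← Finset.sum_add_distrib]
    exact Finset.sum_eq_zero fun e he => hα.endSum_eq_zero e he
  rw [totalWeight, Fintype.sum_bool, Finset.sum_sub_distrib]
  simp only [endSum, Finset.sum_add_distrib]
  have h1 := side false
  have h2 := side true
  linarith

theorem IsWitness.totalWeight_nonpos {α : Bool → ℕ → ℤ} (hα : IsWitness rk E M α)
    (hM : IsDisjointEdges M) (hNE : N ⊆ E) (hN : IsDisjointEdges N) :
    totalWeight (edgeGain rk M) 1 M N ≤ 0 :=
  (hα.totalWeight_le hM hN).trans <| Finset.sum_nonpos fun e he =>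
    sub_nonpos.2 (hα.gain_le e (hNE he))

theorem IsWitness.partner {α : Bool → ℕ → ℤ} (hα : IsWitness rk E M α) {s : Bool} {z : ℕ}
    (h : Covers M s z) : α s z = -1 ∨ α s z = 0 ∨ α s z = 1 := by
  obtain ⟨e, he, rfl⟩ := h
  have h1 := hα.endSum_eq_zero e he
  have h2 := hα.neg_one_le false (end' false e)
  have h3 := hα.neg_one_le true (end' true e)
  rw [endSum] at h1
  cases s <;> omega

/-- A larger matching has an edge whose worker is unmatched in `M`. That worker has value 0 and
votes 1, so the gain of the edge is 0 or 2. The other endpoint must then have value 1 and the gain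
must be 0, so there is slack on this edge. -/
theorem IsWitness.totalWeight_neg {α : Bool → ℕ → ℤ} (hα : IsWitness rk E M α)
    (hα0 : ∀ s z, Covers M s z → α s z ≠ 0)
    (hM : IsDisjointEdges M) (hNE : N ⊆ E) (hN : IsDisjointEdges N) (hcard : M.card < N.card) :
    totalWeight (edgeGain rk M) 1 M N < 0 := by
  classical
  obtain ⟨e, he, hcov⟩ : ∃ e ∈ N, ¬ Covers M false (end' false e) := by
    by_contra! hno
    have h1 : N.image (end' false) ⊆ M.image (end' false) := by
      intro z hz
      obtain ⟨e, he, rfl⟩ := Finset.mem_image.1 hz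
      obtain ⟨d, hd, h⟩ := hno e he
      exact Finset.mem_image.2 ⟨d, hd, h⟩
    have h2 := Finset.card_le_card h1
    rw [Finset.card_image_of_injOn fun e he d hd h => hN e he d hd false h,
      Finset.card_image_of_injOn fun e he d hd h => hM e he d hd false h] at h2
    omega
  refine (hα.totalWeight_le hM hN).trans_lt ?_
  refine Finset.sum_neg' (fun d hd => sub_nonpos.2 (hα.gain_le d (hNE hd))) ⟨e, he, ?_⟩
  have h1 := hα.gain_le e (hNE he)
  have h2 := hα.eq_zero false _ hcov
  have h3 : edgeVote rk M false e = 1 := edgeVote_of_not_covers hcov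
  rw [edgeGain, h3, endSum, h2] at h1 ⊢
  by_cases hc : Covers M true (end' true e)
  · have h4 := hα0 true _ hc
    have h5 := hα.partner hc
    rcases edgeVote_of_not_mem (rk := rk) (s := true) (not_mem_of_not_covers hcov) with h | h <;>
      rw [h] at h1 ⊢ <;> omega
  · have h4 := hα.eq_zero true _ hc
    have h5 : edgeVote rk M true e = 1 := edgeVote_of_not_covers hc
    rw [h4, h5] at h1
    omega

theorem exists_isWitness (hME : M ⊆ E) (hM : IsDisjointEdges M)
    (h : ∀ N ⊆ E, IsDisjointEdges N → totalWeight (edgeGain rk M) 1 M N ≤ 0) :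
    ∃ α, IsWitness rk E M α := by
  have h0 : ∑ e ∈ M, edgeGain rk M e = 0 :=
    Finset.sum_eq_zero fun e he => edgeGain_of_mem hM he
  obtain ⟨y, h1, h2, h3, h4⟩ := exists_dual hME hM (edgeGain rk M) zero_le_one
    fun N hNE hN => (h N hNE hN).trans h0.ge
  exact ⟨y, h1, fun e he => (h2 e he).trans (edgeGain_of_mem hM he), h3, h4⟩

/-- Size is used as a tie-breaker. For the edge weights `K * edgeGain rk M e + 1` with `K` larger
than every matching, the two hypotheses together make `M` optimal. The dual values are integers with
sum 1 on each edge of `M`, so exactly one of its endpoints is positive; the signs form the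
certificate. -/
theorem exists_isWitness_ne_zero (hME : M ⊆ E) (hM : IsDisjointEdges M)
    (h : ∀ N ⊆ E, IsDisjointEdges N → totalWeight (edgeGain rk M) 1 M N ≤ 0)
    (h' : ∀ N ⊆ E, IsDisjointEdges N → M.card < N.card →
      totalWeight (edgeGain rk M) 1 M N < 0) :
    ∃ α, IsWitness rk E M α ∧ ∀ s z, Covers M s z → α s z ≠ 0 := by
  classical
  set K : ℤ := E.card + 1 with hKdef
  have hK : 0 < K := by positivity
  have hsum : ∑ e ∈ M, (K * edgeGain rk M e + 1) = M.card := by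
    rw [Finset.sum_congr rfl fun e he => by rw [edgeGain_of_mem hM he, mul_zero, zero_add]]
    simp
  obtain ⟨y, h1, h2, h3, h4⟩ := exists_dual hME hM (fun e => K * edgeGain rk M e + 1) hK.le (by
    intro N hNE hN
    have h5 : totalWeight (fun e => K * edgeGain rk M e + 1) K M N =
        K * totalWeight (edgeGain rk M) 1 M N + N.card := by
      simp only [totalWeight, Finset.sum_add_distrib, mul_sub, Finset.mul_sum, mul_ite, mul_zero,
        mul_one, Finset.sum_const, nsmul_eq_mul]
      ring
    rw [h5, hsum]
    by_cases hc : M.card < N.card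
    · have h6 := h' N hNE hN hc
      have h7 : (N.card : ℤ) ≤ E.card := by exact_mod_cast Finset.card_le_card hNE
      nlinarith
    · have h6 := h N hNE hN
      have h7 : (N.card : ℤ) ≤ M.card := by exact_mod_cast not_lt.1 hc
      nlinarith)
  have h2' : ∀ e ∈ M, y false (end' false e) + y true (end' true e) = 1 := fun e he => by
    rw [h2 e he, edgeGain_of_mem hM he, mul_zero, zero_add]
  have hub : ∀ s z, y s z ≤ K + 1 := by
    intro s z
    by_cases hc : Covers M s z
    · obtain ⟨e, he, rfl⟩ := hc
      have h5 := h2' e he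
      have h6 := h3 false (end' false e)
      have h7 := h3 true (end' true e)
      cases s <;> linarith
    · rw [h4 s z hc]
      linarith
  set α : Bool → ℕ → ℤ := fun s z => if Covers M s z then (if 0 < y s z then 1 else -1) else 0
    with hα
  have hα1 : ∀ {s z}, Covers M s z → 0 < y s z → α s z = 1 := fun h h' => by
    simp only [hα, if_pos h, if_pos h']
  have hα2 : ∀ {s z}, Covers M s z → ¬ 0 < y s z → α s z = -1 := fun h h' => by
    simp only [hα, if_pos h, if_neg h']
  have hα3 : ∀ {s z}, ¬ Covers M s z → α s z = 0 := fun h => by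
    simp only [hα, if_neg h]
  refine ⟨α, ⟨fun e he => ?_, fun e he => ?_, fun s z => ?_, fun s z h => hα3 h⟩, fun s z h => ?_⟩
  -- Dual values are at most `K + 1`. Hence gain 2 forces both dual values to be positive, and gain
  -- 0 forces one of them to be positive.
  · have key := h1 e he
    have b1 := hub false (end' false e)
    have b2 := hub true (end' true e)
    rw [endSum]
    by_cases heM : e ∈ M
    · rw [edgeGain_of_mem hM heM]
      have h5 := h2' e heM
      have c1 : Covers M false (end' false e) := ⟨e, heM, rfl⟩
      have c2 : Covers M true (end' true e) := ⟨e, heM, rfl⟩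
      by_cases p1 : 0 < y false (end' false e)
      · rw [hα1 c1 p1]
        by_cases p2 : 0 < y true (end' true e)
        · rw [hα1 c2 p2]; norm_num
        · rw [hα2 c2 p2]; norm_num
      · rw [hα2 c1 p1, hα1 c2 (by linarith)]; norm_num
    · have v1 := edgeVote_of_not_mem (rk := rk) (s := false) heM
      have v2 := edgeVote_of_not_mem (rk := rk) (s := true) heM
      have hα' : ∀ s z, y s z ≤ 0 ∧ α s z = 0 ∧ ¬ Covers M s z ∨ y s z ≤ 0 ∧ α s z = -1 ∧ Covers M s z ∨
          0 < y s z ∧ α s z = 1 := by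
        intro s z
        by_cases hc : Covers M s z
        · by_cases hp : 0 < y s z
          · exact Or.inr (Or.inr ⟨hp, hα1 hc hp⟩)
          · exact Or.inr (Or.inl ⟨not_lt.1 hp, hα2 hc hp, hc⟩)
        · exact Or.inl ⟨(h4 s z hc).le, hα3 hc, hc⟩
      have u1 : ∀ s, ¬ Covers M s (end' s e) → edgeVote rk M s e = 1 :=
        fun s hc => edgeVote_of_not_covers hc
      rw [edgeGain] at key ⊢
      rcases hα' false (end' false e) with ⟨a1, a2, a3⟩ | ⟨a1, a2, a3⟩ | ⟨a1, a2⟩ <;>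
      rcases hα' true (end' true e) with ⟨a4, a5, a6⟩ | ⟨a4, a5, a6⟩ | ⟨a4, a5⟩ <;>
      rw [a2, a5] <;> (try rw [u1 false a3] at key ⊢) <;> (try rw [u1 true a6] at key ⊢) <;>
      rcases v1 with v1 | v1 <;> rcases v2 with v2 | v2 <;> (try rw [v1] at key ⊢) <;>
      (try rw [v2] at key ⊢) <;> norm_num at key ⊢ <;> linarith
  · have h5 := h2' e he
    have c1 : Covers M false (end' false e) := ⟨e, he, rfl⟩
    have c2 : Covers M true (end' true e) := ⟨e, he, rfl⟩
    rw [endSum]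
    by_cases p1 : 0 < y false (end' false e)
    · rw [hα1 c1 p1, hα2 c2 (by omega)]; norm_num
    · rw [hα2 c1 p1, hα1 c2 (by omega)]; norm_num
  · simp only [hα]
    split_ifs <;> norm_num
  · simp only [hα, if_pos h]
    split_ifs <;> norm_num

end Witness

end MatchingPref

/-! ### Certificates and stable sets with one or two levels. -/

namespace MatchingPref

open Contracts

variable {m n : ℕ} {Γ : Type*} [LinearOrder Γ] {rk : Bool → Fin m × Fin n → Γ}
  {E M : Finset (Fin m × Fin n)}

/-- The agents of a contract; a contract is an edge together with a level. -/
def end₂ (s : Bool) (c : (Fin m × Fin n) × ℕ) : ℕ :=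
  end' s c.1

/-- How little side `s` likes the level `l`: workers like `0`, firms like `1`. -/
def levelCost : Bool → ℕ → ℕ
  | false, l => l
  | true, l => 1 - l

/-- Contracts are ranked by their level first. -/
def rank₂ (rk : Bool → Fin m × Fin n → Γ) (s : Bool) (c : (Fin m × Fin n) × ℕ) : ℕ ×ₗ Γ :=
  toLex (levelCost s c.2, rk s c.1)

/-- The contracts with a level below `lam`. -/
def levels (E : Finset (Fin m × Fin n)) (lam : ℕ) : Set ((Fin m × Fin n) × ℕ) :=
  {c | c.1 ∈ E ∧ c.2 < lam}

theorem levels_finite (E : Finset (Fin m × Fin n)) (lam : ℕ) : (levels E lam).Finite := by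
  refine (E ×ˢ Finset.range lam).finite_toSet.subset fun c hc => ?_
  simpa [levels] using hc

theorem levelCost_not {l : ℕ} (h : l < 2) (s : Bool) :
    levelCost (!s) l = 1 - levelCost s l := by
  cases s <;> simp only [Bool.not_false, Bool.not_true, levelCost] <;> omega

theorem levelCost_lt {l : ℕ} (h : l < 2) (s : Bool) : levelCost s l < 2 := by
  cases s <;> simp only [levelCost] <;> omega

theorem levelCost_inj {l l' : ℕ} (h : l < 2) (h' : l' < 2) {s : Bool}
    (heq : levelCost s l = levelCost s l') : l = l' := by
  cases s <;> simp only [levelCost] at heq <;> omega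

theorem exists_levelCost (s : Bool) {i : ℕ} (hi : i < 2) : ∃ l < 2, levelCost s l = i := by
  cases s
  · exact ⟨i, hi, rfl⟩
  · exact ⟨1 - i, by omega, by simp only [levelCost]; omega⟩

theorem rank₂_le_iff {s : Bool} {c d : (Fin m × Fin n) × ℕ} :
    rank₂ rk s c ≤ rank₂ rk s d ↔ levelCost s c.2 < levelCost s d.2 ∨
      levelCost s c.2 = levelCost s d.2 ∧ rk s c.1 ≤ rk s d.1 :=
  Prod.Lex.toLex_le_toLex

theorem rank₂_lt_iff {s : Bool} {c d : (Fin m × Fin n) × ℕ} :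
    rank₂ rk s c < rank₂ rk s d ↔ levelCost s c.2 < levelCost s d.2 ∨
      levelCost s c.2 = levelCost s d.2 ∧ rk s c.1 < rk s d.1 :=
  Prod.Lex.toLex_lt_toLex

theorem rankInj_rank₂ (hinj : RankInj end' rk (E : Set (Fin m × Fin n))) {lam : ℕ} (hlam : lam ≤ 2) :
    RankInj end₂ (rank₂ rk) (levels E lam) := by
  rintro ⟨e, l⟩ ⟨he, hl⟩ ⟨d, l'⟩ ⟨hd, hl'⟩ s h1 h2
  have h3 := Prod.mk.inj (toLex.injective h2)
  obtain rfl := levelCost_inj (by simp only at hl; omega) (by simp only at hl'; omega) h3.1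
  rw [hinj e he d hd s h1 h3.2]

theorem exists_of_edgeVote_nonpos {s : Bool} {e : Fin m × Fin n} (h : edgeVote rk M s e ≤ 0) :
    ∃ d ∈ M, end' s d = end' s e ∧ rk s d ≤ rk s e := by
  by_cases he : e ∈ M
  · exact ⟨e, he, rfl, le_rfl⟩
  · rcases edgeVote_of_not_mem (rk := rk) (s := s) he with h1 | h1
    · omega
    · obtain ⟨d, hd, h2, h3⟩ := exists_of_edgeVote_neg h1
      exact ⟨d, hd, h2, h3.le⟩

/-- The edges of a finite set of contracts. -/
theorem exists_finset_edges {lam : ℕ} {S : Set ((Fin m × Fin n) × ℕ)} (hS : S ⊆ levels E lam) :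
    ∃ M : Finset (Fin m × Fin n), M ⊆ E ∧ ∀ e, e ∈ M ↔ ∃ l, (e, l) ∈ S := by
  classical
  refine ⟨E.filter fun e => ∃ l, (e, l) ∈ S, Finset.filter_subset _ _, fun e => ?_⟩
  rw [Finset.mem_filter]
  exact ⟨fun h => h.2, fun h => ⟨(hS h.choose_spec).1, h⟩⟩

theorem isDisjointEdges_of_isStable {S : Set ((Fin m × Fin n) × ℕ)} (hS : IsDisjoint end₂ S)
    (hM : ∀ e, e ∈ M ↔ ∃ l, (e, l) ∈ S) : IsDisjointEdges M := by
  intro e he d hd s h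
  obtain ⟨l, hl⟩ := (hM e).1 he
  obtain ⟨l', hl'⟩ := (hM d).1 hd
  exact congrArg Prod.fst (hS _ hl _ hl' s h)

/-- An edge that does not block has an endpoint voting against it, so no edge has positive gain. -/
theorem isWitness_of_isStable_one (hinj : RankInj end' rk (E : Set (Fin m × Fin n)))
    {S : Set ((Fin m × Fin n) × ℕ)} (hS : IsStable end₂ (rank₂ rk) (levels E 1) S)
    (hM : ∀ e, e ∈ M ↔ ∃ l, (e, l) ∈ S) : IsWitness rk E M fun _ _ => 0 := by
  have hMd := isDisjointEdges_of_isStable hS.disjoint hM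
  refine ⟨fun e he => ?_, fun _ _ => rfl, fun _ _ => by norm_num, fun _ _ _ => rfl⟩
  change _ ≤ (0 : ℤ)
  by_cases heM : e ∈ M
  · rw [edgeGain_of_mem hMd heM]
  · obtain ⟨c, hc, s, h1, h2⟩ := hS.dominates (e, 0) ⟨he, zero_lt_one⟩
    have hc2 : c.2 = 0 := Nat.lt_one_iff.1 (hS.subset hc).2
    have hcM : c.1 ∈ M := (hM _).2 ⟨c.2, hc⟩
    rw [rank₂_le_iff, hc2] at h2
    have h3 : edgeVote rk M s e = -1 := by
      refine edgeVote_eq_neg_one hcM h1 (lt_of_le_of_ne (by simpa using h2) fun heq => heM ?_)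
      rw [← hinj c.1 (hS.subset hc).1 e he s h1 heq]
      exact hcM
    have h4 := edgeVote_le_one (rk := rk) (M := M) (!s) e
    rw [edgeGain]
    cases s <;> simp only [Bool.not_false, Bool.not_true] at h4 <;> omega

/-- A matched agent gets 1 if its contract is on the level that its side likes, and -1 otherwise;
the two ends of a contract thus cancel. That neither copy of an edge blocks yields the two
constraints that bound its gain. -/
theorem exists_isWitness_of_isStable_two (hinj : RankInj end' rk (E : Set (Fin m × Fin n)))
    {S : Set ((Fin m × Fin n) × ℕ)} (hS : IsStable end₂ (rank₂ rk) (levels E 2) S)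
    (hM : ∀ e, e ∈ M ↔ ∃ l, (e, l) ∈ S) :
    ∃ α, IsWitness rk E M α ∧ ∀ s z, Covers M s z → α s z ≠ 0 := by
  classical
  have hMd := isDisjointEdges_of_isStable hS.disjoint hM
  set α : Bool → ℕ → ℤ := fun s z => if ∃ c ∈ S, end₂ s c = z ∧ levelCost s c.2 = 0 then 1
    else if Covers M s z then -1 else 0 with hα
  have hα1 : ∀ s, ∀ c ∈ S, levelCost s c.2 = 0 → α s (end₂ s c) = 1 := fun s c hc h =>
    if_pos ⟨c, hc, rfl, h⟩
  have hα2 : ∀ s, ∀ c ∈ S, levelCost s c.2 = 1 → α s (end₂ s c) = -1 := by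
    intro s c hc h
    simp only [hα]
    rw [if_neg, if_pos ⟨c.1, (hM _).2 ⟨c.2, hc⟩, rfl⟩]
    rintro ⟨d, hd, h1, h2⟩
    rw [hS.disjoint d hd c hc s h1] at h2
    omega
  have hαge : ∀ s z, -1 ≤ α s z := by
    intro s z
    simp only [hα]
    split_ifs <;> norm_num
  refine ⟨α, ⟨fun e he => ?_, fun e he => ?_, hαge, fun s z h => ?_⟩, fun s z h => ?_⟩
  · by_cases heM : e ∈ M
    · obtain ⟨l, hl⟩ := (hM e).1 heM
      rw [edgeGain_of_mem hMd heM, endSum]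
      have h0 := levelCost_not (hS.subset hl).2 false
      have h1 := levelCost_lt (hS.subset hl).2 false
      simp only [Bool.not_false] at h0
      by_cases h : levelCost false l = 0
      · have h2 := hα1 false _ hl h
        have h3 := hα2 true _ hl (by simp only; omega)
        simp only [end₂] at h2 h3
        omega
      · have h2 := hα2 false _ hl (by simp only at *; omega)
        have h3 := hα1 true _ hl (by simp only at *; omega)
        simp only [end₂] at h2 h3
        omega
    · have key : ∀ s, (α s (end' s e) = 1 ∧ edgeVote rk M s e = -1) ∨
          α (!s) (end' (!s) e) = 1 ∨
          (α (!s) (end' (!s) e) = -1 ∧ edgeVote rk M (!s) e = -1) := by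
        intro s
        -- The copy of `e` on the level that side `s` likes is dominated: at side `s` only by a
        -- better edge on the same level, at the other side by a better level or a better edge.
        obtain ⟨l, hl, hsl⟩ := exists_levelCost s (i := 0) (by norm_num)
        have hsl' := levelCost_not hl s
        rw [hsl] at hsl'
        obtain ⟨c, hc, t, h1, h2⟩ := hS.dominates (e, l) ⟨he, hl⟩
        have hcM : c.1 ∈ M := (hM _).2 ⟨c.2, hc⟩
        have hne : rk t c.1 ≠ rk t e := fun heq => heM <| by
          rw [← hinj c.1 (hS.subset hc).1 e he t h1 heq]
          exact hcM
        rw [rank₂_le_iff] at h2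
        simp only at h2
        have h1' : end₂ t c = end' t e := h1
        have hvote : rk t c.1 ≤ rk t e → edgeVote rk M t e = -1 := fun h =>
          edgeVote_eq_neg_one hcM h1 (lt_of_le_of_ne h hne)
        by_cases hts : t = s
        · subst hts
          rw [hsl] at h2
          have h3 : levelCost t c.2 = 0 ∧ rk t c.1 ≤ rk t e := by simpa using h2
          have h4 := hα1 t c hc h3.1
          rw [h1'] at h4
          exact Or.inl ⟨h4, hvote h3.2⟩
        · have : t = !s := Bool.eq_not.2 hts
          subst this
          rw [hsl'] at h2
          rcases h2 with h2 | ⟨h2, h3⟩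
          · have h4 := hα1 (!s) c hc (by omega)
            rw [h1'] at h4
            exact Or.inr (Or.inl h4)
          · have h4 := hα2 (!s) c hc h2
            rw [h1'] at h4
            exact Or.inr (Or.inr ⟨h4, hvote h3⟩)
      have k0 := key false
      have k1 := key true
      have v0 := edgeVote_le_one (rk := rk) (M := M) false e
      have v1 := edgeVote_le_one (rk := rk) (M := M) true e
      have g0 := hαge false (end' false e)
      have g1 := hαge true (end' true e)
      simp only [Bool.not_false, Bool.not_true] at k0 k1
      rw [edgeGain, endSum]
      omega
  · obtain ⟨l, hl⟩ := (hM e).1 he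
    rw [endSum]
    have h0 := levelCost_not (hS.subset hl).2 false
    have h1 := levelCost_lt (hS.subset hl).2 false
    simp only [Bool.not_false] at h0
    by_cases h : levelCost false l = 0
    · have h2 := hα1 false _ hl h
      have h3 := hα2 true _ hl (by simp only; omega)
      simp only [end₂] at h2 h3
      omega
    · have h2 := hα2 false _ hl (by simp only at *; omega)
      have h3 := hα1 true _ hl (by simp only at *; omega)
      simp only [end₂] at h2 h3
      omega
  · simp only [hα]
    rw [if_neg, if_neg h]
    rintro ⟨c, hc, h1, -⟩
    exact h ⟨c.1, (hM _).2 ⟨c.2, hc⟩, h1⟩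
  · simp only [hα, if_pos h]
    split_ifs <;> norm_num

theorem IsWitness.eq_zero_of_mem {α : Bool → ℕ → ℤ} (hα : IsWitness rk E M α) {e : Fin m × Fin n}
    (he : e ∈ M) {s : Bool} (h : α s (end' s e) = 0) (t : Bool) : α t (end' t e) = 0 := by
  have := hα.endSum_eq_zero e he
  rw [endSum] at this
  cases s <;> cases t <;> omega

theorem IsWitness.covers {α : Bool → ℕ → ℤ} (hα : IsWitness rk E M α) {s : Bool} {z : ℕ}
    (h : α s z ≠ 0) : Covers M s z := by
  by_contra hc
  exact h (hα.eq_zero s z hc)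

theorem IsWitness.trichotomy {α : Bool → ℕ → ℤ} (hα : IsWitness rk E M α) (s : Bool) (z : ℕ) :
    α s z = -1 ∨ α s z = 0 ∨ α s z = 1 := by
  by_cases h : α s z = 0
  · exact Or.inr (Or.inl h)
  · exact hα.partner (hα.covers h)

theorem edgeGain_eq (s : Bool) (e : Fin m × Fin n) :
    edgeGain rk M e = edgeVote rk M s e + edgeVote rk M (!s) e := by
  cases s
  · rfl
  · rw [edgeGain, add_comm]
    rfl

theorem endSum_eq (α : Bool → ℕ → ℤ) (s : Bool) (e : Fin m × Fin n) :
    endSum α e = α s (end' s e) + α (!s) (end' (!s) e) := by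
  cases s
  · rfl
  · rw [endSum, add_comm]
    rfl

theorem neg_one_le_edgeVote (s : Bool) (e : Fin m × Fin n) : -1 ≤ edgeVote rk M s e := by
  rw [edgeVote]
  split_ifs <;> simp

/-- The part of a popular matching with certificate `0` extends to a stable matching. -/
theorem IsWitness.exists_isStable_one {α : Bool → ℕ → ℤ} (hα : IsWitness rk E M α)
    (hinj : RankInj end' rk (E : Set (Fin m × Fin n))) (hME : M ⊆ E) (hM : IsDisjointEdges M) :
    ∃ S, IsStable end₂ (rank₂ rk) (levels E 1) S ∧
      (∀ e ∈ M, (∀ s, α s (end' s e) = 0) → (e, 0) ∈ S) ∧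
      ∀ c ∈ S, c.1 ∈ M ∨ ∀ s, α s (end₂ s c) ≠ 0 := by
  -- Agents of value 0 keep their partners. The others are matched anew by a stable set of `A`,
  -- where agents of value 1 accept nothing worse than their partner in `M`.
  set A : Set ((Fin m × Fin n) × ℕ) := {c | c ∈ levels E 1 ∧ ∀ s, α s (end₂ s c) ≠ 0 ∧
    (α s (end₂ s c) = 1 → ∀ d ∈ M, end' s d = end₂ s c → rk s c.1 ≤ rk s d)} with hA
  have hAE : A ⊆ levels E 1 := fun c hc => hc.1
  have hinj₂ := rankInj_rank₂ hinj (lam := 1) (by norm_num)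
  obtain ⟨N, hN⟩ := exists_isStable (A := A) ((levels_finite E 1).subset hAE)
    fun c hc d hd => hinj₂ c (hAE hc) d (hAE hd)
  have hl0 : ∀ c ∈ levels E 1, c.2 = 0 := fun c hc => Nat.lt_one_iff.1 hc.2
  have hle : ∀ c ∈ levels E 1, ∀ e s, rank₂ rk s c ≤ rank₂ rk s (e, 0) ↔ rk s c.1 ≤ rk s e := by
    intro c hc e s
    rw [rank₂_le_iff, hl0 c hc]
    simp
  -- Agents of value 1 are covered by `N`. Otherwise the partner, of value -1, has in `N` something
  -- it likes better than its edge in `M`, and the gain of that edge exceeds its certificate.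
  have key : ∀ s, ∀ d ∈ M, α s (end' s d) = 1 →
      ∃ c ∈ N, end₂ s c = end' s d ∧ rk s c.1 ≤ rk s d := by
    intro s d hd h1
    suffices h : ∃ c ∈ N, end₂ s c = end' s d by
      obtain ⟨c, hc, h2⟩ := h
      exact ⟨c, hc, h2, ((hN.subset hc).2 s).2 (h2 ▸ h1) d hd h2.symm⟩
    have hsum := hα.endSum_eq_zero d hd
    rw [endSum_eq α s] at hsum
    have hdA : (d, 0) ∈ A := by
      refine ⟨⟨hME hd, zero_lt_one⟩, fun t => ?_⟩
      by_cases ht : t = s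
      · subst ht
        refine ⟨?_, fun _ d' hd' h2 => ?_⟩
        · change α t (end' t d) ≠ 0
          omega
        · rw [hM d' hd' d hd t h2]
      · have : t = !s := Bool.eq_not.2 ht
        subst this
        change α (!s) (end' (!s) d) ≠ 0 ∧ (α (!s) (end' (!s) d) = 1 → _)
        exact ⟨by omega, by omega⟩
    obtain ⟨c, hc, t, h2, h3⟩ := hN.dominates _ hdA
    by_cases ht : t = s
    · subst ht
      exact ⟨c, hc, h2⟩
    have : t = !s := Bool.eq_not.2 ht
    subst this
    have hcA := hN.subset hc
    rw [hle c hcA.1] at h3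
    by_cases hcd : c.1 = d
    · exact ⟨c, hc, by rw [end₂, hcd]⟩
    exfalso
    have hcM : c.1 ∉ M := fun h => hcd (hM _ h _ hd _ h2)
    have hlt : rk (!s) c.1 < rk (!s) d := lt_of_le_of_ne h3 fun heq =>
      hcd (hinj c.1 hcA.1.1 d (hME hd) _ h2 heq)
    have hv : edgeVote rk M (!s) c.1 = 1 := edgeVote_eq_one hcM fun d' hd' h4 => by
      rw [hM d' hd' d hd (!s) (h4.trans h2)]
      exact not_lt.2 hlt.le
    have hg := hα.gain_le c.1 hcA.1.1
    rw [edgeGain_eq s, endSum_eq α s, hv] at hg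
    have h2' : end' (!s) c.1 = end' (!s) d := h2
    rw [h2'] at hg
    have hcs := (hcA.2 s).1
    simp only [end₂] at hcs
    rcases hα.trichotomy s (end' s c.1) with h5 | h5 | h5
    · have := neg_one_le_edgeVote (rk := rk) (M := M) s c.1
      omega
    · exact hcs h5
    · have hv' : edgeVote rk M s c.1 = 1 := edgeVote_eq_one hcM fun d' hd' h4 =>
        not_lt.2 ((hcA.2 s).2 h5 d' hd' h4)
      omega
  refine ⟨{c | c.1 ∈ M ∧ c.2 = 0 ∧ ∀ s, α s (end₂ s c) = 0} ∪ N, ⟨?_, ?_, ?_⟩, ?_, ?_⟩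
  · rintro c (hc | hc)
    · exact ⟨hME hc.1, by rw [hc.2.1]; norm_num⟩
    · exact hAE (hN.subset hc)
  · rintro c (hc | hc) d (hd | hd) s hs
    · exact Prod.ext (hM _ hc.1 _ hd.1 s hs) (hc.2.1.trans hd.2.1.symm)
    · have := ((hN.subset hd).2 s).1
      rw [← hs] at this
      exact absurd (hc.2.2 s) this
    · have := ((hN.subset hc).2 s).1
      rw [hs] at this
      exact absurd (hd.2.2 s) this
    · exact hN.disjoint c hc d hd s hs
  · rintro ⟨e, l⟩ he
    obtain rfl : l = 0 := hl0 _ he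
    by_contra hno
    have h0 : ∀ s, α s (end' s e) = 0 → edgeVote rk M s e = 1 := by
      intro s h
      by_contra hv
      obtain ⟨d, hd, h1, h2⟩ := exists_of_edgeVote_nonpos (rk := rk) (M := M) (s := s) (e := e) (by
        have := edgeVote_le_one (rk := rk) (M := M) s e
        omega)
      refine hno ⟨(d, 0), Or.inl ⟨hd, rfl, ?_⟩, s, h1, ?_⟩
      · rw [← h1] at h
        exact hα.eq_zero_of_mem hd h
      · rw [hle (d, 0) ⟨hME hd, zero_lt_one⟩]
        exact h2
    have h1 : ∀ s, α s (end' s e) = 1 → ∀ d ∈ M, end' s d = end' s e → rk s e < rk s d := by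
      intro s h d hd h1
      by_contra hlt
      obtain ⟨c, hc, h3, h4⟩ := key s d hd (by rw [h1]; exact h)
      refine hno ⟨c, Or.inr hc, s, h3.trans h1, ?_⟩
      rw [hle c (hAE (hN.subset hc))]
      exact h4.trans (not_lt.1 hlt)
    -- For a blocking edge with an end of value 0 the votes exceed the certificate. A blocking edge
    -- without such an end lies in `A`, where `N` is stable.
    by_cases hz : ∃ s, α s (end' s e) = 0
    · obtain ⟨s, hs⟩ := hz
      have hv := h0 s hs
      have hg := hα.gain_le e he.1
      rw [edgeGain_eq s, endSum_eq α s, hv, hs] at hg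
      have hv' := neg_one_le_edgeVote (rk := rk) (M := M) (!s) e
      rcases hα.trichotomy (!s) (end' (!s) e) with h5 | h5 | h5
      · omega
      · have := h0 (!s) h5
        omega
      · have : ¬ edgeVote rk M (!s) e ≤ 0 := fun h => by
          obtain ⟨d, hd, h6, h7⟩ := exists_of_edgeVote_nonpos h
          exact absurd (h1 (!s) h5 d hd h6) (not_lt.2 h7)
        omega
    · push Not at hz
      obtain ⟨c, hc, h⟩ := hN.dominates (e, 0) ⟨he, fun s => ⟨hz s, fun h d hd h2 =>
        (h1 s h d hd h2).le⟩⟩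
      exact hno ⟨c, Or.inr hc, h⟩
  · exact fun e he h => Or.inl ⟨he, rfl, h⟩
  · rintro c (hc | hc)
    · exact Or.inl hc.1
    · exact Or.inr fun s => ((hN.subset hc).2 s).1

set_option maxHeartbeats 1000000 in
/-- The part of a popular matching with nonzero certificate extends to a two-level stable
matching. -/
theorem IsWitness.exists_isStable_two {α : Bool → ℕ → ℤ} (hα : IsWitness rk E M α)
    (hinj : RankInj end' rk (E : Set (Fin m × Fin n))) (hME : M ⊆ E) (hM : IsDisjointEdges M) :
    ∃ S, IsStable end₂ (rank₂ rk) (levels E 2) S ∧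
      (∀ e ∈ M, (∀ s, α s (end' s e) ≠ 0) → ∃ l, (e, l) ∈ S) ∧
      ∀ c ∈ S, c.1 ∈ M ∨ ∀ s, α s (end₂ s c) = 0 := by
  -- The roles are exchanged: agents of nonzero value keep their partners, on the level given by the
  -- sign, and agents of value 0 are matched anew. On the level that its side dislikes, such an
  -- agent accepts nothing worse than its partner in `M`.
  set A : Set ((Fin m × Fin n) × ℕ) := {c | c ∈ levels E 2 ∧ ∀ s, α s (end₂ s c) = 0 ∧
    (levelCost s c.2 = 1 → ∀ d ∈ M, end' s d = end₂ s c → rk s c.1 ≤ rk s d)} with hA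
  have hAE : A ⊆ levels E 2 := fun c hc => hc.1
  have hinj₂ := rankInj_rank₂ hinj (lam := 2) le_rfl
  obtain ⟨N, hN⟩ := exists_isStable (A := A) ((levels_finite E 2).subset hAE)
    fun c hc d hd => hinj₂ c (hAE hc) d (hAE hd)
  have key : ∀ s, ∀ d ∈ M, α s (end' s d) = 0 →
      ∃ c ∈ N, end₂ s c = end' s d ∧ (levelCost s c.2 = 1 → rk s c.1 ≤ rk s d) := by
    intro s d hd h1
    suffices h : ∃ c ∈ N, end₂ s c = end' s d by
      obtain ⟨c, hc, h2⟩ := h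
      exact ⟨c, hc, h2, fun h3 => ((hN.subset hc).2 s).2 h3 d hd h2.symm⟩
    obtain ⟨l, hl, hsl⟩ := exists_levelCost s (i := 1) (by norm_num)
    have hsl' := levelCost_not hl s
    rw [hsl] at hsl'
    have hdA : (d, l) ∈ A := by
      refine ⟨⟨hME hd, hl⟩, fun t => ⟨hα.eq_zero_of_mem hd h1 t, ?_⟩⟩
      by_cases ht : t = s
      · subst ht
        intro _ d' hd' h2
        rw [hM d' hd' d hd t h2]
      · have : t = !s := Bool.eq_not.2 ht
        subst this
        intro h
        simp only at h
        omega
    obtain ⟨c, hc, t, h2, h3⟩ := hN.dominates _ hdA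
    by_cases ht : t = s
    · subst ht
      exact ⟨c, hc, h2⟩
    have : t = !s := Bool.eq_not.2 ht
    subst this
    have hcA := hN.subset hc
    rw [rank₂_le_iff, hsl'] at h3
    have h3' : levelCost (!s) c.2 = 0 ∧ rk (!s) c.1 ≤ rk (!s) d := by simpa using h3
    have hcl : levelCost s c.2 = 1 := by
      have h4 := levelCost_not hcA.1.2 s
      have h5 := levelCost_lt hcA.1.2 s
      omega
    by_cases hcd : c.1 = d
    · exact ⟨c, hc, by rw [end₂, hcd]⟩
    exfalso
    have hcM : c.1 ∉ M := fun h => hcd (hM _ h _ hd _ h2)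
    have hlt : rk (!s) c.1 < rk (!s) d := lt_of_le_of_ne h3'.2 fun heq =>
      hcd (hinj c.1 hcA.1.1 d (hME hd) _ h2 heq)
    have hv : edgeVote rk M (!s) c.1 = 1 := edgeVote_eq_one hcM fun d' hd' h4 => by
      rw [hM d' hd' d hd (!s) (h4.trans h2)]
      exact not_lt.2 hlt.le
    have hv' : edgeVote rk M s c.1 = 1 := edgeVote_eq_one hcM fun d' hd' h4 =>
      not_lt.2 ((hcA.2 s).2 hcl d' hd' h4)
    have hg := hα.gain_le c.1 hcA.1.1
    have e1 := (hcA.2 s).1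
    have e2 := (hcA.2 (!s)).1
    simp only [end₂] at e1 e2
    rw [edgeGain_eq s, endSum_eq α s, hv, hv', e1, e2] at hg
    omega
  set S₁ : Set ((Fin m × Fin n) × ℕ) := {c | c.1 ∈ M ∧ c.2 < 2 ∧ ∀ s,
    (α s (end₂ s c) = 1 ∧ levelCost s c.2 = 0) ∨ (α s (end₂ s c) = -1 ∧ levelCost s c.2 = 1)}
    with hS₁
  have hS₁mem : ∀ s, ∀ d ∈ M, α s (end' s d) ≠ 0 → ∃ l, (d, l) ∈ S₁ := by
    intro s d hd h
    have hsum := hα.endSum_eq_zero d hd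
    rw [endSum_eq α s] at hsum
    obtain ⟨l, hl, hsl⟩ := exists_levelCost s (i := if α s (end' s d) = 1 then 0 else 1)
      (by split_ifs <;> norm_num)
    have hsl' := levelCost_not hl s
    have htri := hα.trichotomy s (end' s d)
    refine ⟨l, hd, hl, fun t => ?_⟩
    by_cases ht : t = s
    · subst ht
      simp only [end₂]
      split_ifs at hsl <;> omega
    · have : t = !s := Bool.eq_not.2 ht
      subst this
      simp only [end₂]
      split_ifs at hsl <;> omega
  have hS₁ne : ∀ c ∈ S₁, ∀ s, α s (end₂ s c) ≠ 0 := by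
    intro c hc s
    have := hc.2.2 s
    omega
  refine ⟨S₁ ∪ N, ⟨?_, ?_, ?_⟩, ?_, ?_⟩
  · rintro c (hc | hc)
    · exact ⟨hME hc.1, hc.2.1⟩
    · exact hAE (hN.subset hc)
  · rintro c (hc | hc) d (hd | hd) s hs
    · have h1 := hM _ hc.1 _ hd.1 s hs
      have h2 := hc.2.2 s
      have h3 := hd.2.2 s
      rw [← hs] at h3
      exact Prod.ext h1 (levelCost_inj hc.2.1 hd.2.1 (s := s) (by omega))
    · have := hS₁ne c hc s
      rw [hs] at this
      exact absurd ((hN.subset hd).2 s).1 this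
    · have := hS₁ne d hd s
      rw [← hs] at this
      exact absurd ((hN.subset hc).2 s).1 this
    · exact hN.disjoint c hc d hd s hs
  · rintro ⟨e, l⟩ he
    by_contra hno
    have hle : ∀ s, edgeVote rk M s e ≠ 1 →
        ∃ d ∈ M, end' s d = end' s e ∧ rk s d ≤ rk s e := fun s hv =>
      exists_of_edgeVote_nonpos (by
        have := edgeVote_le_one (rk := rk) (M := M) s e
        omega)
    have r1 : ∀ s, α s (end' s e) = 1 → levelCost s l = 0 ∧ edgeVote rk M s e = 1 := by
      intro s h
      constructor
      · by_contra hl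
        obtain ⟨d, hd, h1⟩ := hα.covers (s := s) (z := end' s e) (by omega)
        obtain ⟨l', hl'⟩ := hS₁mem s d hd (by rw [h1]; omega)
        refine hno ⟨(d, l'), Or.inl hl', s, h1, rank₂_le_iff.2 (Or.inl ?_)⟩
        have := hl'.2.2 s
        have h2 : end₂ s (d, l') = end' s e := h1
        rw [h2] at this
        simp only at this ⊢
        omega
      · by_contra hv
        obtain ⟨d, hd, h1, h2⟩ := hle s hv
        obtain ⟨l', hl'⟩ := hS₁mem s d hd (by rw [h1]; omega)
        refine hno ⟨(d, l'), Or.inl hl', s, h1, rank₂_le_iff.2 ?_⟩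
        have := hl'.2.2 s
        have h3 : end₂ s (d, l') = end' s e := h1
        rw [h3] at this
        simp only at this ⊢
        have : levelCost s l' = 0 := by omega
        rcases Nat.eq_zero_or_pos (levelCost s l) with h4 | h4
        · exact Or.inr ⟨by omega, h2⟩
        · exact Or.inl (by omega)
    have r2 : ∀ s, α s (end' s e) = -1 → levelCost s l = 1 → edgeVote rk M s e = 1 := by
      intro s h hl
      by_contra hv
      obtain ⟨d, hd, h1, h2⟩ := hle s hv
      obtain ⟨l', hl'⟩ := hS₁mem s d hd (by rw [h1]; omega)
      refine hno ⟨(d, l'), Or.inl hl', s, h1, rank₂_le_iff.2 (Or.inr ⟨?_, h2⟩)⟩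
      have := hl'.2.2 s
      have h3 : end₂ s (d, l') = end' s e := h1
      rw [h3] at this
      simp only at this ⊢
      omega
    have r3 : ∀ s, α s (end' s e) = 0 → levelCost s l = 1 → ∀ d ∈ M, end' s d = end' s e →
        rk s e < rk s d := by
      intro s h hl d hd h1
      by_contra hlt
      obtain ⟨c, hc, h2, h3⟩ := key s d hd (by rw [h1]; exact h)
      refine hno ⟨c, Or.inr hc, s, h2.trans h1, rank₂_le_iff.2 ?_⟩
      have h4 := levelCost_lt (hN.subset hc).1.2 s
      simp only
      rw [hl]
      by_cases h5 : levelCost s c.2 = 1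
      · exact Or.inr ⟨h5, (h3 h5).trans (not_lt.1 hlt)⟩
      · exact Or.inl (by omega)
    -- Let `t` be the side that dislikes the level of the blocking contract. Its agent does not have
    -- value 1 and votes for the edge. The certificate then leaves only value 0 at both ends, and
    -- there `N` is stable.
    obtain ⟨t, ht⟩ : ∃ t, levelCost t l = 1 := by
      have h1 := levelCost_not he.2 false
      have h2 := levelCost_lt he.2 false
      simp only [Bool.not_false] at h1 h2
      by_cases h : levelCost false l = 1
      · exact ⟨_, h⟩
      · exact ⟨true, by omega⟩
    have hs := levelCost_not he.2 t
    simp only at hs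
    rw [ht] at hs
    have hvt : α t (end' t e) ≠ 1 ∧ edgeVote rk M t e = 1 := by
      rcases hα.trichotomy t (end' t e) with h | h | h
      · exact ⟨by omega, r2 t h ht⟩
      · refine ⟨by omega, ?_⟩
        by_contra hv
        obtain ⟨d, hd, h1, h2⟩ := hle t hv
        exact absurd (r3 t h ht d hd h1) (not_lt.2 h2)
      · have := (r1 t h).1
        omega
    have hg := hα.gain_le e he.1
    rw [edgeGain_eq t, endSum_eq α t, hvt.2] at hg
    have hv' := neg_one_le_edgeVote (rk := rk) (M := M) (!t) e
    have htri := hα.trichotomy t (end' t e)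
    rcases hα.trichotomy (!t) (end' (!t) e) with h | h | h
    · omega
    · have h0 : α t (end' t e) = 0 := by omega
      obtain ⟨c, hc, h1⟩ := hN.dominates (e, l) ⟨he, fun s => by
        by_cases hst : s = t
        · subst hst
          exact ⟨h0, fun h2 d hd h3 => (r3 s h0 h2 d hd h3).le⟩
        · have : s = !t := Bool.eq_not.2 hst
          subst this
          refine ⟨h, fun h2 => ?_⟩
          simp only at h2
          omega⟩
      exact hno ⟨c, Or.inr hc, h1⟩
    · have := (r1 (!t) h).2
      omega
  · exact fun e he h => by
      obtain ⟨l, hl⟩ := hS₁mem false e he (h false)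
      exact ⟨l, Or.inl hl⟩
  · rintro c (hc | hc)
    · exact Or.inl hc.1
    · exact Or.inr fun s => ((hN.subset hc).2 s).1

end MatchingPref

/-! ### One hybrid instance in place of many. -/

namespace MatchingPref

open Contracts

variable {m n k : ℕ}

/-- All instances have the same preferences for the agent `z` of side `s`. -/
def ConstAt (I : Fin k → Instance m n) (s : Bool) (z : ℕ) : Prop :=
  ∀ i j e, end' s e = z → (I i).rank s e = (I j).rank s e

/-- All agents other than `z₀` on side `s₀` have the same preferences in all instances. -/
def ConstExcept (I : Fin k → Instance m n) (s₀ : Bool) (z₀ : ℕ) : Prop :=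
  ∀ s z, ¬ (s = s₀ ∧ z = z₀) → ConstAt I s z

open Classical in
/-- The hybrid preferences with respect to the pair `x`: everything that is better than `x` in some
instance is put above it. -/
noncomputable def hybridRank (I : Fin k → Instance m n) (i₀ : Fin k) (x : Bool → ℕ) (s : Bool)
    (e : Fin m × Fin n) : ℕ ×ₗ ℕ :=
  toLex (if end' s e = x s then
      (if ∃ i o, (∀ t, end' t o = x t) ∧ (I i).rank s e < (I i).rank s o then 0
        else if ∀ t, end' t e = x t then 1 else 2)
    else 0, (I i₀).rank s e)

variable {I : Fin k → Instance m n} {i₀ : Fin k} {x : Bool → ℕ} {E : Finset (Fin m × Fin n)}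

theorem rankInj_hybridRank (hE : ∀ i, (I i).edges = E) :
    RankInj end' (hybridRank I i₀ x) (E : Set (Fin m × Fin n)) := by
  intro e he d _ s h1 h2
  have h3 := (Prod.mk.inj (toLex.injective h2)).2
  exact (I i₀).rank_inj (by rw [hE]; exact he) h1 h3

/-- For an agent with constant preferences the classes 0, 1, 2 only cut its list at the edge `x`, so
the order is unchanged. Against the edge `x` itself the class alone decides. No other comparison is
ever used, so the order inside the classes of the varying agent is immaterial. -/
theorem hybridRank_lt_iff (hE : ∀ i, (I i).edges = E) {s : Bool} {e d : Fin m × Fin n}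
    (he : e ∈ E) (hed : end' s e = end' s d)
    (h : ConstAt I s (end' s e) ∨ ∀ t, end' t d = x t) :
    hybridRank I i₀ x s e < hybridRank I i₀ x s d ↔ ∃ i, (I i).rank s e < (I i).rank s d := by
  have hconst : ConstAt I s (end' s e) →
      ((∃ i, (I i).rank s e < (I i).rank s d) ↔ (I i₀).rank s e < (I i₀).rank s d) := by
    intro hc
    constructor
    · rintro ⟨i, hi⟩
      rwa [hc i₀ i e rfl, hc i₀ i d hed.symm]
    · exact fun h => ⟨i₀, h⟩
  rw [hybridRank, hybridRank, Prod.Lex.toLex_lt_toLex]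
  by_cases hx : end' s e = x s
  · have hdx : end' s d = x s := hed.symm.trans hx
    simp only [if_pos hx, if_pos hdx]
    by_cases hd : ∀ t, end' t d = x t
    · have ho : ∀ o : Fin m × Fin n, (∀ t, end' t o = x t) ↔ o = d := fun o =>
        ⟨fun h => end'_ext fun t => (h t).trans (hd t).symm, fun h => h ▸ hd⟩
      simp only [ho, exists_eq_left, lt_irrefl, exists_false, if_false, if_true]
      by_cases hB : ∃ i, (I i).rank s e < (I i).rank s d
      · simp [hB]
      · by_cases hed' : e = d
        · simp [hed']
        · simp [hB, hed']
    · have hc : ConstAt I s (end' s e) := h.resolve_right hd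
      rw [hconst hc]
      have hB : ∀ e', end' s e' = end' s e →
          ((∃ i o, (∀ t, end' t o = x t) ∧ (I i).rank s e' < (I i).rank s o) ↔
            ∃ o, (∀ t, end' t o = x t) ∧ (I i₀).rank s e' < (I i₀).rank s o) := by
        intro e' he'
        constructor
        · rintro ⟨i, o, ho, hlt⟩
          refine ⟨o, ho, ?_⟩
          rwa [hc i₀ i e' he', hc i₀ i o ((ho s).trans hx.symm)]
        · rintro ⟨o, ho, hlt⟩
          exact ⟨i₀, o, ho, hlt⟩
      simp only [hB e rfl, hB d hed.symm, if_neg hd]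
      by_cases hex : ∃ o : Fin m × Fin n, ∀ t, end' t o = x t
      · obtain ⟨o, ho⟩ := hex
        have huniq : ∀ o' : Fin m × Fin n, (∀ t, end' t o' = x t) ↔ o' = o := fun o' =>
          ⟨fun h => end'_ext fun t => (h t).trans (ho t).symm, fun h => h ▸ ho⟩
        simp only [huniq, exists_eq_left]
        rw [huniq] at hd
        by_cases heo : e = o
        · subst heo
          have hne : (I i₀).rank s e ≠ (I i₀).rank s d := fun h =>
            hd ((I i₀).rank_inj (by rw [hE]; exact he) hed h).symm
          by_cases h2 : (I i₀).rank s d < (I i₀).rank s e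
          · simp [h2, h2.le]
          · have : (I i₀).rank s e < (I i₀).rank s d := by omega
            simp [this, h2]
        · by_cases h1 : (I i₀).rank s e < (I i₀).rank s o <;>
          by_cases h2 : (I i₀).rank s d < (I i₀).rank s o <;> simp [h1, h2, heo] <;> omega
      · have h1 : ∀ e' : Fin m × Fin n, ¬ ∀ t, end' t e' = x t := fun e' h => hex ⟨e', h⟩
        simp only [h1, false_and, exists_false, if_false, lt_irrefl, true_and, false_or]
  · have hdx : ¬ end' s d = x s := by rwa [← hed]
    have hc : ConstAt I s (end' s e) := h.resolve_right fun h => hdx (h s)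
    rw [hconst hc]
    simp [hx, hdx]

/-- The only edge of `M` at the agents `x` is the edge between them. -/
def Respects (M : Finset (Fin m × Fin n)) (x : Bool → ℕ) : Prop :=
  ∀ e ∈ M, Touches end' x e → ∀ t, end' t e = x t

/-- If the varying agent is matched in `M`, its edge is the pair `x`, so `hybridRank_lt_iff` applies
to every edge of `M`. As there are no ties, negating it turns "some instance" into "every instance".
-/
theorem hybridRank_lt_iff_forall (hE : ∀ i, (I i).edges = E) {s₀ : Bool}
    (hx : ConstExcept I s₀ (x s₀)) {M : Finset (Fin m × Fin n)} (hME : M ⊆ E)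
    (hMx : Respects M x) {s : Bool} {e d : Fin m × Fin n} (he : e ∈ E) (hd : d ∈ M)
    (hed : end' s d = end' s e) :
    hybridRank I i₀ x s d < hybridRank I i₀ x s e ↔ ∀ i, (I i).rank s d < (I i).rank s e := by
  have hor : ConstAt I s (end' s e) ∨ ∀ t, end' t d = x t := by
    by_cases h : s = s₀ ∧ end' s e = x s₀
    · obtain ⟨rfl, h⟩ := h
      exact Or.inr (hMx d hd ⟨s, hed.trans h⟩)
    · exact Or.inl (hx _ _ h)
  have hiff := hybridRank_lt_iff (i₀ := i₀) hE he hed.symm hor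
  by_cases hne : d = e
  · subst hne
    simp only [lt_irrefl, false_iff, not_forall]
    exact ⟨i₀, not_false⟩
  · have h1 : hybridRank I i₀ x s d ≠ hybridRank I i₀ x s e := fun h =>
      hne (rankInj_hybridRank hE d (hME hd) e he s hed h)
    have h2 : ∀ i, (I i).rank s d ≠ (I i).rank s e := fun i h =>
      hne ((I i).rank_inj (by rw [hE]; exact hME hd) hed h)
    rw [← not_iff_not, not_lt, le_iff_lt_or_eq, hiff]
    push Not
    constructor
    · rintro (⟨i, hi⟩ | h)
      · exact ⟨i, hi.le⟩
      · exact absurd h.symm h1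
    · rintro ⟨i, hi⟩
      exact Or.inl ⟨i, lt_of_le_of_ne hi (h2 i).symm⟩

theorem edgeVote_le_hybrid (hE : ∀ i, (I i).edges = E) {s₀ : Bool}
    (hx : ConstExcept I s₀ (x s₀)) {M : Finset (Fin m × Fin n)} (hME : M ⊆ E)
    (hMd : IsDisjointEdges M) (hMx : Respects M x) {e : Fin m × Fin n} (he : e ∈ E) (s : Bool)
    (i : Fin k) : edgeVote (I i).rank M s e ≤ edgeVote (hybridRank I i₀ x) M s e := by
  by_cases heM : e ∈ M
  · rw [edgeVote_of_mem hMd heM, edgeVote_of_mem hMd heM]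
  · rcases edgeVote_of_not_mem (rk := hybridRank I i₀ x) (s := s) heM with h | h
    · rw [h]
      exact edgeVote_le_one s e
    · obtain ⟨d, hd, h1, h2⟩ := exists_of_edgeVote_neg h
      rw [h, edgeVote_eq_neg_one hd h1 ((hybridRank_lt_iff_forall hE hx hME hMx he hd h1).1 h2 i)]

theorem exists_edgeVote_eq_one (hE : ∀ i, (I i).edges = E) {s₀ : Bool}
    (hx : ConstExcept I s₀ (x s₀)) {M : Finset (Fin m × Fin n)} (hME : M ⊆ E)
    (hMd : IsDisjointEdges M) (hMx : Respects M x) {e : Fin m × Fin n} (he : e ∈ E) {s : Bool}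
    (h : edgeVote (hybridRank I i₀ x) M s e = 1) : ∃ i, edgeVote (I i).rank M s e = 1 := by
  have heM : e ∉ M := fun heM => by
    rw [edgeVote_of_mem hMd heM] at h
    norm_num at h
  by_contra! hno
  have hneg : ∀ i, edgeVote (I i).rank M s e = -1 := fun i =>
    (edgeVote_of_not_mem heM).resolve_left (hno i)
  obtain ⟨d, hd, h1, -⟩ := exists_of_edgeVote_neg (hneg i₀)
  rw [edgeVote_eq_neg_one hd h1 ((hybridRank_lt_iff_forall hE hx hME hMx he hd h1).2 fun i => ?_)]
    at h
  · norm_num at h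
  · obtain ⟨d', hd', h1', h2'⟩ := exists_of_edgeVote_neg (hneg i)
    rwa [hMd d hd d' hd' s (h1.trans h1'.symm)]

/-- This is where a single varying agent matters: `N` has at most one edge at it, so an instance
that attains the hybrid vote there attains it on all of `N`. At the other agents all instances vote
alike. -/
theorem exists_edgeGain_ge (hE : ∀ i, (I i).edges = E) {s₀ : Bool}
    (hx : ConstExcept I s₀ (x s₀)) {M : Finset (Fin m × Fin n)} (hME : M ⊆ E)
    (hMd : IsDisjointEdges M) (hMx : Respects M x) {N : Finset (Fin m × Fin n)} (hNE : N ⊆ E)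
    (hNd : IsDisjointEdges N) :
    ∃ i, ∀ e ∈ N, edgeGain (hybridRank I i₀ x) M e ≤ edgeGain (I i).rank M e := by
  have hconst : ∀ {s e}, ConstAt I s (end' s e) → ∀ i j,
      edgeVote (I i).rank M s e = edgeVote (I j).rank M s e := by
    intro s e hc i j
    have : (∃ d ∈ M, end' s d = end' s e ∧ (I i).rank s d < (I i).rank s e) ↔
        ∃ d ∈ M, end' s d = end' s e ∧ (I j).rank s d < (I j).rank s e := by
      refine exists_congr fun d => and_congr_right fun _ => and_congr_right fun h => ?_
      rw [hc i j d h, hc i j e rfl]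
    simp only [edgeVote, this]
  obtain ⟨i, hi⟩ : ∃ i, ∀ e ∈ N, end' s₀ e = x s₀ →
      edgeVote (hybridRank I i₀ x) M s₀ e ≤ edgeVote (I i).rank M s₀ e := by
    by_cases hex : ∃ e ∈ N, end' s₀ e = x s₀ ∧ edgeVote (hybridRank I i₀ x) M s₀ e = 1
    · obtain ⟨e, he, h1, h2⟩ := hex
      obtain ⟨i, hi⟩ := exists_edgeVote_eq_one hE hx hME hMd hMx (hNE he) h2
      refine ⟨i, fun d hd h3 => ?_⟩
      rw [hNd d hd e he s₀ (h3.trans h1.symm), hi]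
      exact edgeVote_le_one _ _
    · push Not at hex
      refine ⟨i₀, fun e he h1 => ?_⟩
      by_cases heM : e ∈ M
      · rw [edgeVote_of_mem hMd heM, edgeVote_of_mem hMd heM]
      · rw [(edgeVote_of_not_mem heM).resolve_left (hex e he h1)]
        exact neg_one_le_edgeVote _ _
  have hvote : ∀ e ∈ N, ∀ s, edgeVote (hybridRank I i₀ x) M s e ≤ edgeVote (I i).rank M s e := by
    intro e he s
    by_cases h : s = s₀ ∧ end' s e = x s₀
    · obtain ⟨rfl, h⟩ := h
      exact hi e he h
    · by_cases heM : e ∈ M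
      · rw [edgeVote_of_mem hMd heM, edgeVote_of_mem hMd heM]
      · rcases edgeVote_of_not_mem (rk := hybridRank I i₀ x) (s := s) heM with h1 | h1
        · obtain ⟨j, hj⟩ := exists_edgeVote_eq_one hE hx hME hMd hMx (hNE he) h1
          rw [h1, hconst (hx _ _ h) i j, hj]
        · rw [h1]
          exact neg_one_le_edgeVote _ _
  exact ⟨i, fun e he => add_le_add (hvote e he false) (hvote e he true)⟩

/-- Popularity, or dominance if `dom` is `true`. -/
def Instance.IsGood (dom : Bool) (J : Instance m n) (M : Finset (Fin m × Fin n)) : Prop :=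
  if dom then J.IsDominant M else J.IsPopular M

theorem Instance.IsGood.isPopular {dom : Bool} {J : Instance m n} {M : Finset (Fin m × Fin n)}
    (h : J.IsGood dom M) : J.IsPopular M := by
  cases dom
  · exact h
  · exact h.1

theorem Instance.isGood_of_isWitness {dom : Bool} {J : Instance m n} {M : Finset (Fin m × Fin n)}
    (hM : J.IsMatching M) {α : Bool → ℕ → ℤ} (hα : IsWitness J.rank J.edges M α)
    (hdom : dom = true → ∀ s z, Covers M s z → α s z ≠ 0) : J.IsGood dom M := by
  obtain ⟨hME, hMd⟩ := isMatching_iff.1 hM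
  have hpop : J.IsPopular M := by
    refine ⟨hM, fun N hN => ?_⟩
    obtain ⟨hNE, hNd⟩ := isMatching_iff.1 hN
    rw [margin_eq hM hN]
    exact neg_nonneg.2 (hα.totalWeight_nonpos hMd hNE hNd)
  cases dom with
  | false => exact hpop
  | true =>
    refine ⟨hpop, fun N hN hcard => ?_⟩
    obtain ⟨hNE, hNd⟩ := isMatching_iff.1 hN
    rw [margin_eq hM hN]
    exact neg_pos.2 (hα.totalWeight_neg (hdom rfl) hMd hNE hNd hcard)

theorem totalWeight_mono {u v : Fin m × Fin n → ℤ} {K : ℤ} {M N : Finset (Fin m × Fin n)}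
    (h : ∀ e ∈ N, u e ≤ v e) : totalWeight u K M N ≤ totalWeight v K M N :=
  sub_le_sub_right (Finset.sum_le_sum h) _

/-- A common popular matching has a certificate for the hybrid preferences. -/
theorem exists_isWitness_hybrid {dom : Bool} (hE : ∀ i, (I i).edges = E) {s₀ : Bool}
    (hx : ConstExcept I s₀ (x s₀)) {M : Finset (Fin m × Fin n)} (hMx : Respects M x)
    (hM : ∀ i, (I i).IsGood dom M) (i₀ : Fin k) :
    ∃ α, IsWitness (hybridRank I i₀ x) E M α ∧
      (dom = true → ∀ s z, Covers M s z → α s z ≠ 0) := by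
  have hMm : ∀ i, (I i).IsMatching M := fun i => (hM i).isPopular.1
  obtain ⟨hME, hMd⟩ := Instance.isMatching_iff.1 (hMm i₀)
  rw [hE] at hME
  have hNm : ∀ N ⊆ E, IsDisjointEdges N → ∀ i, (I i).IsMatching N := fun N hNE hN i =>
    Instance.isMatching_iff.2 ⟨by rwa [hE], hN⟩
  have hpop : ∀ N ⊆ E, IsDisjointEdges N →
      totalWeight (edgeGain (hybridRank I i₀ x) M) 1 M N ≤ 0 := by
    intro N hNE hN
    obtain ⟨i, hi⟩ := exists_edgeGain_ge (i₀ := i₀) hE hx hME hMd hMx hNE hN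
    have h1 := (hM i).isPopular.2 N (hNm N hNE hN i)
    rw [Instance.margin_eq (hMm i) (hNm N hNE hN i)] at h1
    exact (totalWeight_mono hi).trans (neg_nonneg.1 h1)
  cases dom with
  | false =>
    obtain ⟨α, hα⟩ := exists_isWitness hME hMd hpop
    exact ⟨α, hα, fun h => by cases h⟩
  | true =>
    obtain ⟨α, hα, h⟩ := exists_isWitness_ne_zero hME hMd hpop (by
      intro N hNE hN hcard
      obtain ⟨i, hi⟩ := exists_edgeGain_ge (i₀ := i₀) hE hx hME hMd hMx hNE hN
      have h1 := (hM i).2 N (hNm N hNE hN i) hcard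
      rw [Instance.margin_eq (hMm i) (hNm N hNE hN i)] at h1
      exact (totalWeight_mono hi).trans_lt (neg_pos.1 h1))
    exact ⟨α, hα, fun _ => h⟩

/-- The contracts of level `l₀` between the agents `x`. -/
def forcedContracts (E : Finset (Fin m × Fin n)) (lam : ℕ) (x : Bool → ℕ) (l₀ : ℕ) :
    Set ((Fin m × Fin n) × ℕ) :=
  {c | c ∈ levels E lam ∧ (∀ t, end₂ t c = x t) ∧ c.2 = l₀}

/-- One or two levels are used for popular matchings, two for dominant matchings. -/
def LevelsFor (dom : Bool) (lam : ℕ) : Prop :=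
  lam = 2 ∨ lam = 1 ∧ dom = false

/-- Hybrid votes bound the votes in each instance, so the certificate derived from `S` serves all
instances at once. -/
theorem isGood_of_isStable {dom : Bool} (hE : ∀ i, (I i).edges = E) {s₀ : Bool}
    (hx : ConstExcept I s₀ (x s₀)) {lam l₀ : ℕ} (hlam : LevelsFor dom lam)
    {S : Set ((Fin m × Fin n) × ℕ)}
    (hS : IsStable end₂ (rank₂ (hybridRank I i₀ x)) (levels E lam) S)
    (hSx : ∀ c, c ∈ forcedContracts E lam x l₀ ↔ c ∈ S ∧ Touches end₂ x c) :
    ∃ M, ∀ i, (I i).IsGood dom M := by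
  obtain ⟨M, hME, hM⟩ := exists_finset_edges hS.subset
  have hMd := isDisjointEdges_of_isStable hS.disjoint hM
  have hinj := rankInj_hybridRank (i₀ := i₀) (x := x) hE
  have hMx : Respects M x := by
    intro e he hex
    obtain ⟨l, hl⟩ := (hM e).1 he
    exact ((hSx (e, l)).2 ⟨hl, hex⟩).2.1
  have hα : ∃ α, IsWitness (hybridRank I i₀ x) E M α ∧
      (dom = true → ∀ s z, Covers M s z → α s z ≠ 0) := by
    rcases hlam with rfl | ⟨rfl, rfl⟩
    · obtain ⟨α, hα, h⟩ := exists_isWitness_of_isStable_two hinj hS hM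
      exact ⟨α, hα, fun _ => h⟩
    · exact ⟨_, isWitness_of_isStable_one hinj hS hM, fun h => by cases h⟩
  obtain ⟨α, hα, hdom⟩ := hα
  refine ⟨M, fun i => Instance.isGood_of_isWitness
    (Instance.isMatching_iff.2 ⟨by rwa [hE], hMd⟩) (α := α) ⟨?_, hα.2, hα.3, hα.4⟩ hdom⟩
  rw [hE]
  intro e he
  exact (add_le_add (edgeVote_le_hybrid hE hx hME hMd hMx he false i)
    (edgeVote_le_hybrid hE hx hME hMd hMx he true i)).trans (hα.gain_le e he)

/-- The number of agents of a side. -/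
def sideSize (m n : ℕ) : Bool → ℕ
  | false => m
  | true => n

theorem end'_lt (s : Bool) (e : Fin m × Fin n) : end' s e < sideSize m n s := by
  cases s
  · exact e.1.2
  · exact e.2.2

/-- Only the situation of the agents `x` has to be carried over from `M` to the stable set. Their
edge lies either in the part of `M` with certificate 0 or in the other part, and each part extends
to a stable set of the matching kind. -/
theorem exists_isStable_of_isGood {dom : Bool} (hE : ∀ i, (I i).edges = E) (i₀ : Fin k) {s₀ : Bool}
    {z₀ : ℕ} (hz₀ : z₀ ≤ sideSize m n s₀) (hconst : ConstExcept I s₀ z₀)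
    {M : Finset (Fin m × Fin n)} (hM : ∀ i, (I i).IsGood dom M) :
    ∃ x : Bool → ℕ, x s₀ = z₀ ∧ (∀ s, x s ≤ sideSize m n s) ∧
      ∃ lam l₀ S, LevelsFor dom lam ∧ l₀ < lam ∧
        IsStable end₂ (rank₂ (hybridRank I i₀ x)) (levels E lam) S ∧
        ∀ c, c ∈ forcedContracts E lam x l₀ ↔ c ∈ S ∧ Touches end₂ x c := by
  classical
  obtain ⟨hME, hMd⟩ := Instance.isMatching_iff.1 (hM i₀).isPopular.1
  rw [hE] at hME
  -- If `z₀` is unmatched, its partner in `x` is the nonexistent agent with index `sideSize`, and no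
  -- contract is forced.
  obtain ⟨x, hx0, hxle, hxM, hMx⟩ : ∃ x : Bool → ℕ, x s₀ = z₀ ∧ (∀ s, x s ≤ sideSize m n s) ∧
      ((∀ s, x s < sideSize m n s) → ∃ o ∈ M, ∀ t, end' t o = x t) ∧ Respects M x := by
    by_cases hc : Covers M s₀ z₀
    · obtain ⟨e, he, rfl⟩ := hc
      refine ⟨fun t => end' t e, rfl, fun t => (end'_lt t e).le, fun _ => ⟨e, he, fun _ => rfl⟩, ?_⟩
      rintro d hd ⟨s, hs⟩ t
      rw [hMd d hd e he s hs]
    · refine ⟨fun t => if t = s₀ then z₀ else sideSize m n t, if_pos rfl, fun t => ?_, fun h => ?_,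
        ?_⟩
      · dsimp only
        split_ifs with h
        · rwa [h]
        · exact le_rfl
      · have h1 := h (!s₀)
        have h2 : (!s₀) ≠ s₀ := by cases s₀ <;> decide
        simp only [if_neg h2, lt_irrefl] at h1
      · rintro d hd ⟨s, hs⟩
        dsimp only at hs
        split_ifs at hs with h
        · subst h
          exact absurd ⟨d, hd, hs⟩ hc
        · exact absurd (end'_lt s d) (by omega)
  subst hx0
  refine ⟨x, rfl, hxle, ?_⟩
  have hoM : ∀ o : Fin m × Fin n, (∀ t, end' t o = x t) → o ∈ M := by
    intro o ho
    obtain ⟨e, he, h⟩ := hxM fun s => by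
      rw [← ho s]
      exact end'_lt s o
    rwa [show o = e from end'_ext fun t => (ho t).trans (h t).symm]
  obtain ⟨α, hα, hdom⟩ := exists_isWitness_hybrid hE hconst hMx hM i₀
  have hinj := rankInj_hybridRank (i₀ := i₀) (x := x) hE
  by_cases hP : ∃ e ∈ M, ∃ s, end' s e = x s ∧ α s (x s) ≠ 0
  · obtain ⟨e, he, s, hs, hαs⟩ := hP
    obtain ⟨S, hS, hS1, -⟩ := hα.exists_isStable_two hinj hME hMd
    have hex := hMx e he ⟨s, hs⟩
    obtain ⟨l, hl⟩ := hS1 e he fun t h => hαs (by rw [← hs]; exact hα.eq_zero_of_mem he h s)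
    refine ⟨2, l, S, Or.inl rfl, (hS.subset hl).2, hS, fun c => ⟨fun hc => ?_, fun hc => ?_⟩⟩
    · have : c = (e, l) := Prod.ext (end'_ext fun t => (hc.2.1 t).trans (hex t).symm) hc.2.2
      exact ⟨this ▸ hl, true, hc.2.1 true⟩
    · obtain ⟨hc, t, ht⟩ := hc
      obtain rfl := hS.disjoint c hc (e, l) hl t (ht.trans (hex t).symm)
      exact ⟨hS.subset hc, hex, rfl⟩
  · push Not at hP
    have hzero : ∀ o ∈ M, (∀ t, end' t o = x t) → ∀ t, α t (end' t o) = 0 := fun o ho h t => by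
      rw [h t]
      exact hP o ho t (h t)
    have huncov : ∀ s, α s (x s) ≠ 0 → ¬ Covers M s (x s) := by
      rintro s h ⟨e, he, h1⟩
      exact h (hP e he s h1)
    cases dom with
    | false =>
      obtain ⟨S, hS, hS1, hS2⟩ := hα.exists_isStable_one hinj hME hMd
      refine ⟨1, 0, S, Or.inr ⟨rfl, rfl⟩, zero_lt_one, hS, fun c => ⟨fun hc => ?_, fun hc => ?_⟩⟩
      · have hcM := hoM c.1 hc.2.1
        have := hS1 c.1 hcM (hzero _ hcM hc.2.1)
        rw [← hc.2.2] at this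
        exact ⟨this, true, hc.2.1 true⟩
      · obtain ⟨hc, t, ht⟩ := hc
        refine ⟨hS.subset hc, ?_, Nat.lt_one_iff.1 (hS.subset hc).2⟩
        rcases hS2 c hc with h | h
        · exact hMx c.1 h ⟨t, ht⟩
        · have h1 := h t
          rw [ht] at h1
          exact absurd (hα.covers h1) (huncov t h1)
    | true =>
      have hno : ∀ e ∈ M, ¬ Touches end' x e := by
        rintro e he ⟨s, hs⟩
        refine hdom rfl s (x s) ⟨e, he, hs⟩ (hP e he s hs)
      obtain ⟨S, hS, -, hS2⟩ := hα.exists_isStable_two hinj hME hMd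
      refine ⟨2, 0, S, Or.inl rfl, two_pos, hS, fun c => ⟨fun hc => ?_, fun hc => ?_⟩⟩
      · exact absurd ⟨true, hc.2.1 true⟩ (hno c.1 (hoM c.1 hc.2.1))
      · obtain ⟨hc, t, ht⟩ := hc
        rcases hS2 c hc with h | h
        · exact absurd ⟨t, ht⟩ (hno c.1 h)
        -- An edge of `S` outside `M` has both ends of value 0. By dominance these are unmatched in
        -- `M`, so the edge has gain 2 and certificate 0.
        · exfalso
          have h1 : ∀ s, ¬ Covers M s (end' s c.1) := fun s hs => hdom rfl s _ hs (h s)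
          have h2 := hα.gain_le c.1 (hS.subset hc).1
          have h3 := h false
          have h4 := h true
          simp only [end₂] at h3 h4
          rw [edgeGain, edgeVote_of_not_covers (h1 false), edgeVote_of_not_covers (h1 true),
            endSum, h3, h4] at h2
          norm_num at h2

end MatchingPref

/-! ### Running time of programs -/

namespace RAM

/-- The program `c`, started in `s`, halts within `T` steps in a state that satisfies `Q`. -/
def Runs (c : Cmd) (s : State) (T : ℕ) (Q : State → Prop) : Prop :=
  ∃ t s', Exec c s t s' ∧ t ≤ T ∧ Q s'

theorem Runs.mono {c : Cmd} {s : State} {T T' : ℕ} {Q Q' : State → Prop} (h : Runs c s T Q)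
    (hT : T ≤ T') (hQ : ∀ s', Q s' → Q' s') : Runs c s T' Q' := by
  obtain ⟨t, s', h1, h2, h3⟩ := h
  exact ⟨t, s', h1, h2.trans hT, hQ s' h3⟩

theorem Runs.skip {s : State} {Q : State → Prop} (h : Q s) : Runs .skip s 1 Q :=
  ⟨1, s, .skip s, le_rfl, h⟩

theorem Runs.assign {x : ℕ} {e : Expr} {s : State} {Q : State → Prop}
    (h : Q ⟨Function.update s.reg x (e.eval s), s.mem⟩) : Runs (.assign x e) s 1 Q :=
  ⟨1, _, .assign x e s, le_rfl, h⟩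

theorem Runs.store {a : ℕ} {i e : Expr} {s : State} {Q : State → Prop}
    (h : Q ⟨s.reg, Function.update s.mem a (Function.update (s.mem a) (i.eval s) (e.eval s))⟩) :
    Runs (.store a i e) s 1 Q :=
  ⟨1, _, .store a i e s, le_rfl, h⟩

theorem Runs.seq {c₁ c₂ : Cmd} {s : State} {T₁ T₂ : ℕ} {Q : State → Prop}
    (h : Runs c₁ s T₁ fun s₁ => Runs c₂ s₁ T₂ Q) : Runs (.seq c₁ c₂) s (T₁ + T₂) Q := by
  obtain ⟨t₁, s₁, h1, h2, t₂, s₂, h3, h4, h5⟩ := h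
  exact ⟨t₁ + t₂, s₂, .seq h1 h3, add_le_add h2 h4, h5⟩

theorem Runs.ite {e : Expr} {c₁ c₂ : Cmd} {s : State} {T : ℕ} {Q : State → Prop}
    (h1 : e.eval s ≠ 0 → Runs c₁ s T Q) (h2 : e.eval s = 0 → Runs c₂ s T Q) :
    Runs (.ite e c₁ c₂) s (T + 1) Q := by
  by_cases h : e.eval s = 0
  · obtain ⟨t, s', h3, h4, h5⟩ := h2 h
    exact ⟨t + 1, s', .ite_false h h3, Nat.succ_le_succ h4, h5⟩
  · obtain ⟨t, s', h3, h4, h5⟩ := h1 h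
    exact ⟨t + 1, s', .ite_true h h3, Nat.succ_le_succ h4, h5⟩

/-- A loop with invariant `J`, whose first argument strictly decreases. -/
theorem Runs.loop {e : Expr} {c : Cmd} {T : ℕ} {Q : State → Prop} {J : ℕ → State → Prop}
    (hexit : ∀ j s, J j s → e.eval s = 0 → Q s)
    (hbody : ∀ j s, J j s → e.eval s ≠ 0 → Runs c s T fun s' => ∃ j' < j, J j' s')
    (j : ℕ) (s : State) (h : J j s) : Runs (.loop e c) s ((T + 1) * j + 1) Q := by
  induction j using Nat.strong_induction_on generalizing s with
  | _ j ih =>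
    by_cases he : e.eval s = 0
    · exact ⟨1, s, .loop_false he, by omega, hexit j s h he⟩
    · obtain ⟨t, s', h1, h2, j', hj', h3⟩ := hbody j s h he
      obtain ⟨t', s'', h4, h5, h6⟩ := ih j' hj' s' h3
      refine ⟨t + t' + 1, s'', .loop_true he h1 h4, ?_, h6⟩
      have : (T + 1) * (j' + 1) ≤ (T + 1) * j := Nat.mul_le_mul le_rfl hj'
      rw [mul_add] at this
      omega

/-! ### Definable relations -/

/-- The data that formulas refer to: a bound for the quantifiers and the memory. -/
structure Ctx where
  len : ℕ
  mem : ℕ → ℕ → ℕ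

def State.ctx (s : State) : Ctx :=
  ⟨s.reg 0, s.mem⟩

/-- The values of the first `q` variables, which are kept in the registers from `10` on. -/
def State.env (q : ℕ) (s : State) : Fin q → ℕ :=
  fun i => s.reg (10 + i)

/-- Terms: functions of the context and the variables that are given by an expression. -/
def TmDef (q : ℕ) (t : Ctx → (Fin q → ℕ) → ℕ) : Prop :=
  ∃ e : Expr, ∀ s : State, e.eval s = t s.ctx (s.env q)

/-- Relations that a program evaluates into register `1` in polynomial time, without changing the
memory or the variables. -/
def FDef (q : ℕ) (P : Ctx → (Fin q → ℕ) → Prop) : Prop :=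
  ∃ (c : Cmd) (p : Polynomial ℕ), ∀ s : State, Runs c s (p.eval (s.reg 0)) fun s' =>
    s'.mem = s.mem ∧ (∀ x < 10 + q, x ≠ 1 → s'.reg x = s.reg x) ∧
      (P s.ctx (s.env q) → s'.reg 1 = 1) ∧ (¬ P s.ctx (s.env q) → s'.reg 1 = 0)

variable {q : ℕ}

theorem TmDef.var (i : Fin q) : TmDef q fun _ v => v i :=
  ⟨.reg (10 + i), fun _ => rfl⟩

theorem TmDef.const (c : ℕ) : TmDef q fun _ _ => c :=
  ⟨.const c, fun _ => rfl⟩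

theorem TmDef.add {t u : Ctx → (Fin q → ℕ) → ℕ} (ht : TmDef q t) (hu : TmDef q u) :
    TmDef q fun γ v => t γ v + u γ v := by
  obtain ⟨e, he⟩ := ht
  obtain ⟨f, hf⟩ := hu
  exact ⟨.add e f, fun s => by simp only [Expr.eval, he, hf]⟩

theorem TmDef.sub {t u : Ctx → (Fin q → ℕ) → ℕ} (ht : TmDef q t) (hu : TmDef q u) :
    TmDef q fun γ v => t γ v - u γ v := by
  obtain ⟨e, he⟩ := ht
  obtain ⟨f, hf⟩ := hu
  exact ⟨.sub e f, fun s => by simp only [Expr.eval, he, hf]⟩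

theorem TmDef.load (a : ℕ) {t : Ctx → (Fin q → ℕ) → ℕ} (ht : TmDef q t) :
    TmDef q fun γ v => γ.mem a (t γ v) := by
  obtain ⟨e, he⟩ := ht
  exact ⟨.load a e, fun s => by simp only [Expr.eval, he]; rfl⟩

theorem TmDef.lift {t : Ctx → (Fin q → ℕ) → ℕ} (ht : TmDef q t) :
    TmDef (q + 1) fun γ v => t γ (Fin.init v) := by
  obtain ⟨e, he⟩ := ht
  exact ⟨e, fun s => he s⟩

theorem TmDef.last : TmDef (q + 1) fun _ v => v (Fin.last q) :=
  TmDef.var _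

theorem FDef.congr {P Q : Ctx → (Fin q → ℕ) → Prop} (hP : FDef q P) (h : ∀ γ v, Q γ v ↔ P γ v) :
    FDef q Q := by
  have : Q = P := funext fun γ => funext fun v => propext (h γ v)
  rwa [this]

theorem FDef.lt {t u : Ctx → (Fin q → ℕ) → ℕ} (ht : TmDef q t) (hu : TmDef q u) :
    FDef q fun γ v => t γ v < u γ v := by
  obtain ⟨e, he⟩ := ht
  obtain ⟨f, hf⟩ := hu
  -- Two truncated subtractions from 1 turn any positive difference into 1.
  refine ⟨.assign 1 (.sub (.const 1) (.sub (.const 1) (.sub f e))), 1, fun s => ?_⟩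
  rw [Polynomial.eval_one]
  refine Runs.assign ⟨rfl, fun x _ hx => Function.update_of_ne hx _ _, fun h => ?_, fun h => ?_⟩ <;>
    simp only [Function.update_self, Expr.eval, he, hf] <;> omega

theorem FDef.not {P : Ctx → (Fin q → ℕ) → Prop} (hP : FDef q P) : FDef q fun γ v => ¬ P γ v := by
  obtain ⟨c, p, hc⟩ := hP
  refine ⟨.seq c (.assign 1 (.sub (.const 1) (.reg 1))), p + 1, fun s => ?_⟩
  rw [Polynomial.eval_add, Polynomial.eval_one]
  refine Runs.seq ((hc s).mono le_rfl ?_)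
  rintro s' ⟨h1, h2, h3, h4⟩
  refine Runs.assign ⟨h1, fun x hx hx1 => ?_, fun h => ?_, fun h => ?_⟩
  · exact (Function.update_of_ne hx1 _ _).trans (h2 x hx hx1)
  · simp only [Function.update_self, Expr.eval, h4 h]
  · simp only [Function.update_self, Expr.eval, h3 (not_not.1 h)]

theorem env_eq_of_agree {s s' : State} (h : ∀ x < 10 + q, x ≠ 1 → s'.reg x = s.reg x) :
    s'.env q = s.env q :=
  funext fun i => h _ (by omega) (by omega)

theorem ctx_eq_of_agree {s s' : State} (hm : s'.mem = s.mem)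
    (h : ∀ x < 10 + q, x ≠ 1 → s'.reg x = s.reg x) : s'.ctx = s.ctx := by
  rw [State.ctx, State.ctx, hm, h 0 (by omega) (by omega)]

theorem FDef.and {P Q : Ctx → (Fin q → ℕ) → Prop} (hP : FDef q P) (hQ : FDef q Q) :
    FDef q fun γ v => P γ v ∧ Q γ v := by
  obtain ⟨c, p, hc⟩ := hP
  obtain ⟨d, r, hd⟩ := hQ
  refine ⟨.seq c (.ite (.reg 1) d .skip), p + (r + 1 + 1), fun s => ?_⟩
  simp only [Polynomial.eval_add, Polynomial.eval_one]
  refine Runs.seq ((hc s).mono le_rfl ?_)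
  rintro s' ⟨h1, h2, h3, h4⟩
  have henv := env_eq_of_agree h2
  have hctx := ctx_eq_of_agree h1 h2
  have h0 : s'.reg 0 = s.reg 0 := h2 0 (by omega) (by omega)
  refine Runs.ite (fun h => ?_) (fun h => ?_)
  · have hPs : P s.ctx (s.env q) := by
      by_contra hno
      exact h (h4 hno)
    have := hd s'
    rw [h0, henv, hctx] at this
    refine this.mono (Nat.le_succ _) ?_
    rintro s'' ⟨g1, g2, g3, g4⟩
    exact ⟨g1.trans h1, fun x hx hx1 => (g2 x hx hx1).trans (h2 x hx hx1), fun h => g3 h.2,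
      fun h => g4 fun hq => h ⟨hPs, hq⟩⟩
  · have hPs : ¬ P s.ctx (s.env q) := by
      intro hyes
      have : s'.reg 1 = 0 := h
      rw [h3 hyes] at this
      exact one_ne_zero this
    exact (Runs.skip ⟨h1, h2, fun h => absurd h.1 hPs, fun _ => h⟩).mono (Nat.le_add_left _ _)
      fun _ h => h

theorem FDef.or {P Q : Ctx → (Fin q → ℕ) → Prop} (hP : FDef q P) (hQ : FDef q Q) :
    FDef q fun γ v => P γ v ∨ Q γ v :=
  (hP.not.and hQ.not).not.congr fun _ _ => by tauto

theorem FDef.imp {P Q : Ctx → (Fin q → ℕ) → Prop} (hP : FDef q P) (hQ : FDef q Q) :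
    FDef q fun γ v => P γ v → Q γ v :=
  (hP.and hQ.not).not.congr fun _ _ => by tauto

theorem FDef.le {t u : Ctx → (Fin q → ℕ) → ℕ} (ht : TmDef q t) (hu : TmDef q u) :
    FDef q fun γ v => t γ v ≤ u γ v :=
  (FDef.lt hu ht).not.congr fun _ _ => by simp

theorem FDef.eq {t u : Ctx → (Fin q → ℕ) → ℕ} (ht : TmDef q t) (hu : TmDef q u) :
    FDef q fun γ v => t γ v = u γ v :=
  ((FDef.le ht hu).and (FDef.le hu ht)).congr fun _ _ => by omega

theorem FDef.ne {t u : Ctx → (Fin q → ℕ) → ℕ} (ht : TmDef q t) (hu : TmDef q u) :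
    FDef q fun γ v => t γ v ≠ u γ v :=
  (FDef.eq ht hu).not

/-- A linear search in the register of the new variable. After a hit this register is set to the
bound, which ends the loop and keeps the 1 in register `1`. -/
theorem FDef.ex {Q : Ctx → (Fin q → ℕ) → ℕ → Prop}
    (hQ : FDef (q + 1) fun γ v => Q γ (Fin.init v) (v (Fin.last q))) :
    FDef q fun γ v => ∃ u < γ.len, Q γ v u := by
  obtain ⟨c, p, hc⟩ := hQ
  refine ⟨.seq (.assign (10 + q) (.const 0)) (.seq (.assign 1 (.const 0))
    (.loop (.sub (.reg 0) (.reg (10 + q))) (.seq c (.ite (.reg 1) (.assign (10 + q) (.reg 0))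
      (.assign (10 + q) (.add (.reg (10 + q)) (.const 1))))))),
    1 + (1 + ((p + (1 + 1) + 1) * Polynomial.X + 1)), fun s => ?_⟩
  simp only [Polynomial.eval_add, Polynomial.eval_mul, Polynomial.eval_one, Polynomial.eval_X]
  refine Runs.seq (Runs.assign (Runs.seq (Runs.assign ?_)))
  let J : ℕ → State → Prop := fun j s' => j = s.reg 0 - s'.reg (10 + q) ∧
    s'.mem = s.mem ∧ (∀ x < 10 + q, x ≠ 1 → s'.reg x = s.reg x) ∧
    ((s'.reg 1 = 0 ∧ s'.reg (10 + q) ≤ s.reg 0 ∧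
        ∀ u < s'.reg (10 + q), ¬ Q s.ctx (s.env q) u) ∨
      (s'.reg 1 = 1 ∧ s'.reg (10 + q) = s.reg 0 ∧ ∃ u < s.reg 0, Q s.ctx (s.env q) u))
  have hctxlen : s.ctx.len = s.reg 0 := rfl
  refine Runs.loop (J := J) ?_ ?_ (s.reg 0) _ ?_
  · rintro j s' ⟨-, h1, h2, h3⟩ he
    have h0 : s'.reg 0 = s.reg 0 := h2 0 (by omega) (by omega)
    simp only [Expr.eval, h0] at he
    rw [hctxlen]
    refine ⟨h1, h2, ?_⟩
    rcases h3 with ⟨h3, h4, h5⟩ | ⟨h3, h4, h5⟩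
    · have : s'.reg (10 + q) = s.reg 0 := by omega
      rw [this] at h5
      exact ⟨fun ⟨u, hu, hu'⟩ => absurd hu' (h5 u hu), fun _ => h3⟩
    · exact ⟨fun _ => h3, fun h => absurd h5 h⟩
  · rintro j s' ⟨hj, h1, h2, h3⟩ he
    have h0 : s'.reg 0 = s.reg 0 := h2 0 (by omega) (by omega)
    simp only [Expr.eval, h0] at he
    rcases h3 with ⟨h3, h4, h5⟩ | ⟨h3, h4, -⟩
    · have henv := env_eq_of_agree h2
      have hctx := ctx_eq_of_agree h1 h2
      have hinit : Fin.init (s'.env (q + 1)) = s.env q := henv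
      have hlast : s'.env (q + 1) (Fin.last q) = s'.reg (10 + q) := rfl
      have := hc s'
      dsimp only at this
      rw [h0, hctx, hinit, hlast] at this
      refine Runs.seq (this.mono le_rfl ?_)
      rintro s'' ⟨g1, g2, g3, g4⟩
      have g0 : s''.reg 0 = s.reg 0 := (g2 0 (by omega) (by omega)).trans h0
      have gq : s''.reg (10 + q) = s'.reg (10 + q) := g2 _ (by omega) (by omega)
      have gx : ∀ x < 10 + q, x ≠ 1 → s''.reg x = s.reg x := fun x hx hx1 =>
        (g2 x (by omega) hx1).trans (h2 x hx hx1)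
      refine Runs.ite (fun h => Runs.assign ?_) (fun h => Runs.assign ?_)
      · have hQs : Q s.ctx (s.env q) (s'.reg (10 + q)) := by
          by_contra hno
          exact h (g4 hno)
        refine ⟨0, by omega, ?_, g1.trans h1, fun x hx hx1 => ?_, Or.inr ⟨?_, ?_, ?_⟩⟩
        · simp only [Function.update_self, Expr.eval]
          omega
        · exact (Function.update_of_ne (by omega) _ _).trans (gx x hx hx1)
        · exact (Function.update_of_ne (by omega) _ _).trans (g3 hQs)
        · simp only [Function.update_self, Expr.eval, g0]
        · exact ⟨_, by omega, hQs⟩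
      · have hQs : ¬ Q s.ctx (s.env q) (s'.reg (10 + q)) := by
          intro hyes
          have : s''.reg 1 = 0 := h
          rw [g3 hyes] at this
          exact one_ne_zero this
        refine ⟨j - 1, by omega, ?_, g1.trans h1, fun x hx hx1 => ?_, Or.inl ⟨?_, ?_, ?_⟩⟩
        · simp only [Function.update_self, Expr.eval, gq]
          omega
        · exact (Function.update_of_ne (by omega) _ _).trans (gx x hx hx1)
        · exact (Function.update_of_ne (by omega) _ _).trans h
        · simp only [Function.update_self, Expr.eval, gq]
          omega
        · simp only [Function.update_self, Expr.eval, gq]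
          intro u hu
          rcases Nat.lt_succ_iff_lt_or_eq.1 hu with h6 | rfl
          · exact h5 u h6
          · exact hQs
    · omega
  · have hr : Function.update (Function.update s.reg (10 + q) 0) 1 0 (10 + q) = 0 := by
      rw [Function.update_of_ne (by omega), Function.update_self]
    refine ⟨?_, rfl, fun x hx hx1 => ?_, Or.inl ⟨?_, ?_, ?_⟩⟩
    · simp only [Expr.eval, hr, Nat.sub_zero]
    · exact (Function.update_of_ne hx1 _ _).trans (Function.update_of_ne (by omega) _ _)
    · simp only [Expr.eval, Function.update_self]
    · simp only [Expr.eval, hr, Nat.zero_le]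
    · simp only [Expr.eval, hr, Nat.not_lt_zero, false_imp_iff, implies_true]

theorem FDef.all {Q : Ctx → (Fin q → ℕ) → ℕ → Prop}
    (hQ : FDef (q + 1) fun γ v => Q γ (Fin.init v) (v (Fin.last q))) :
    FDef q fun γ v => ∀ u < γ.len, Q γ v u :=
  (FDef.ex (Q := fun γ v u => ¬ Q γ v u) hQ.not).not.congr fun _ _ => by push Not; rfl

end RAM

namespace RAM

/-! ### Nested loops and fixpoints -/

/-- The memory, and the register `2`, which records changes. -/
def State.data (s : State) : (ℕ → ℕ → ℕ) × ℕ :=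
  (s.mem, s.reg 2)

/-- If `J` holds and the first `q` variables are below `L`, then `c` preserves `J` and the values of the first `q` variables, changes the data
along `Rel` and establishes `Post`. -/
def Meets (q : ℕ) (c : Cmd) (p : Polynomial ℕ) (L : ℕ) (J : (ℕ → ℕ → ℕ) × ℕ → Prop)
    (Rel : (ℕ → ℕ → ℕ) × ℕ → (ℕ → ℕ → ℕ) × ℕ → Prop)
    (Post : (Fin q → ℕ) → (ℕ → ℕ → ℕ) × ℕ → Prop) : Prop :=
  ∀ s : State, s.reg 0 = L → (∀ i, s.env q i < L) → J s.data → Runs c s (p.eval L) fun s' =>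
    (∀ x < 10 + q, x ≠ 1 → x ≠ 2 → s'.reg x = s.reg x) ∧ J s'.data ∧ Rel s.data s'.data ∧
      Post (s.env q) s'.data

/-- Run `c` for all values of the variable with index `q`. -/
def loopVar (q : ℕ) (c : Cmd) : Cmd :=
  .seq (.assign (10 + q) (.const 0)) (.loop (.sub (.reg 0) (.reg (10 + q)))
    (.seq c (.assign (10 + q) (.add (.reg (10 + q)) (.const 1)))))

theorem data_update (s : State) {x : ℕ} (hx : x ≠ 2) (y : ℕ) :
    (⟨Function.update s.reg x y, s.mem⟩ : State).data = s.data := by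
  simp only [State.data, Function.update_of_ne hx.symm]

variable {q L : ℕ} {J : (ℕ → ℕ → ℕ) × ℕ → Prop}
  {Rel : (ℕ → ℕ → ℕ) × ℕ → (ℕ → ℕ → ℕ) × ℕ → Prop}

theorem Meets.loopVar {c : Cmd} {p : Polynomial ℕ}
    {Post : (Fin (q + 1) → ℕ) → (ℕ → ℕ → ℕ) × ℕ → Prop} (hc : Meets (q + 1) c p L J Rel Post)
    (hrefl : ∀ δ, Rel δ δ) (htrans : ∀ δ₁ δ₂ δ₃, Rel δ₁ δ₂ → Rel δ₂ δ₃ → Rel δ₁ δ₃)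
    (hpost : ∀ v δ δ', Post v δ → Rel δ δ' → Post v δ') :
    Meets q (loopVar q c) (1 + ((p + 1 + 1) * Polynomial.X + 1)) L J Rel
      fun v δ => ∀ u < L, Post (Fin.snoc v u) δ := by
  intro s hL hv hJ
  simp only [Polynomial.eval_add, Polynomial.eval_mul, Polynomial.eval_one, Polynomial.eval_X]
  refine Runs.seq (Runs.assign ?_)
  let K : ℕ → State → Prop := fun j s' => j = L - s'.reg (10 + q) ∧ s'.reg (10 + q) ≤ L ∧
    (∀ x < 10 + q, x ≠ 1 → x ≠ 2 → s'.reg x = s.reg x) ∧ J s'.data ∧ Rel s.data s'.data ∧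
    ∀ u < s'.reg (10 + q), Post (Fin.snoc (s.env q) u) s'.data
  refine Runs.loop (J := K) ?_ ?_ L _ ?_
  · rintro j s' ⟨-, h1, h2, h3, h4, h5⟩ he
    have h0 : s'.reg 0 = L := (h2 0 (by omega) (by omega) (by omega)).trans hL
    simp only [Expr.eval, h0] at he
    have h6 : s'.reg (10 + q) = L := by omega
    rw [h6] at h5
    exact ⟨h2, h3, h4, h5⟩
  · rintro j s' ⟨hj, h1, h2, h3, h4, h5⟩ he
    have h0 : s'.reg 0 = L := (h2 0 (by omega) (by omega) (by omega)).trans hL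
    simp only [Expr.eval, h0] at he
    have henv : s'.env (q + 1) = Fin.snoc (s.env q) (s'.reg (10 + q)) := by
      rw [← Fin.snoc_init_self (s'.env (q + 1))]
      congr 1
      funext i
      exact h2 (10 + i) (by omega) (by omega) (by omega)
    have hv' : ∀ i, s'.env (q + 1) i < L := by
      rw [henv]
      refine Fin.lastCases ?_ fun i => ?_
      · rw [Fin.snoc_last]
        omega
      · rw [Fin.snoc_castSucc]
        exact hv i
    refine Runs.seq ((hc s' h0 hv' h3).mono le_rfl ?_)
    rintro s'' ⟨g1, g2, g3, g4⟩
    have hq : s''.reg (10 + q) = s'.reg (10 + q) := g1 _ (by omega) (by omega) (by omega)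
    refine Runs.assign ⟨j - 1, by omega, ?_⟩
    simp only [K, data_update s'' (show 10 + q ≠ 2 by omega), Function.update_self, Expr.eval, hq]
    refine ⟨by omega, by omega, fun x hx hx1 hx2 => ?_, g2, htrans _ _ _ h4 g3, fun u hu => ?_⟩
    · exact (Function.update_of_ne (by omega) _ _).trans
        ((g1 x (by omega) hx1 hx2).trans (h2 x hx hx1 hx2))
    · rcases Nat.lt_succ_iff_lt_or_eq.1 hu with h6 | rfl
      · exact hpost _ _ _ (h5 u h6) g3
      · rw [← henv]
        exact g4
  · simp only [K, data_update s (show 10 + q ≠ 2 by omega), Function.update_self, Expr.eval]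
    refine ⟨by omega, by omega, fun x hx hx1 hx2 => ?_, hJ, hrefl _, fun u hu => by omega⟩
    exact Function.update_of_ne (by omega) _ _

/-- Run `c` for all values of the first `q` variables. -/
def loopVars : ℕ → Cmd → Cmd
  | 0, c => c
  | q + 1, c => loopVars q (loopVar q c)

/-- The running time of `loopVars`. -/
noncomputable def loopVarsTime : ℕ → Polynomial ℕ → Polynomial ℕ
  | 0, p => p
  | q + 1, p => loopVarsTime q (1 + ((p + 1 + 1) * Polynomial.X + 1))

theorem Meets.loopVars {c : Cmd} {p : Polynomial ℕ}
    {Post : (Fin q → ℕ) → (ℕ → ℕ → ℕ) × ℕ → Prop} (hc : Meets q c p L J Rel Post)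
    (hrefl : ∀ δ, Rel δ δ) (htrans : ∀ δ₁ δ₂ δ₃, Rel δ₁ δ₂ → Rel δ₂ δ₃ → Rel δ₁ δ₃)
    (hpost : ∀ v δ δ', Post v δ → Rel δ δ' → Post v δ') :
    Meets 0 (loopVars q c) (loopVarsTime q p) L J Rel
      fun _ δ => ∀ v : Fin q → ℕ, (∀ i, v i < L) → Post v δ := by
  induction q generalizing c p with
  | zero =>
    intro s hL hv hJ
    refine (hc s hL hv hJ).mono le_rfl ?_
    rintro s' ⟨h1, h2, h3, h4⟩
    refine ⟨h1, h2, h3, fun v _ => ?_⟩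
    rwa [Subsingleton.elim v (s.env 0)]
  | succ q ih =>
    have := ih (hc.loopVar hrefl htrans hpost) fun v δ δ' h h' u hu => hpost _ _ _ (h u hu) h'
    intro s hL hv hJ
    refine (this s hL hv hJ).mono le_rfl ?_
    rintro s' ⟨h1, h2, h3, h4⟩
    refine ⟨h1, h2, h3, fun v hv => ?_⟩
    have := h4 (Fin.init v) (fun i => hv _) (v (Fin.last q)) (hv _)
    rwa [Fin.snoc_init_self] at this

/-- The number of a memory that a program fills with a relation. -/
abbrev relMem : ℕ := 4

/-- The relation that is stored in the memory `relMem`. -/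
def Ctx.Stored (ad : Ctx → (Fin q → ℕ) → ℕ) (γ : Ctx) (v : Fin q → ℕ) : Prop :=
  γ.mem relMem (ad γ v) ≠ 0

/-- The contexts agree outside of `relMem`. -/
def Ctx.Agree (γ γ' : Ctx) : Prop :=
  γ.len = γ'.len ∧ ∀ a ≠ relMem, γ.mem a = γ'.mem a

/-- All tuples with entries below `L`. -/
def box (q L : ℕ) : Finset (Fin q → ℕ) :=
  Fintype.piFinset fun _ => Finset.range L

theorem mem_box {v : Fin q → ℕ} : v ∈ box q L ↔ ∀ i, v i < L := by
  simp [box]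

theorem card_box (q L : ℕ) : (box q L).card = L ^ q := by
  simp [box]

/-- A program computes a fixpoint of a monotone definable operator on relations. -/
theorem exists_cmd_fixpoint {Φ : Ctx → (Fin q → ℕ) → Prop} {ad : Ctx → (Fin q → ℕ) → ℕ}
    (hΦ : FDef q Φ) (had : TmDef q ad) :
    ∃ (c : Cmd) (p : Polynomial ℕ), ∀ s : State,
      (∀ γ, s.ctx.Agree γ → ∀ v, ad γ v = ad s.ctx v) →
      (∀ v ∈ box q (s.reg 0), ∀ w ∈ box q (s.reg 0), ad s.ctx v = ad s.ctx w → v = w) →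
      (∀ γ γ', s.ctx.Agree γ → s.ctx.Agree γ' →
        (∀ v ∈ box q (s.reg 0), γ.Stored ad v → γ'.Stored ad v) →
        ∀ v ∈ box q (s.reg 0), Φ γ v → Φ γ' v) →
      (∀ i, s.mem relMem i = 0) →
      Runs c s (p.eval (s.reg 0)) fun s' => s.ctx.Agree s'.ctx ∧
        ∀ v ∈ box q (s.reg 0), s'.ctx.Stored ad v ↔ Φ s'.ctx v := by
  classical
  obtain ⟨c, p, hc⟩ := hΦ
  obtain ⟨e, he⟩ := had
  set body : Cmd := .seq c (.ite (.reg 1) (.ite (.load relMem e) .skip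
    (.seq (.store relMem e (.const 1)) (.assign 2 (.const 1)))) .skip) with hbody
  refine ⟨.seq (.assign 2 (.const 1)) (.loop (.reg 2) (.seq (.assign 2 (.const 0))
    (loopVars q body))), 1 + ((1 + loopVarsTime q (p + (1 + 1 + 1 + 1)) + 1) *
      (Polynomial.X ^ q + 1) + 1), fun s hagree hadinj hmono hzero => ?_⟩
  set L := s.reg 0 with hL
  set mk : (ℕ → ℕ → ℕ) → Ctx := fun μ => ⟨L, μ⟩ with hmk
  -- Every marked tuple satisfies the operator. By monotonicity further marks preserve this, so
  -- marks can be set in place and are never withdrawn.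
  let J : (ℕ → ℕ → ℕ) × ℕ → Prop := fun δ => s.ctx.Agree (mk δ.1) ∧
    ∀ v ∈ box q L, (mk δ.1).Stored ad v → Φ (mk δ.1) v
  let cells : (ℕ → ℕ → ℕ) × ℕ → Finset (Fin q → ℕ) := fun δ =>
    (box q L).filter fun v => (mk δ.1).Stored ad v
  -- Marks only grow. A flag that is still 0 certifies an unchanged memory, and a flag that has been
  -- raised certifies a new mark.
  let Rel : (ℕ → ℕ → ℕ) × ℕ → (ℕ → ℕ → ℕ) × ℕ → Prop := fun δ δ' =>
    cells δ ⊆ cells δ' ∧ (δ'.2 = 0 → δ.2 = 0 ∧ δ'.1 = δ.1) ∧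
      (δ'.2 ≠ 0 → δ.2 ≠ 0 ∨ (cells δ).card < (cells δ').card)
  have hrefl : ∀ δ, Rel δ δ := fun δ => ⟨le_rfl, fun h => ⟨h, rfl⟩, fun h => Or.inl h⟩
  have htrans : ∀ δ₁ δ₂ δ₃, Rel δ₁ δ₂ → Rel δ₂ δ₃ → Rel δ₁ δ₃ := by
    rintro δ₁ δ₂ δ₃ ⟨a1, a2, a3⟩ ⟨b1, b2, b3⟩
    refine ⟨a1.trans b1, fun h => ?_, fun h => ?_⟩
    · obtain ⟨h2, h3⟩ := b2 h
      obtain ⟨h4, h5⟩ := a2 h2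
      exact ⟨h4, h3.trans h5⟩
    · by_cases h2 : δ₂.2 = 0
      · rcases b3 h with h3 | h3
        · exact absurd h2 h3
        · exact Or.inr ((Finset.card_le_card a1).trans_lt h3)
      · rcases a3 h2 with h3 | h3
        · exact Or.inl h3
        · exact Or.inr (h3.trans_le (Finset.card_le_card b1))
  let Post : (Fin q → ℕ) → (ℕ → ℕ → ℕ) × ℕ → Prop := fun v δ =>
    δ.2 = 0 → v ∈ box q L → Φ (mk δ.1) v → (mk δ.1).Stored ad v
  have hpost : ∀ v δ δ', Post v δ → Rel δ δ' → Post v δ' := by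
    rintro v δ δ' h ⟨-, h1, -⟩ h2 hv
    obtain ⟨h3, h4⟩ := h1 h2
    rw [h4]
    exact h h3 hv
  have hbodyM : Meets q body (p + (1 + 1 + 1 + 1)) L J Rel Post := by
    intro s₁ hs₁ hbox hJ₁
    obtain ⟨hA, hst⟩ := hJ₁
    change s.ctx.Agree (mk s₁.mem) at hA
    change ∀ v ∈ box q L, (mk s₁.mem).Stored ad v → Φ (mk s₁.mem) v at hst
    rw [← mem_box] at hbox
    simp only [Polynomial.eval_add, Polynomial.eval_one]
    have hctx₁ : s₁.ctx = mk s₁.mem := by rw [State.ctx, hs₁]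
    have h1 := hc s₁
    rw [hs₁, hctx₁] at h1
    refine Runs.seq (h1.mono le_rfl ?_)
    rintro s₂ ⟨g1, g2, g3, g4⟩
    have hs₂ : s₂.reg 0 = L := (g2 0 (by omega) (by omega)).trans hs₁
    have h22 : s₂.reg 2 = s₁.reg 2 := g2 2 (by omega) (by omega)
    have henv := env_eq_of_agree g2
    have hctx₂ : s₂.ctx = mk s₁.mem := by rw [State.ctx, hs₂, g1]
    have hdata : s₂.data = s₁.data := by rw [State.data, State.data, g1, h22]
    have heval : e.eval s₂ = ad (mk s₁.mem) (s₁.env q) := by rw [he, hctx₂, henv]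
    have hload : (Expr.load relMem e).eval s₂ = s₁.mem relMem (ad (mk s₁.mem) (s₁.env q)) := by
      rw [Expr.eval, heval, g1]
    refine Runs.ite (fun hr => ?_) (fun hr => (Runs.skip ?_).mono (by omega) fun _ h => h)
    · have hΦv : Φ (mk s₁.mem) (s₁.env q) := by
        by_contra hno
        exact hr (g4 hno)
      refine Runs.ite (fun h => (Runs.skip ?_).mono (by omega) fun _ h => h)
        (fun h => Runs.seq (Runs.store (Runs.assign ?_)))
      · rw [hload] at h
        rw [hdata]
        exact ⟨fun x hx hx1 hx2 => g2 x hx hx1, ⟨hA, hst⟩, hrefl _, fun _ _ _ => h⟩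
      · rw [hload] at h
        simp only [Expr.eval, heval, g1]
        set μ := Function.update s₁.mem relMem (Function.update (s₁.mem relMem)
          (ad (mk s₁.mem) (s₁.env q)) 1) with hμ
        have hag : s.ctx.Agree (mk μ) :=
          ⟨rfl, fun a ha => (hA.2 a ha).trans (Function.update_of_ne ha _ _).symm⟩
        have hadμ : ∀ v, ad (mk μ) v = ad (mk s₁.mem) v := fun v => by
          rw [hagree _ hag, hagree _ hA]
        have hstμ : ∀ v, (mk μ).Stored ad v ↔ (mk s₁.mem).Stored ad v ∨
            ad (mk s₁.mem) v = ad (mk s₁.mem) (s₁.env q) := by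
          intro v
          have hup : (mk μ).mem relMem = Function.update (s₁.mem relMem)
            (ad (mk s₁.mem) (s₁.env q)) 1 := by
            change μ relMem = _
            rw [hμ, Function.update_self]
          rw [Ctx.Stored, Ctx.Stored, hadμ, hup]
          by_cases hv : ad (mk s₁.mem) v = ad (mk s₁.mem) (s₁.env q)
          · simp [hv]
          · rw [Function.update_of_ne hv]
            exact (or_iff_left hv).symm
        have hmono' : ∀ v ∈ box q L, Φ (mk s₁.mem) v → Φ (mk μ) v :=
          hmono _ _ hA hag fun v _ h => (hstμ v).2 (Or.inl h)
        have hsub : ∀ a : ℕ, cells s₁.data ⊆ cells (μ, a) := fun a v hv => by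
          simp only [cells, Finset.mem_filter] at hv ⊢
          exact ⟨hv.1, (hstμ v).2 (Or.inl hv.2)⟩
        refine ⟨fun x hx hx1 hx2 => (Function.update_of_ne hx2 _ _).trans (g2 x hx hx1),
          ⟨hag, fun v hv h' => ?_⟩, ⟨hsub _, fun h' => ?_, fun _ => Or.inr ?_⟩, fun h' => ?_⟩
        · rcases (hstμ v).1 h' with h' | h'
          · exact hmono' v hv (hst v hv h')
          · rw [hagree _ hA, hagree _ hA] at h'
            rw [hadinj v hv _ hbox h']
            exact hmono' _ hbox hΦv
        · simp [State.data] at h'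
        · refine Finset.card_lt_card ⟨hsub _, fun h' => ?_⟩
          have := h' (Finset.mem_filter.2 ⟨hbox, (hstμ _).2 (Or.inr rfl)⟩ :
            s₁.env q ∈ cells (μ, _))
          exact (Finset.mem_filter.1 this).2 h
        · simp [State.data] at h'
    · rw [hdata]
      refine ⟨fun x hx hx1 hx2 => g2 x hx hx1, ⟨hA, hst⟩, hrefl _, fun _ _ h => ?_⟩
      have : s₂.reg 1 = 0 := hr
      rw [g3 h] at this
      exact absurd this one_ne_zero
  have hloop := hbodyM.loopVars hrefl htrans hpost
  simp only [Polynomial.eval_add, Polynomial.eval_mul, Polynomial.eval_pow, Polynomial.eval_one,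
    Polynomial.eval_X]
  -- The measure counts the unmarked tuples, plus one while the flag demands another pass. It bounds
  -- the number of passes by `L ^ q + 1`.
  let K : ℕ → State → Prop := fun j s' => s'.reg 0 = L ∧ J s'.data ∧
    j = (L ^ q - (cells s'.data).card) + (if s'.reg 2 = 0 then 0 else 1) ∧
    (s'.reg 2 = 0 → ∀ v ∈ box q L, Φ (mk s'.mem) v → (mk s'.mem).Stored ad v)
  have hcells : ∀ δ, (cells δ).card ≤ L ^ q := fun δ =>
    (Finset.card_filter_le _ _).trans (card_box q L).le
  refine Runs.seq (Runs.assign ((Runs.loop (J := K)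
    (T := 1 + (loopVarsTime q (p + (1 + 1 + 1 + 1))).eval L) ?_ ?_
    ((L ^ q - (cells (s.mem, 1)).card) + 1) _ ?_).mono ?_ fun _ h => h))
  · rintro j s' ⟨h0, ⟨hA, hst⟩, -, h2⟩ he
    have hctx : s'.ctx = mk s'.mem := by rw [State.ctx, h0]
    rw [hctx]
    exact ⟨hA, fun v hv => ⟨hst v hv, h2 he v hv⟩⟩
  · rintro j s' ⟨h0, hJ', hj, -⟩ he
    change s'.reg 2 ≠ 0 at he
    refine Runs.seq (Runs.assign ((hloop _ ?_ (fun i => i.elim0) ?_).mono le_rfl ?_))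
    · exact Eq.trans (b := s'.reg 0) (Function.update_of_ne (show 0 ≠ 2 by omega) 0 _) h0
    · exact hJ'
    rintro s'' ⟨g1, g2, ⟨g3, g4, g5⟩, g6⟩
    have hd : cells (⟨Function.update s'.reg 2 ((Expr.const 0).eval s'), s'.mem⟩ : State).data =
      cells s'.data := rfl
    rw [hd] at g3 g5
    have h2 : (⟨Function.update s'.reg 2 ((Expr.const 0).eval s'), s'.mem⟩ : State).data.2 = 0 := by
      change Function.update s'.reg 2 0 2 = 0
      rw [Function.update_self]
    refine ⟨_, ?_, ?_, g2, rfl, fun h v hv => g6 v (mem_box.1 hv) h hv⟩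
    · rw [hj, if_neg he]
      by_cases h : s''.reg 2 = 0
      · rw [if_pos h]
        have := Finset.card_le_card g3
        omega
      · rw [if_neg h]
        have := (g5 h).resolve_left (fun h' => h' h2)
        have := hcells s''.data
        omega
    · exact (g1 0 (by omega) (by omega) (by omega)).trans
        (Eq.trans (b := s'.reg 0) (Function.update_of_ne (show 0 ≠ 2 by omega) 0 _) h0)
  · refine ⟨Function.update_of_ne (show 0 ≠ 2 by omega) 1 _, ⟨⟨rfl, fun _ _ => rfl⟩, fun v _ h => ?_⟩, ?_,
      fun h => ?_⟩
    · exact absurd (hzero _) h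
    · rfl
    · change Function.update s.reg 2 1 2 = 0 at h
      rw [Function.update_self] at h
      exact absurd h one_ne_zero
  · gcongr
    omega

end RAM

namespace RAM

/-! ### Reading the input -/

theorem getElem?_flatten_sum {α : Type*} {Ls : List (List α)} {j : ℕ} {x : List α}
    (hj : Ls[j]? = some x) {a : ℕ} (ha : a < x.length) :
    Ls.flatten[((Ls.take j).map List.length).sum + a]? = x[a]? := by
  induction Ls generalizing j with
  | nil => simp at hj
  | cons y Ls ih =>
    cases j with
    | zero =>
      obtain rfl : y = x := by simpa using hj
      simp [List.getElem?_append_left ha]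
    | succ j =>
      have := ih (j := j) (by simpa using hj)
      rw [List.flatten_cons, List.take_succ_cons, List.map_cons, List.sum_cons, add_assoc,
        List.getElem?_append_right (Nat.le_add_right _ _), Nat.add_sub_cancel_left, this]

/-- The position of the `j`-th list if the lists are written one after the other from cell `3` on,
each of them preceded by its length. -/
def blockStart (Ls : List (List ℕ)) (j : ℕ) : ℕ :=
  3 + ((Ls.take j).map fun x => x.length + 1).sum

/-- The lists `Ls`, each of them preceded by its length, after three numbers. -/
def blocks (a b c : ℕ) (Ls : List (List ℕ)) : List ℕ :=
  a :: b :: c :: (Ls.map fun x => x.length :: x).flatten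

theorem blockStart_succ {Ls : List (List ℕ)} {j : ℕ} {x : List ℕ} (hj : Ls[j]? = some x) :
    blockStart Ls (j + 1) = blockStart Ls j + (x.length + 1) := by
  rw [blockStart, blockStart, List.take_add_one, hj]
  simp [add_assoc]

theorem blockStart_mono (Ls : List (List ℕ)) : Monotone (blockStart Ls) :=
  monotone_nat_of_le_succ fun j => by
    rw [blockStart, blockStart, List.take_add_one, List.map_append, List.sum_append]
    omega

theorem length_blocks (a b c : ℕ) (Ls : List (List ℕ)) :
    (blocks a b c Ls).length = blockStart Ls Ls.length := by
  simp [blocks, blockStart, List.length_flatten, Function.comp_def]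
  omega

theorem getD_blocks (a b c : ℕ) {Ls : List (List ℕ)} {j : ℕ} {x : List ℕ} (hj : Ls[j]? = some x)
    {i : ℕ} (hi : i < x.length + 1) :
    (blocks a b c Ls).getD (blockStart Ls j + i) 0 = (x.length :: x).getD i 0 := by
  have h1 : (Ls.map fun x => x.length :: x)[j]? = some (x.length :: x) := by simp [hj]
  have h2 := getElem?_flatten_sum h1 (a := i) hi
  have h3 : blockStart Ls j + i =
      (((Ls.map fun x => x.length :: x).take j).map List.length).sum + i + 1 + 1 + 1 := by
    rw [blockStart, ← List.map_take, List.map_map]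
    simp only [Function.comp_def, List.length_cons]
    omega
  rw [List.getD_eq_getElem?_getD, List.getD_eq_getElem?_getD, h3, blocks,
    List.getElem?_cons_succ, List.getElem?_cons_succ, List.getElem?_cons_succ, h2]

theorem length_le_blockStart (Ls : List (List ℕ)) : Ls.length + 3 ≤ blockStart Ls Ls.length := by
  rw [blockStart, List.take_length]
  have : ∀ l : List (List ℕ), l.length ≤ (l.map fun x => x.length + 1).sum := by
    intro l
    induction l with
    | nil => simp
    | cons y l ih =>
      simp only [List.length_cons, List.map_cons, List.sum_cons]
      omega
  have := this Ls
  omega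

theorem length_lt_blockStart {Ls : List (List ℕ)} {j : ℕ} {x : List ℕ} (hj : Ls[j]? = some x) :
    x.length < blockStart Ls Ls.length := by
  have h1 := blockStart_succ hj
  have h2 : j + 1 ≤ Ls.length := (List.getElem?_eq_some_iff.1 hj).1
  have h3 := blockStart_mono Ls h2
  omega

/-- Write the positions of the lists to memory `1`. -/
def parse : Cmd :=
  .seq (.assign 4 (.const 3)) (.seq (.assign 5 (.const 0)) (.loop (.sub (.reg 0) (.reg 4))
    (.seq (.store 1 (.reg 5) (.reg 4)) (.seq
      (.assign 4 (.add (.reg 4) (.add (.load 0 (.reg 4)) (.const 1))))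
      (.assign 5 (.add (.reg 5) (.const 1)))))))

/-- The scan jumps from one length entry to the next. It terminates because even an empty list
occupies a cell. -/
theorem runs_parse {a b c : ℕ} {Ls : List (List ℕ)} {s : State}
    (h0 : s.reg 0 = (blocks a b c Ls).length)
    (hm : s.mem 0 = fun i => (blocks a b c Ls).getD i 0) :
    Runs parse s (1 + (1 + ((1 + (1 + 1) + 1) * s.reg 0 + 1))) fun s' =>
      s'.reg 0 = s.reg 0 ∧ (∀ b ≠ 1, s'.mem b = s.mem b) ∧
        ∀ j < Ls.length, s'.mem 1 j = blockStart Ls j := by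
  rw [length_blocks] at h0
  refine Runs.seq (Runs.assign (Runs.seq (Runs.assign ?_)))
  let J : ℕ → State → Prop := fun μ s' => μ = s.reg 0 - s'.reg 4 ∧ s'.reg 0 = s.reg 0 ∧
    (∀ b ≠ 1, s'.mem b = s.mem b) ∧ ∃ j ≤ Ls.length, s'.reg 5 = j ∧ s'.reg 4 = blockStart Ls j ∧
      ∀ i < j, s'.mem 1 i = blockStart Ls i
  refine (Runs.loop (J := J) (T := 1 + (1 + 1)) ?_ ?_ (s.reg 0 - 3) _ ?_).mono ?_ fun _ h => h
  · rintro μ s' ⟨-, g0, g1, j, hj, -, g4, g5⟩ he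
    refine ⟨g0, g1, ?_⟩
    simp only [Expr.eval, g0, h0, g4] at he
    obtain rfl : j = Ls.length := by
      by_contra hne
      have hlt : j < Ls.length := lt_of_le_of_ne hj hne
      have h1 := blockStart_succ (List.getElem?_eq_getElem hlt)
      have h2 := blockStart_mono Ls (show j + 1 ≤ Ls.length from hlt)
      omega
    exact g5
  · rintro μ s' ⟨hμ, g0, g1, j, hj, g3, g4, g5⟩ he
    simp only [Expr.eval, g0, h0, g4] at he
    have hlt : j < Ls.length := by
      by_contra hne
      obtain rfl : j = Ls.length := by omega
      omega
    have hget := List.getElem?_eq_getElem hlt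
    have h1 := blockStart_succ hget
    have h2 : s'.mem 0 (blockStart Ls j) = (Ls[j]).length := by
      rw [g1 0 (by omega), hm]
      exact getD_blocks a b c hget (i := 0) (by omega)
    refine Runs.seq (Runs.store (Runs.seq (Runs.assign (Runs.assign ?_))))
    have h3 : ∀ x : ℕ → ℕ, Function.update s'.mem 1 x 0 = s'.mem 0 := fun x =>
      Function.update_of_ne (by omega) _ _
    simp only [Expr.eval, g3, g4, h3, h2]
    have h4 : ∀ u v, Function.update (Function.update s'.reg 4 u) 5 v 4 = u := fun u v => by
      rw [Function.update_of_ne (by omega), Function.update_self]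
    refine ⟨_, ?_, rfl, ?_, fun b hb => ?_, j + 1, hlt, ?_, ?_, fun i hi => ?_⟩
    · simp only [h4]
      omega
    · simp [g0]
    · exact (Function.update_of_ne hb _ _).trans (g1 b hb)
    · simp only [Function.update_self]
      rw [Function.update_of_ne (by omega), g3]
    · simp only [h4, h1]
    · simp only [Function.update_self]
      rcases Nat.lt_succ_iff_lt_or_eq.1 hi with hi | rfl
      · rw [Function.update_of_ne hi.ne, g5 i hi]
      · rw [Function.update_self]
  · have h4 : ∀ u v, Function.update (Function.update s.reg 4 u) 5 v 4 = u := fun u v => by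
      rw [Function.update_of_ne (by omega), Function.update_self]
    refine ⟨?_, ?_, fun _ _ => rfl, 0, by omega, ?_, ?_, fun i hi => by omega⟩
    · simp only [Expr.eval, h4]
    · simp
    · simp only [Expr.eval, Function.update_self]
    · simp only [Expr.eval, h4]
      rfl
  · gcongr
    omega

/-! ### Multiplication tables -/

/-- Write the multiples of the number in register `3` to memory `a`, and the last one of them to
register `3`. -/
def table (a : ℕ) : Cmd :=
  .seq (.assign 4 (.const 0)) (.seq (.assign 5 (.const 0)) (.seq
    (.loop (.sub (.add (.reg 0) (.const 1)) (.reg 4)) (.seq (.store a (.reg 4) (.reg 5)) (.seq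
      (.assign 5 (.add (.reg 5) (.reg 3))) (.assign 4 (.add (.reg 4) (.const 1))))))
    (.assign 3 (.sub (.reg 5) (.reg 3)))))

theorem runs_table (a : ℕ) (s : State) :
    Runs (table a) s (1 + (1 + ((1 + (1 + 1) + 1) * (s.reg 0 + 1) + 1 + 1))) fun s' =>
      s'.reg 0 = s.reg 0 ∧ s'.reg 3 = s.reg 0 * s.reg 3 ∧ (∀ b ≠ a, s'.mem b = s.mem b) ∧
        ∀ i ≤ s.reg 0, s'.mem a i = i * s.reg 3 := by
  refine Runs.seq (Runs.assign (Runs.seq (Runs.assign (Runs.seq ?_))))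
  let J : ℕ → State → Prop := fun μ s' => μ = s.reg 0 + 1 - s'.reg 4 ∧ s'.reg 4 ≤ s.reg 0 + 1 ∧
    s'.reg 0 = s.reg 0 ∧ s'.reg 3 = s.reg 3 ∧ (∀ b ≠ a, s'.mem b = s.mem b) ∧
    s'.reg 5 = s'.reg 4 * s.reg 3 ∧ ∀ i < s'.reg 4, s'.mem a i = i * s.reg 3
  refine Runs.loop (J := J) ?_ ?_ (s.reg 0 + 1) _ ?_
  -- The running sum has gone one multiple too far; after subtracting it, register `3` holds the
  -- base of the next table.
  · rintro μ s' ⟨-, g1, g2, g3, g4, g5, g6⟩ he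
    simp only [Expr.eval, g2] at he
    have h4 : s'.reg 4 = s.reg 0 + 1 := by omega
    refine Runs.assign ⟨by simp [g2], ?_, g4,
      fun i hi => g6 i (by omega)⟩
    simp only [Function.update_self, Expr.eval, g5, g3, h4, add_mul, one_mul, Nat.add_sub_cancel]
  · rintro μ s' ⟨hμ, g1, g2, g3, g4, g5, g6⟩ he
    simp only [Expr.eval, g2] at he
    refine Runs.seq (Runs.store (Runs.seq (Runs.assign (Runs.assign ?_))))
    simp only [Expr.eval]
    have h5 : ∀ u v, Function.update (Function.update s'.reg 5 u) 4 v 5 = u := fun u v => by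
      rw [Function.update_of_ne (by omega), Function.update_self]
    have h4 : ∀ u, Function.update s'.reg 5 u 4 = s'.reg 4 := fun u =>
      Function.update_of_ne (by omega) _ _
    refine ⟨_, ?_, rfl, ?_, ?_, ?_, fun b hb => ?_, ?_, fun i hi => ?_⟩
    · simp only [Function.update_self, h4]
      omega
    · simp only [Function.update_self, h4]
      omega
    · simp [g2]
    · simp [g3]
    · exact (Function.update_of_ne hb _ _).trans (g4 b hb)
    · simp only [h5, Function.update_self, h4, g5, g3, add_mul, one_mul]
    · simp only [Function.update_self, h4] at hi ⊢
      rcases Nat.lt_succ_iff_lt_or_eq.1 hi with hi | rfl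
      · rw [Function.update_of_ne hi.ne, g6 i hi]
      · rw [Function.update_self, g5]
  · have h4 : ∀ u v, Function.update (Function.update s.reg 4 u) 5 v 4 = u := fun u v => by
      rw [Function.update_of_ne (by omega), Function.update_self]
    refine ⟨?_, ?_, ?_, ?_, fun _ _ => rfl, ?_, fun i hi => ?_⟩
    · simp only [Expr.eval, h4, Nat.sub_zero]
    · simp only [Expr.eval, h4, Nat.zero_le]
    · simp
    · simp
    · simp only [Expr.eval, h4, Function.update_self, zero_mul]
    · simp only [Expr.eval, h4] at hi
      omega

/-- Tables of the multiples of the first `d` powers of the length of the input. -/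
def powerTables : ℕ → Cmd
  | 0 => .assign 3 (.reg 0)
  | d + 1 => .seq (powerTables d) (table (11 + d))

theorem runs_powerTables (d : ℕ) (s : State) :
    Runs (powerTables d) s (1 + d * (1 + (1 + ((1 + (1 + 1) + 1) * (s.reg 0 + 1) + 1 + 1))))
      fun s' => s'.reg 0 = s.reg 0 ∧ s'.reg 3 = s.reg 0 ^ (d + 1) ∧
        (∀ b < 11, s'.mem b = s.mem b) ∧
        ∀ j < d, ∀ i ≤ s.reg 0, s'.mem (11 + j) i = i * s.reg 0 ^ (j + 1) := by
  induction d with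
  | zero =>
    refine (Runs.assign ⟨by simp, ?_, fun _ _ => rfl,
      fun j hj => by omega⟩).mono (by omega) fun _ h => h
    simp only [Function.update_self, Expr.eval, zero_add, pow_one]
  | succ d ih =>
    rw [add_mul, one_mul, ← add_assoc]
    refine Runs.seq (ih.mono le_rfl ?_)
    rintro s₁ ⟨g1, g2, g3, g4⟩
    have := runs_table (11 + d) s₁
    rw [g1, g2] at this
    refine this.mono le_rfl ?_
    rintro s₂ ⟨k1, k2, k3, k4⟩
    refine ⟨k1, ?_, fun b hb => (k3 b (by omega)).trans (g3 b hb), fun j hj i hi => ?_⟩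
    · rw [k2, pow_succ' _ (d + 1)]
    · rcases Nat.lt_succ_iff_lt_or_eq.1 hj with hj | rfl
      · rw [k3 _ (by omega), g4 j hj i hi]
      · exact k4 i hi

end RAM

/-! ### The encoding of a collection as a sequence of lists. -/

namespace MatchingPref

variable {m n : ℕ}

/-- The preference lists of all workers, then of all firms. -/
def Instance.lists (I : Instance m n) : List (List ℕ) :=
  (List.ofFn fun w => (I.workerPref w).map Fin.val) ++
    List.ofFn fun f => (I.firmPref f).map Fin.val

/-- The preference lists of all instances. -/
def OneAgentCollection.lists (C : OneAgentCollection) : List (List ℕ) :=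
  (List.ofFn fun i => (C.inst i).lists).flatten

theorem Instance.length_lists (I : Instance m n) : I.lists.length = m + n := by
  simp [Instance.lists]

theorem Instance.encode_eq (I : Instance m n) :
    I.encode = (I.lists.map fun x => x.length :: x).flatten := by
  simp [Instance.encode, Instance.lists, encodeList, List.map_ofFn, Function.comp_def]

theorem OneAgentCollection.encode_eq (C : OneAgentCollection) :
    C.encode = RAM.blocks C.m C.n C.k C.lists := by
  rw [OneAgentCollection.encode, RAM.blocks, OneAgentCollection.lists, List.map_flatten,
    List.flatten_flatten, List.map_map, List.map_ofFn]
  simp only [Function.comp_def, Instance.encode_eq]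

theorem sum_take_ofFn_length {k r : ℕ} {f : Fin k → List (List ℕ)} (hf : ∀ i, (f i).length = r)
    {i : ℕ} (hi : i ≤ k) : (((List.ofFn f).take i).map List.length).sum = i * r := by
  have : ((List.ofFn f).take i).map List.length = List.replicate i r := by
    refine List.eq_replicate_iff.2 ⟨by simp [hi], fun b hb => ?_⟩
    obtain ⟨x, hx, rfl⟩ := List.mem_map.1 hb
    obtain ⟨j, rfl⟩ := (List.mem_ofFn' _ _).1 (List.mem_of_mem_take hx)
    exact hf j
  rw [this, List.sum_replicate, smul_eq_mul]

theorem OneAgentCollection.length_lists (C : OneAgentCollection) :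
    C.lists.length = C.k * (C.m + C.n) := by
  rw [OneAgentCollection.lists, List.length_flatten,
    ← sum_take_ofFn_length (fun i => (C.inst i).length_lists) le_rfl,
    List.take_of_length_le (by simp)]

theorem OneAgentCollection.getElem?_lists (C : OneAgentCollection) (i : Fin C.k) {z : ℕ}
    (hz : z < C.m + C.n) : C.lists[i * (C.m + C.n) + z]? = (C.inst i).lists[z]? := by
  have h1 : (List.ofFn fun i => (C.inst i).lists)[(i : ℕ)]? = some (C.inst i).lists := by
    simp
  have h2 := RAM.getElem?_flatten_sum h1 (a := z) (by rwa [Instance.length_lists])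
  rwa [sum_take_ofFn_length (fun i => (C.inst i).length_lists) i.2.le] at h2

theorem OneAgentCollection.mul_add_three_le (C : OneAgentCollection) :
    C.k * (C.m + C.n) + 3 ≤ C.encode.length := by
  rw [C.encode_eq, RAM.length_blocks, ← C.length_lists]
  exact RAM.length_le_blockStart _

end MatchingPref

/-! ### Preparing random access to the input. -/

namespace RAM

open MatchingPref

/-- The memories `0`, `1`, `2` contain the collection `C`, the positions of its lists and the
numbers of the lists at which its instances begin; the memories from `11` on contain tables of
powers. -/
structure Ctx.Encodes (γ : Ctx) (C : OneAgentCollection) : Prop where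
  len : γ.len = C.encode.length
  workers : γ.mem 0 0 = C.m
  firms : γ.mem 0 1 = C.n
  insts : γ.mem 0 2 = C.k
  lists : ∀ (i : Fin C.k) (z : ℕ) (x : List ℕ), (C.inst i).lists[z]? = some x →
    ∀ a < x.length + 1, γ.mem 0 (γ.mem 1 (γ.mem 2 i + z) + a) = (x.length :: x).getD a 0
  length_lt : ∀ (i : Fin C.k) (z : ℕ) (x : List ℕ), (C.inst i).lists[z]? = some x →
    x.length < γ.len
  powers : ∀ j < 6, ∀ i ≤ γ.len, γ.mem (11 + j) i = i * γ.len ^ (j + 1)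

theorem Ctx.Encodes.agree {γ γ' : Ctx} {C : OneAgentCollection} (h : γ.Encodes C)
    (hγ : γ.Agree γ') : γ'.Encodes C := by
  obtain ⟨h1, h2, h3, h4, h5, h6, h7⟩ := h
  obtain ⟨g, k⟩ := hγ
  have k0 := k 0 (by decide)
  refine ⟨g ▸ h1, k0 ▸ h2, k0 ▸ h3, k0 ▸ h4, ?_, g ▸ h6, fun j hj => ?_⟩
  · rw [← k0, ← k 1 (by decide), ← k 2 (by decide)]
    exact h5
  · rw [← g, ← k (11 + j) (by simp only [relMem]; omega)]
    exact h7 j hj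

/-- Fill the memories `1`, `2` and those from `11` on. -/
def setup : Cmd :=
  .seq parse (.seq (.assign 3 (.add (.load 0 (.const 0)) (.load 0 (.const 1))))
    (.seq (table 2) (powerTables 6)))

theorem runs_setup (C : OneAgentCollection) :
    Runs setup (initState C.encode) (36 * C.encode.length + 100) fun s =>
      s.ctx.Encodes C ∧ ∀ i, s.mem relMem i = 0 := by
  set s := initState C.encode with hs
  have hL : s.reg 0 = C.encode.length := by
    simp [hs, initState]
  have hm0 : s.mem 0 = fun i => C.encode.getD i 0 := by
    simp [hs, initState]
  have hm4 : ∀ i, s.mem relMem i = 0 := fun i => by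
    simp [hs, initState]
  have hcode := C.encode_eq
  have hlen := C.mul_add_three_le
  rw [← hL] at hlen ⊢
  refine Runs.mono (T := (1 + (1 + ((1 + (1 + 1) + 1) * s.reg 0 + 1))) +
    (1 + ((1 + (1 + ((1 + (1 + 1) + 1) * (s.reg 0 + 1) + 1 + 1))) +
      (1 + 6 * (1 + (1 + ((1 + (1 + 1) + 1) * (s.reg 0 + 1) + 1 + 1))))))) ?_ (by omega)
      fun _ h => h
  refine Runs.seq ((runs_parse (by rw [hL, hcode]) (by rw [hm0, hcode])).mono le_rfl ?_)
  rintro s₁ ⟨g1, g2, g3⟩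
  refine Runs.seq (Runs.assign (Runs.seq ?_))
  have htab := runs_table 2 ⟨Function.update s₁.reg 3
    ((Expr.add (.load 0 (.const 0)) (.load 0 (.const 1))).eval s₁), s₁.mem⟩
  have h0 : Function.update s₁.reg 3
    ((Expr.add (.load 0 (.const 0)) (.load 0 (.const 1))).eval s₁) 0 = s.reg 0 := by
    rw [Function.update_of_ne (by decide), g1]
  have h3 : (Expr.add (.load 0 (.const 0)) (.load 0 (.const 1))).eval s₁ = C.m + C.n := by
    simp only [Expr.eval, g2 0 (by decide), hm0, hcode]
    rfl
  rw [h3] at h0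
  simp only [Function.update_self, h3] at htab
  rw [h0] at htab
  rw [h3]
  refine htab.mono le_rfl ?_
  rintro s₂ ⟨k1, -, k3, k4⟩
  have hpow := runs_powerTables 6 s₂
  rw [k1] at hpow
  refine hpow.mono le_rfl ?_
  rintro s₃ ⟨p1, -, p3, p4⟩
  have e0 : s₃.mem 0 = fun i => C.encode.getD i 0 := by
    rw [p3 0 (by omega), k3 0 (by omega), g2 0 (by omega), hm0]
  have e1 : s₃.mem 1 = s₁.mem 1 := by rw [p3 1 (by omega), k3 1 (by omega)]
  have e2 : s₃.mem 2 = s₂.mem 2 := p3 2 (by omega)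
  have hpos : ∀ (i : Fin C.k) (z : ℕ) (x : List ℕ), (C.inst i).lists[z]? = some x →
      C.lists[i * (C.m + C.n) + z]? = some x := by
    intro i z x hx
    rw [C.getElem?_lists i, hx]
    rw [← (C.inst i).length_lists]
    exact (List.getElem?_eq_some_iff.1 hx).1
  have hctx : s₃.ctx.len = s.reg 0 := p1
  refine ⟨⟨p1.trans hL, ?_, ?_, ?_, fun i z x hx a ha => ?_, fun i z x hx => ?_, ?_⟩, fun i => ?_⟩
  · change s₃.mem 0 0 = _
    rw [e0]
    rfl
  · change s₃.mem 0 1 = _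
    rw [e0]
    rfl
  · change s₃.mem 0 2 = _
    rw [e0]
    rfl
  · change s₃.mem 0 (s₃.mem 1 (s₃.mem 2 i + z) + a) = _
    have hlt := (List.getElem?_eq_some_iff.1 (hpos i z x hx)).1
    have hz := (List.getElem?_eq_some_iff.1 hx).1
    rw [(C.inst i).length_lists] at hz
    -- The table of multiples reaches only up to the input length. As a list exists, `C.m + C.n` is
    -- positive, so the number of instances stays below that length.
    have hi : (i : ℕ) ≤ s.reg 0 := by
      have h5 : (i : ℕ) ≤ C.k * (C.m + C.n) := i.2.le.trans (Nat.le_mul_of_pos_right _ (by omega))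
      omega
    rw [e2, k4 i hi, e1, g3 _ hlt, e0, hcode]
    exact getD_blocks _ _ _ (hpos i z x hx) ha
  · rw [hctx, hL, hcode, length_blocks]
    exact length_lt_blockStart (hpos i z x hx)
  · rw [hctx]
    exact p4
  · rw [p3 _ (by decide), k3 _ (by decide), g2 _ (by decide)]
    exact hm4 i

end RAM

/-! ### Definability of the stable matching computation. -/

namespace RAM

open MatchingPref

variable {q : ℕ}

theorem FDef.const (P : Prop) : FDef q fun _ _ => P := by
  by_cases h : P
  · exact (FDef.eq (TmDef.const 0) (TmDef.const 0)).congr fun _ _ => by simp [h]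
  · exact (FDef.lt (TmDef.const 0) (TmDef.const 0)).congr fun _ _ => by simp [h]

theorem FDef.iff {P Q : Ctx → (Fin q → ℕ) → Prop} (hP : FDef q P) (hQ : FDef q Q) :
    FDef q fun γ v => P γ v ↔ Q γ v :=
  ((hP.imp hQ).and (hQ.imp hP)).congr fun _ _ => iff_def

theorem FDef.exBool {P : Bool → Ctx → (Fin q → ℕ) → Prop} (h : ∀ s, FDef q (P s)) :
    FDef q fun γ v => ∃ s, P s γ v :=
  ((h false).or (h true)).congr fun _ _ => Bool.exists_bool

theorem FDef.allBool {P : Bool → Ctx → (Fin q → ℕ) → Prop} (h : ∀ s, FDef q (P s)) :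
    FDef q fun γ v => ∀ s, P s γ v :=
  ((h false).and (h true)).congr fun _ _ => Bool.forall_bool

/-- Contracts, given by the numbers of the two agents and the level. -/
abbrev Ct : Type := (Bool → ℕ) × ℕ

/-- The contract of the worker `w` and the firm `f` with level `l`. -/
def toCt (w f l : ℕ) : Ct :=
  (fun s => cond s f w, l)

theorem toCt_eta (c : Ct) : toCt (c.1 false) (c.1 true) c.2 = c :=
  Prod.ext (funext fun s => by cases s <;> rfl) rfl

/-- All numbers that describe the contract are below `L`. -/
def Ct.Below (c : Ct) (L : ℕ) : Prop :=
  (∀ s, c.1 s < L) ∧ c.2 < L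

/-- The numbers that describe the contract are terms. -/
def CtDef (q : ℕ) (t : Ctx → (Fin q → ℕ) → Ct) : Prop :=
  (∀ s, TmDef q fun γ v => (t γ v).1 s) ∧ TmDef q fun γ v => (t γ v).2

theorem CtDef.mk {w f l : Ctx → (Fin q → ℕ) → ℕ} (hw : TmDef q w) (hf : TmDef q f)
    (hl : TmDef q l) : CtDef q fun γ v => toCt (w γ v) (f γ v) (l γ v) :=
  ⟨fun s => by cases s <;> assumption, hl⟩

/-- The values of all but the last three variables. -/
def init₃ (v : Fin (q + 3) → ℕ) : Fin q → ℕ :=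
  Fin.init (Fin.init (Fin.init v))

/-- The last three variables, seen as a contract. -/
def last₃ (v : Fin (q + 3) → ℕ) : Ct :=
  toCt (Fin.init (Fin.init v) (Fin.last q)) (Fin.init v (Fin.last (q + 1))) (v (Fin.last (q + 2)))

theorem TmDef.lift₃ {t : Ctx → (Fin q → ℕ) → ℕ} (ht : TmDef q t) :
    TmDef (q + 3) fun γ v => t γ (init₃ v) :=
  ht.lift.lift.lift

theorem CtDef.lift {t : Ctx → (Fin q → ℕ) → Ct} (ht : CtDef q t) :
    CtDef (q + 1) fun γ v => t γ (Fin.init v) :=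
  ⟨fun s => (ht.1 s).lift, ht.2.lift⟩

theorem CtDef.lift₃ {t : Ctx → (Fin q → ℕ) → Ct} (ht : CtDef q t) :
    CtDef (q + 3) fun γ v => t γ (init₃ v) :=
  ⟨fun s => (ht.1 s).lift₃, ht.2.lift₃⟩

theorem CtDef.last₃ : CtDef (q + 3) fun _ v => last₃ v :=
  CtDef.mk TmDef.last.lift.lift TmDef.last.lift TmDef.last

theorem FDef.exCt {Q : Ctx → (Fin q → ℕ) → Ct → Prop}
    (hQ : FDef (q + 3) fun γ v => Q γ (init₃ v) (last₃ v)) :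
    FDef q fun γ v => ∃ c : Ct, c.Below γ.len ∧ Q γ v c := by
  refine (FDef.ex (Q := fun γ v w => ∃ f < γ.len, ∃ l < γ.len, Q γ v (toCt w f l))
    (FDef.ex (Q := fun γ v f => ∃ l < γ.len, Q γ (Fin.init v) (toCt (v (Fin.last q)) f l))
      (FDef.ex (Q := fun γ v l => Q γ (Fin.init (Fin.init v))
        (toCt (Fin.init v (Fin.last q)) (v (Fin.last (q + 1))) l)) hQ))).congr fun γ v => ?_
  constructor
  · rintro ⟨c, ⟨h1, h2⟩, h3⟩
    exact ⟨_, h1 false, _, h1 true, _, h2, by rwa [toCt_eta]⟩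
  · rintro ⟨w, hw, f, hf, l, hl, h⟩
    exact ⟨toCt w f l, ⟨fun s => by cases s <;> assumption, hl⟩, h⟩

theorem FDef.allCt {Q : Ctx → (Fin q → ℕ) → Ct → Prop}
    (hQ : FDef (q + 3) fun γ v => Q γ (init₃ v) (last₃ v)) :
    FDef q fun γ v => ∀ c : Ct, c.Below γ.len → Q γ v c :=
  (FDef.exCt (Q := fun γ v c => ¬ Q γ v c) hQ.not).not.congr fun _ _ => by push Not; rfl

/-! ### The formulas of the algorithm -/

namespace Ctx

/-- The entry with number `a` of the list of agent `z` in instance `i` is `u`. -/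
def Pos (γ : Ctx) (i z a u : ℕ) : Prop :=
  a < γ.mem 0 (γ.mem 1 (γ.mem 2 i + z)) ∧ γ.mem 0 (γ.mem 1 (γ.mem 2 i + z) + (a + 1)) = u

/-- The number of the list of agent `u` on side `s`. -/
def idx (γ : Ctx) (s : Bool) (u : ℕ) : ℕ :=
  cond s (γ.mem 0 0 + u) u

/-- In some instance the agent `x` on side `s` prefers `u` to `u'`. -/
def Better (γ : Ctx) (s : Bool) (x u u' : ℕ) : Prop :=
  ∃ i < γ.len, i < γ.mem 0 2 ∧ ∃ a < γ.len, ∃ b < γ.len,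
    a < b ∧ γ.Pos i (γ.idx s x) a u ∧ γ.Pos i (γ.idx s x) b u'

/-- The contract belongs to an edge, and its level is below `lam`. -/
def Allowed (γ : Ctx) (lam : ℕ) (c : Ct) : Prop :=
  c.2 < lam ∧ c.1 false < γ.mem 0 0 ∧ ∃ a < γ.len, γ.Pos 0 (c.1 false) a (c.1 true)

/-- The contracts have the same agent on side `s`, and this agent prefers `c` to `d`. -/
def Above (γ : Ctx) (s : Bool) (c d : Ct) : Prop :=
  c.1 s = d.1 s ∧ (levelCost s c.2 < levelCost s d.2 ∨
    levelCost s c.2 = levelCost s d.2 ∧ γ.Better s (c.1 s) (c.1 !s) (d.1 !s))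

/-- The contracts that threaten the forced contract `o`. -/
def Threatens (γ : Ctx) (lam : ℕ) (o d : Ct) : Prop :=
  γ.Allowed lam d ∧ (∃ s, d.1 s = o.1 s) ∧
    ¬ (γ.Allowed lam o ∧ ∃ s, o.1 s = d.1 s ∧ ¬ γ.Above s d o)

/-- The contracts that remain when `o` is forced. -/
def Remains (γ : Ctx) (lam : ℕ) (o c : Ct) : Prop :=
  γ.Allowed lam c ∧ (¬ ∃ s, c.1 s = o.1 s) ∧
    ∀ d : Ct, d.Below γ.len → γ.Threatens lam o d → ∀ s, c.1 s = d.1 s → γ.Above s c d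

/-- The cell of `relMem` for the parameters `lam`, `o` and the contract `c`. -/
def cell (γ : Ctx) (lam : ℕ) (o c : Ct) : ℕ :=
  γ.mem 16 lam + (γ.mem 15 (o.1 false) + (γ.mem 14 (o.1 true) + (γ.mem 13 o.2 +
    (γ.mem 12 (c.1 false) + (γ.mem 11 (c.1 true) + c.2)))))

/-- The contract `c` is marked as rejected. -/
def Marked (γ : Ctx) (lam : ℕ) (o c : Ct) : Prop :=
  γ.mem relMem (γ.cell lam o c) ≠ 0

/-- Everything that the worker prefers is marked. -/
def ProposedTo (γ : Ctx) (lam : ℕ) (o c : Ct) : Prop :=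
  ∀ d : Ct, d.Below γ.len → γ.Remains lam o d → γ.Above false d c → γ.Marked lam o d

/-- The firm gets a better proposal. -/
def RejectedBy (γ : Ctx) (lam : ℕ) (o c : Ct) : Prop :=
  ∃ d : Ct, d.Below γ.len ∧ γ.Remains lam o d ∧ γ.Above true d c ∧ γ.ProposedTo lam o d

/-- The partners of all threats have a contract. -/
def Safe (γ : Ctx) (lam : ℕ) (o : Ct) : Prop :=
  ∀ d : Ct, d.Below γ.len → γ.Threatens lam o d → ∃ c : Ct, c.Below γ.len ∧
    (γ.Remains lam o c ∧ ¬ γ.Marked lam o c ∧ γ.ProposedTo lam o c) ∧ ∃ s, c.1 s = d.1 s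

/-- The agent with list `z` has the same list in all instances. -/
def Same (γ : Ctx) (z : ℕ) : Prop :=
  ∀ i < γ.len, i < γ.mem 0 2 → ∀ a < γ.len, ∀ u < γ.len, γ.Pos i z a u ↔ γ.Pos 0 z a u

/-- All agents except one of those of `o` have the same list in all instances. -/
def OthersSame (γ : Ctx) (o : Ct) : Prop :=
  ∃ s₀, ∀ s, ∀ z < γ.len, z < γ.mem 0 (cond s 1 0) → ¬ (s = s₀ ∧ z = o.1 s₀) →
    γ.Same (γ.idx s z)

/-- The answer of the algorithm. -/
def Answer (dom : Bool) (γ : Ctx) : Prop :=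
  ∃ lam < γ.len, ∃ o : Ct, o.Below γ.len ∧ LevelsFor dom lam ∧ o.2 < lam ∧ γ.OthersSame o ∧
    γ.Safe lam o

end Ctx

variable {i z a u x y lam : Ctx → (Fin q → ℕ) → ℕ} {c d o : Ctx → (Fin q → ℕ) → Ct}

theorem FDef.pos (hi : TmDef q i) (hz : TmDef q z) (ha : TmDef q a) (hu : TmDef q u) :
    FDef q fun γ v => γ.Pos (i γ v) (z γ v) (a γ v) (u γ v) :=
  have h := TmDef.load 1 (((TmDef.load 2 hi).add hz))
  (FDef.lt ha (TmDef.load 0 h)).and (FDef.eq (TmDef.load 0 (h.add (ha.add (TmDef.const 1)))) hu)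

theorem TmDef.idx (s : Bool) (hu : TmDef q u) : TmDef q fun γ v => γ.idx s (u γ v) := by
  cases s
  · exact hu
  · exact (TmDef.load 0 (TmDef.const 0)).add hu

theorem FDef.better (s : Bool) (hx : TmDef q x) (hu : TmDef q u) (hy : TmDef q y) :
    FDef q fun γ v => γ.Better s (x γ v) (u γ v) (y γ v) := by
  refine FDef.ex (Q := fun γ v i => i < γ.mem 0 2 ∧ ∃ a < γ.len, ∃ b < γ.len,
    a < b ∧ γ.Pos i (γ.idx s (x γ v)) a (u γ v) ∧ γ.Pos i (γ.idx s (x γ v)) b (y γ v))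
    (.and (.lt .last (.load 0 (.const 2))) ?_)
  refine FDef.ex (Q := fun γ v a => ∃ b < γ.len, a < b ∧
    γ.Pos (v (Fin.last q)) (γ.idx s (x γ (Fin.init v))) a (u γ (Fin.init v)) ∧
    γ.Pos (v (Fin.last q)) (γ.idx s (x γ (Fin.init v))) b (y γ (Fin.init v))) ?_
  refine FDef.ex (Q := fun γ v b => v (Fin.last (q + 1)) < b ∧
    γ.Pos (Fin.init v (Fin.last q)) (γ.idx s (x γ (Fin.init (Fin.init v)))) (v (Fin.last (q + 1)))
      (u γ (Fin.init (Fin.init v))) ∧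
    γ.Pos (Fin.init v (Fin.last q)) (γ.idx s (x γ (Fin.init (Fin.init v)))) b
      (y γ (Fin.init (Fin.init v)))) ?_
  exact .and (.lt TmDef.last.lift .last) (.and
    (.pos TmDef.last.lift.lift (.idx s hx.lift.lift.lift) TmDef.last.lift hu.lift.lift.lift)
    (.pos TmDef.last.lift.lift (.idx s hx.lift.lift.lift) .last hy.lift.lift.lift))

theorem FDef.allowed (hlam : TmDef q lam) (hc : CtDef q c) :
    FDef q fun γ v => γ.Allowed (lam γ v) (c γ v) :=
  .and (.lt hc.2 hlam) (.and (.lt (hc.1 false) (.load 0 (.const 0)))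
    (.ex (.pos (.const 0) (hc.1 false).lift .last (hc.1 true).lift)))

theorem TmDef.levelCost (s : Bool) (hu : TmDef q u) : TmDef q fun γ v => levelCost s (u γ v) := by
  cases s
  · exact hu
  · exact (TmDef.const 1).sub hu

theorem FDef.above (s : Bool) (hc : CtDef q c) (hd : CtDef q d) :
    FDef q fun γ v => γ.Above s (c γ v) (d γ v) :=
  .and (.eq (hc.1 s) (hd.1 s)) (.or (.lt (.levelCost s hc.2) (.levelCost s hd.2))
    (.and (.eq (.levelCost s hc.2) (.levelCost s hd.2))
      (.better s (hc.1 s) (hc.1 !s) (hd.1 !s))))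

theorem FDef.threatens (hlam : TmDef q lam) (ho : CtDef q o) (hd : CtDef q d) :
    FDef q fun γ v => γ.Threatens (lam γ v) (o γ v) (d γ v) :=
  .and (.allowed hlam hd) (.and (.exBool fun s => .eq (hd.1 s) (ho.1 s))
    (.not (.and (.allowed hlam ho)
      (.exBool fun s => .and (.eq (ho.1 s) (hd.1 s)) (.not (.above s hd ho))))))

theorem FDef.remains (hlam : TmDef q lam) (ho : CtDef q o) (hc : CtDef q c) :
    FDef q fun γ v => γ.Remains (lam γ v) (o γ v) (c γ v) :=
  .and (.allowed hlam hc) (.and (.not (.exBool fun s => .eq (hc.1 s) (ho.1 s)))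
    (.allCt (Q := fun γ v d => γ.Threatens (lam γ v) (o γ v) d →
        ∀ s, (c γ v).1 s = d.1 s → γ.Above s (c γ v) d)
      (.imp (.threatens hlam.lift₃ ho.lift₃ .last₃)
        (.allBool fun s => .imp (.eq (hc.lift₃.1 s) (CtDef.last₃.1 s))
          (.above s hc.lift₃ .last₃)))))

theorem TmDef.cell (hlam : TmDef q lam) (ho : CtDef q o) (hc : CtDef q c) :
    TmDef q fun γ v => γ.cell (lam γ v) (o γ v) (c γ v) :=
  .add (.load 16 hlam) (.add (.load 15 (ho.1 false)) (.add (.load 14 (ho.1 true))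
    (.add (.load 13 ho.2) (.add (.load 12 (hc.1 false)) (.add (.load 11 (hc.1 true)) hc.2)))))

theorem FDef.marked (hlam : TmDef q lam) (ho : CtDef q o) (hc : CtDef q c) :
    FDef q fun γ v => γ.Marked (lam γ v) (o γ v) (c γ v) :=
  .ne (.load relMem (.cell hlam ho hc)) (.const 0)

theorem FDef.proposedTo (hlam : TmDef q lam) (ho : CtDef q o) (hc : CtDef q c) :
    FDef q fun γ v => γ.ProposedTo (lam γ v) (o γ v) (c γ v) :=
  .allCt (Q := fun γ v d => γ.Remains (lam γ v) (o γ v) d → γ.Above false d (c γ v) →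
      γ.Marked (lam γ v) (o γ v) d)
    (.imp (.remains hlam.lift₃ ho.lift₃ .last₃) (.imp (.above false .last₃ hc.lift₃)
      (.marked hlam.lift₃ ho.lift₃ .last₃)))

theorem FDef.rejectedBy (hlam : TmDef q lam) (ho : CtDef q o) (hc : CtDef q c) :
    FDef q fun γ v => γ.RejectedBy (lam γ v) (o γ v) (c γ v) :=
  .exCt (Q := fun γ v d => γ.Remains (lam γ v) (o γ v) d ∧ γ.Above true d (c γ v) ∧
      γ.ProposedTo (lam γ v) (o γ v) d)
    (.and (.remains hlam.lift₃ ho.lift₃ .last₃) (.and (.above true .last₃ hc.lift₃)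
      (.proposedTo hlam.lift₃ ho.lift₃ .last₃)))

theorem FDef.safe (hlam : TmDef q lam) (ho : CtDef q o) :
    FDef q fun γ v => γ.Safe (lam γ v) (o γ v) := by
  refine .allCt (Q := fun γ v d => γ.Threatens (lam γ v) (o γ v) d →
    ∃ c : Ct, c.Below γ.len ∧ (γ.Remains (lam γ v) (o γ v) c ∧ ¬ γ.Marked (lam γ v) (o γ v) c ∧
      γ.ProposedTo (lam γ v) (o γ v) c) ∧ ∃ s, c.1 s = d.1 s)
    (.imp (.threatens hlam.lift₃ ho.lift₃ .last₃) ?_)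
  refine .exCt (Q := fun γ v c => (γ.Remains (lam γ (init₃ v)) (o γ (init₃ v)) c ∧
    ¬ γ.Marked (lam γ (init₃ v)) (o γ (init₃ v)) c ∧
      γ.ProposedTo (lam γ (init₃ v)) (o γ (init₃ v)) c) ∧ ∃ s, c.1 s = (last₃ v).1 s) ?_
  exact .and (.and (.remains hlam.lift₃.lift₃ ho.lift₃.lift₃ .last₃)
    (.and (.not (.marked hlam.lift₃.lift₃ ho.lift₃.lift₃ .last₃))
      (.proposedTo hlam.lift₃.lift₃ ho.lift₃.lift₃ .last₃)))
    (.exBool fun s => .eq (CtDef.last₃.1 s) (CtDef.last₃.lift₃.1 s))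

theorem FDef.same (hz : TmDef q z) : FDef q fun γ v => γ.Same (z γ v) := by
  refine FDef.all (Q := fun γ v i => i < γ.mem 0 2 → ∀ a < γ.len, ∀ u < γ.len,
    γ.Pos i (z γ v) a u ↔ γ.Pos 0 (z γ v) a u) (.imp (.lt .last (.load 0 (.const 2))) ?_)
  refine FDef.all (Q := fun γ v a => ∀ u < γ.len, γ.Pos (v (Fin.last q)) (z γ (Fin.init v)) a u ↔
    γ.Pos 0 (z γ (Fin.init v)) a u) ?_
  refine FDef.all (Q := fun γ v u =>
    γ.Pos (Fin.init v (Fin.last q)) (z γ (Fin.init (Fin.init v))) (v (Fin.last (q + 1))) u ↔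
    γ.Pos 0 (z γ (Fin.init (Fin.init v))) (v (Fin.last (q + 1))) u) ?_
  exact .iff (.pos TmDef.last.lift.lift hz.lift.lift.lift TmDef.last.lift .last)
    (.pos (.const 0) hz.lift.lift.lift TmDef.last.lift .last)

theorem FDef.othersSame (ho : CtDef q o) : FDef q fun γ v => γ.OthersSame (o γ v) := by
  refine .exBool fun s₀ => .allBool fun s => ?_
  refine FDef.all (Q := fun γ v z => z < γ.mem 0 (cond s 1 0) → ¬ (s = s₀ ∧ z = (o γ v).1 s₀) →
    γ.Same (γ.idx s z)) ?_
  exact .imp (.lt .last (.load 0 (.const _)))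
    (.imp (.not (.and (.const _) (.eq .last (ho.lift.1 s₀)))) (.same (.idx s .last)))

theorem FDef.levelsFor (dom : Bool) (hlam : TmDef q lam) :
    FDef q fun γ v => LevelsFor dom (lam γ v) :=
  .or (.eq hlam (.const 2)) (.and (.eq hlam (.const 1)) (.const _))

theorem FDef.answer (dom : Bool) : FDef q fun γ _ => γ.Answer dom := by
  refine FDef.ex (Q := fun γ _ lam => ∃ o : Ct, o.Below γ.len ∧ LevelsFor dom lam ∧ o.2 < lam ∧
    γ.OthersSame o ∧ γ.Safe lam o) ?_
  refine FDef.exCt (Q := fun γ v o => LevelsFor dom (v (Fin.last q)) ∧ o.2 < v (Fin.last q) ∧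
    γ.OthersSame o ∧ γ.Safe (v (Fin.last q)) o) ?_
  exact .and (.levelsFor dom TmDef.last.lift₃) (.and (.lt CtDef.last₃.2 TmDef.last.lift₃)
    (.and (.othersSame .last₃) (.safe TmDef.last.lift₃ .last₃)))

end RAM

/-! ### Computing the marks and running the whole program. -/

namespace RAM

open MatchingPref

namespace Ctx

variable {γ γ' : Ctx}

theorem Agree.symm (h : γ.Agree γ') : γ'.Agree γ :=
  ⟨h.1.symm, fun a ha => (h.2 a ha).symm⟩

theorem Agree.trans {γ'' : Ctx} (h : γ.Agree γ') (h' : γ'.Agree γ'') : γ.Agree γ'' :=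
  ⟨h.1.trans h'.1, fun a ha => (h.2 a ha).trans (h'.2 a ha)⟩

theorem Agree.above (h : γ.Agree γ') : γ.Above = γ'.Above := by
  unfold Above Better Pos idx
  rw [h.1, h.2 0 (by decide), h.2 1 (by decide), h.2 2 (by decide)]

theorem Agree.allowed (h : γ.Agree γ') : γ.Allowed = γ'.Allowed := by
  unfold Allowed Pos
  rw [h.1, h.2 0 (by decide), h.2 1 (by decide), h.2 2 (by decide)]

theorem Agree.remains (h : γ.Agree γ') : γ.Remains = γ'.Remains := by
  unfold Remains Threatens
  rw [h.1, h.above, h.allowed]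

theorem Agree.cell (h : γ.Agree γ') : γ.cell = γ'.cell := by
  unfold Ctx.cell
  rw [h.2 11 (by decide), h.2 12 (by decide), h.2 13 (by decide), h.2 14 (by decide),
    h.2 15 (by decide), h.2 16 (by decide)]

/-- Marks occur only positively in `RejectedBy`, and all other ingredients do not read `relMem`;
this is the monotonicity that the fixpoint program needs. -/
theorem RejectedBy.mono (h : γ.Agree γ') {lam : ℕ} {o c : Ct}
    (hm : ∀ d : Ct, d.Below γ.len → γ.Marked lam o d → γ'.Marked lam o d)
    (hc : γ.RejectedBy lam o c) : γ'.RejectedBy lam o c := by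
  obtain ⟨d, h1, h2, h3, h4⟩ := hc
  refine ⟨d, h.1 ▸ h1, h.remains ▸ h2, h.above ▸ h3, fun d' g1 g2 g3 => ?_⟩
  rw [← h.1] at g1
  rw [← h.remains] at g2
  rw [← h.above] at g3
  exact hm d' g1 (h4 d' g1 g2 g3)

/-- The marks are a fixpoint. -/
def IsMarked (γ : Ctx) : Prop :=
  ∀ lam < γ.len, ∀ o : Ct, o.Below γ.len → ∀ c : Ct, c.Below γ.len →
    (γ.Marked lam o c ↔ γ.RejectedBy lam o c)

end Ctx

theorem mul_add_inj {L a b a' b' : ℕ} (hb : b < L) (hb' : b' < L) (h : a * L + b = a' * L + b') :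
    a = a' ∧ b = b' := by
  have hL : 0 < L := by omega
  have h2 := congrArg (· % L) h
  simp only [Nat.mul_add_mod', Nat.mod_eq_of_lt hb, Nat.mod_eq_of_lt hb']
    at h2
  exact ⟨by subst h2; exact Nat.eq_of_mul_eq_mul_right hL (by omega), h2⟩

/-- The contract with the numbers `v i`, `v j`, `v l`. -/
def ctAt (v : Fin 7 → ℕ) (i j l : Fin 7) : Ct :=
  toCt (v i) (v j) (v l)

theorem CtDef.ctAt (i j l : Fin 7) : CtDef 7 fun _ v => ctAt v i j l :=
  .mk (.var i) (.var j) (.var l)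

theorem below_ctAt {L : ℕ} {v : Fin 7 → ℕ} (hv : ∀ i, v i < L) (i j l : Fin 7) :
    (ctAt v i j l).Below L :=
  ⟨fun s => by cases s <;> exact hv _, hv _⟩

/-- The address has the seven numbers as its digits in base `γ.len`; the power tables stand in for
the multiplications. -/
theorem cell_inj {γ : Ctx} {C : OneAgentCollection} (h : γ.Encodes C) {v w : Fin 7 → ℕ}
    (hv : ∀ i, v i < γ.len) (hw : ∀ i, w i < γ.len)
    (hvw : γ.cell (v 0) (ctAt v 1 2 3) (ctAt v 4 5 6) =
      γ.cell (w 0) (ctAt w 1 2 3) (ctAt w 4 5 6)) : v = w := by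
  set L := γ.len with hL
  have key : ∀ v : Fin 7 → ℕ, (∀ i, v i < L) → γ.cell (v 0) (ctAt v 1 2 3) (ctAt v 4 5 6) =
      (((((v 0 * L + v 1) * L + v 2) * L + v 3) * L + v 4) * L + v 5) * L + v 6 := by
    intro v hv
    have h0 := h.powers 5 (by omega) (v 0) (hv 0).le
    have h1 := h.powers 4 (by omega) (v 1) (hv 1).le
    have h2 := h.powers 3 (by omega) (v 2) (hv 2).le
    have h3 := h.powers 2 (by omega) (v 3) (hv 3).le
    have h4 := h.powers 1 (by omega) (v 4) (hv 4).le
    have h5 := h.powers 0 (by omega) (v 5) (hv 5).le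
    simp only [Nat.reduceAdd, ← hL] at h0 h1 h2 h3 h4 h5
    simp only [Ctx.cell, ctAt, toCt, cond_false, cond_true, h0, h1, h2, h3, h4, h5]
    ring
  rw [key v hv, key w hw] at hvw
  obtain ⟨hvw, h6⟩ := mul_add_inj (hv 6) (hw 6) hvw
  obtain ⟨hvw, h5⟩ := mul_add_inj (hv 5) (hw 5) hvw
  obtain ⟨hvw, h4⟩ := mul_add_inj (hv 4) (hw 4) hvw
  obtain ⟨hvw, h3⟩ := mul_add_inj (hv 3) (hw 3) hvw
  obtain ⟨hvw, h2⟩ := mul_add_inj (hv 2) (hw 2) hvw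
  obtain ⟨h0, h1⟩ := mul_add_inj (hv 1) (hw 1) hvw
  funext i
  fin_cases i <;> assumption

/-- One fixpoint of a relation in seven variables (the number of levels, the forced contract, the
contract in question) runs deferred acceptance for all parameters at once. -/
theorem exists_cmd_isMarked : ∃ (c : Cmd) (p : Polynomial ℕ), ∀ (s : State)
    (C : OneAgentCollection), s.ctx.Encodes C → (∀ i, s.mem relMem i = 0) →
    Runs c s (p.eval (s.reg 0)) fun s' => s'.ctx.Encodes C ∧ s'.ctx.IsMarked := by
  have h0 : TmDef 7 fun _ v => v 0 := .var 0
  obtain ⟨c, p, hc⟩ := exists_cmd_fixpoint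
    (FDef.rejectedBy h0 (CtDef.ctAt 1 2 3) (CtDef.ctAt 4 5 6))
    (TmDef.cell h0 (CtDef.ctAt 1 2 3) (CtDef.ctAt 4 5 6))
  refine ⟨c, p, fun s C hs hzero => (hc s (fun γ h v => ?_) (fun v hv w hw h => ?_)
    (fun γ γ' h h' hm v hv hv' => ?_) hzero).mono le_rfl ?_⟩
  · rw [h.cell]
  · rw [mem_box] at hv hw
    exact cell_inj hs hv hw h
  · rw [mem_box] at hv
    refine Ctx.RejectedBy.mono (h.symm.trans h') (fun d hd hmd => ?_) hv'
    rw [← h.1] at hd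
    have hval : ∀ i, ![v 0, v 1, v 2, v 3, d.1 false, d.1 true, d.2] i < s.reg 0 := by
      intro i
      fin_cases i
      exacts [hv 0, hv 1, hv 2, hv 3, hd.1 _, hd.1 _, hd.2]
    have := hm _ (mem_box.2 hval)
    have hd' : ctAt ![v 0, v 1, v 2, v 3, d.1 false, d.1 true, d.2] 4 5 6 = d := toCt_eta d
    simp only [Ctx.Stored, hd'] at this
    exact this hmd
  · rintro s' ⟨hag, hs'⟩
    refine ⟨hs.agree hag, fun lam hlam o ho d hd => ?_⟩
    rw [← hag.1] at hlam ho hd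
    have hval : ∀ i, ![lam, o.1 false, o.1 true, o.2, d.1 false, d.1 true, d.2] i < s.reg 0 := by
      intro i
      fin_cases i
      exacts [hlam, ho.1 _, ho.1 _, ho.2, hd.1 _, hd.1 _, hd.2]
    have := hs' _ (mem_box.2 hval)
    have hd' : ctAt ![lam, o.1 false, o.1 true, o.2, d.1 false, d.1 true, d.2] 4 5 6 = d :=
      toCt_eta d
    have ho' : ctAt ![lam, o.1 false, o.1 true, o.2, d.1 false, d.1 true, d.2] 1 2 3 = o :=
      toCt_eta o
    simp only [Ctx.Stored, hd', ho'] at this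
    exact this

/-- If the answer of the algorithm is right, then it decides the problem. -/
theorem decidesInPolyTime_of_answer (dom : Bool) {P : OneAgentCollection → Prop}
    (hzero : ∀ C : OneAgentCollection, C.k = 0 → P C)
    (hP : ∀ (C : OneAgentCollection) (γ : Ctx), 0 < C.k → γ.Encodes C → γ.IsMarked →
      (γ.Answer dom ↔ P C)) : DecidesInPolyTime OneAgentCollection.encode P := by
  obtain ⟨c, p, hc⟩ := exists_cmd_isMarked
  obtain ⟨d, r, hd⟩ := FDef.answer (q := 0) dom
  -- Cell 2 of the input is `k`. The case `k = 0` is answered separately, since then the length of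
  -- the input does not bound `m` and `n`.
  refine ⟨.ite (.load 0 (.const 2)) (.seq setup (.seq c (.seq d (.assign 0 (.reg 1)))))
    (.assign 0 (.const 1)), (Polynomial.C 36 * Polynomial.X + Polynomial.C 100) + (p + (r + 1)) + 1,
    fun C => ?_⟩
  have hinst : (Expr.load 0 (.const 2)).eval (initState C.encode) = C.k := by
    simp [Expr.eval, initState, OneAgentCollection.encode]
  simp only [Polynomial.eval_add, Polynomial.eval_mul, Polynomial.eval_C, Polynomial.eval_X,
    Polynomial.eval_one]
  change Runs _ _ _ fun s => (P C → s.reg 0 = 1) ∧ (¬ P C → s.reg 0 = 0)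
  refine Runs.ite (fun hk => ?_) fun hk => ?_
  · rw [hinst] at hk
    refine Runs.seq ((runs_setup C).mono le_rfl ?_)
    rintro s₁ ⟨h1, h2⟩
    have h3 := hc s₁ C h1 h2
    rw [show s₁.reg 0 = C.encode.length from h1.len] at h3
    refine Runs.seq (h3.mono le_rfl ?_)
    rintro s₂ ⟨h4, h5⟩
    have h6 := hd s₂
    rw [show s₂.reg 0 = C.encode.length from h4.len] at h6
    refine Runs.seq (h6.mono le_rfl ?_)
    rintro s₃ ⟨-, -, h7, h8⟩
    dsimp only at h7 h8
    rw [hP C s₂.ctx (Nat.pos_of_ne_zero hk) h4 h5] at h7 h8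
    refine Runs.assign ?_
    simp only [Function.update_self]
    exact ⟨h7, h8⟩
  · rw [hinst] at hk
    refine (Runs.assign ?_).mono (by omega) fun _ h => h
    simp only [Function.update_self]
    exact ⟨fun _ => rfl, fun h => absurd (hzero C hk) h⟩

end RAM

/-! ### Preference lists as lists of numbers. -/

namespace MatchingPref

variable {m n : ℕ}

/-- The preference list of an agent, as a list of numbers. -/
def Instance.agentList (I : Instance m n) : Agent m n → List ℕ
  | .inl w => (I.workerPref w).map Fin.val
  | .inr f => (I.firmPref f).map Fin.val

/-- The endpoint of `e` on side `s`. -/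
def endAgent : Bool → Fin m × Fin n → Agent m n
  | false, e => .inl e.1
  | true, e => .inr e.2

theorem agentCode_endAgent (s : Bool) (e : Fin m × Fin n) :
    agentCode (endAgent s e) = (s, end' s e) := by
  cases s <;> rfl

theorem exists_agentCode {s : Bool} {z : ℕ} (hz : z < sideSize m n s) :
    ∃ x : Agent m n, agentCode x = (s, z) := by
  cases s
  · exact ⟨.inl ⟨z, hz⟩, rfl⟩
  · exact ⟨.inr ⟨z, hz⟩, rfl⟩

theorem agentCode_lt (x : Agent m n) : (agentCode x).2 < sideSize m n (agentCode x).1 := by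
  cases x with
  | inl w => exact w.2
  | inr f => exact f.2

theorem agentCode_injective : Function.Injective (agentCode : Agent m n → Bool × ℕ) := by
  rintro (w | f) (w' | f') h <;> simp only [agentCode, Prod.mk.injEq, reduceCtorEq, false_and] at h
  · rw [Fin.ext h.2]
  · rw [Fin.ext h.2]

theorem Instance.agentList_eq_of_pref_eq {I J : Instance m n} {x : Agent m n}
    (h : I.pref x = J.pref x) : I.agentList x = J.agentList x := by
  cases x with
  | inl w => exact congrArg (List.map Fin.val) (List.map_injective_iff.2 Sum.inr_injective h)
  | inr f => exact congrArg (List.map Fin.val) (List.map_injective_iff.2 Sum.inl_injective h)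

theorem constAt_of_agentList_eq {k : ℕ} {I : Fin k → Instance m n} {x : Agent m n}
    (h : ∀ i j, (I i).agentList x = (I j).agentList x) {s : Bool} {z : ℕ}
    (hx : agentCode x = (s, z)) : ConstAt I s z := by
  rintro i j ⟨w, f⟩ he
  have h1 : agentCode (endAgent s (w, f)) = agentCode x := by rw [agentCode_endAgent, hx, he]
  obtain rfl := agentCode_injective h1
  have h2 := h i j
  have hinj : ∀ r, Function.Injective (List.map (Fin.val : Fin r → ℕ)) := fun r =>
    List.map_injective_iff.2 Fin.val_injective
  cases s with
  | false =>
    change ((I i).workerPref w).idxOf f = ((I j).workerPref w).idxOf f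
    rw [hinj _ h2]
  | true =>
    change ((I i).firmPref f).idxOf w = ((I j).firmPref f).idxOf w
    rw [hinj _ h2]

theorem getElem?_map_val {r : ℕ} {l : List (Fin r)} {a : ℕ} {u : Fin r} :
    (l.map Fin.val)[a]? = some (u : ℕ) ↔ l[a]? = some u := by
  simp [List.getElem?_map, Option.map_eq_some_iff, ← Fin.ext_iff]

theorem exists_lt_getElem?_iff {α : Type*} [DecidableEq α] {l : List α} (hl : l.Nodup) {u v : α}
    (hu : u ∈ l) (hv : v ∈ l) {L : ℕ} (hL : l.length ≤ L) :
    (∃ a < L, ∃ b < L, a < b ∧ l[a]? = some u ∧ l[b]? = some v) ↔ l.idxOf u < l.idxOf v := by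
  constructor
  · rintro ⟨a, -, b, -, hab, ha, hb⟩
    obtain ⟨ha1, rfl⟩ := List.getElem?_eq_some_iff.1 ha
    obtain ⟨hb1, rfl⟩ := List.getElem?_eq_some_iff.1 hb
    rwa [hl.idxOf_getElem, hl.idxOf_getElem]
  · intro h
    have h1 := List.idxOf_lt_length_iff.2 hu
    have h2 := List.idxOf_lt_length_iff.2 hv
    exact ⟨_, h1.trans_le hL, _, h2.trans_le hL, h, by simp [List.getElem?_eq_getElem h1],
      by simp [List.getElem?_eq_getElem h2]⟩

end MatchingPref

/-! ### Reading edges and preferences off the memory. -/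

namespace RAM

open MatchingPref Contracts

namespace Ctx.Encodes

variable {γ : Ctx} {C : OneAgentCollection}

theorem le_len (h : γ.Encodes C) (hk : 0 < C.k) : C.m + C.n + 3 ≤ γ.len := by
  have h1 := C.mul_add_three_le
  have h2 : C.m + C.n ≤ C.k * (C.m + C.n) := Nat.le_mul_of_pos_left _ hk
  rw [h.len]
  omega

theorem lists_idx (h : γ.Encodes C) (i : Fin C.k) {x : Agent C.m C.n} {s : Bool} {z : ℕ}
    (hx : agentCode x = (s, z)) :
    (C.inst i).lists[γ.idx s z]? = some ((C.inst i).agentList x) := by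
  cases x with
  | inl w =>
    cases hx
    rw [Ctx.idx, cond_false, Instance.lists, List.getElem?_append_left (by simp)]
    simp [Instance.agentList]
  | inr f =>
    cases hx
    rw [Ctx.idx, cond_true, Instance.lists, h.workers, List.getElem?_append_right (by simp)]
    simp [Instance.agentList]

theorem pos_iff (h : γ.Encodes C) (i : Fin C.k) {x : Agent C.m C.n} {s : Bool} {z : ℕ}
    (hx : agentCode x = (s, z)) {a u : ℕ} :
    γ.Pos i (γ.idx s z) a u ↔ ((C.inst i).agentList x)[a]? = some u := by
  have h1 := h.lists i _ _ (h.lists_idx i hx)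
  have h2 := h1 0 (by omega)
  rw [add_zero] at h2
  rw [Ctx.Pos, h2, List.getD_cons_zero]
  constructor
  · rintro ⟨h3, h4⟩
    rw [h1 (a + 1) (by omega), List.getD_cons_succ, List.getD_eq_getElem _ _ h3] at h4
    rw [List.getElem?_eq_getElem h3, h4]
  · intro h3
    obtain ⟨h4, rfl⟩ := List.getElem?_eq_some_iff.1 h3
    rw [h1 (a + 1) (by omega), List.getD_cons_succ, List.getD_eq_getElem _ _ h4]
    exact ⟨h4, rfl⟩

theorem length_agentList_lt (h : γ.Encodes C) (i : Fin C.k) (x : Agent C.m C.n) :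
    ((C.inst i).agentList x).length < γ.len :=
  h.length_lt i _ _ (h.lists_idx i (s := (agentCode x).1) (z := (agentCode x).2) rfl)

theorem inst_lt_len (h : γ.Encodes C) (i : Fin C.k) (x : Agent C.m C.n) : (i : ℕ) < γ.len := by
  have h1 := C.mul_add_three_le
  have h2 : 0 < C.m + C.n := by
    cases x with
    | inl w => have := w.2; omega
    | inr f => have := f.2; omega
  have h3 : C.k ≤ C.k * (C.m + C.n) := Nat.le_mul_of_pos_right _ h2
  have := i.2
  rw [h.len]
  omega

/-- The bounded quantifiers of `Same` lose nothing: list lengths, entries and instance numbers are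
all below the input length. -/
theorem same_iff (h : γ.Encodes C) (hk : 0 < C.k) {x : Agent C.m C.n} {s : Bool} {z : ℕ}
    (hx : agentCode x = (s, z)) : γ.Same (γ.idx s z) ↔
      ∀ i, (C.inst i).agentList x = (C.inst ⟨0, hk⟩).agentList x := by
  have h0 : ∀ a u, γ.Pos 0 (γ.idx s z) a u ↔ _ := fun a u => h.pos_iff ⟨0, hk⟩ hx
  have hval : ∀ i : Fin C.k, ∀ u ∈ (C.inst i).agentList x, u < γ.len := by
    intro i u hu
    have := h.le_len hk
    cases x with
    | inl w =>
      obtain ⟨f, -, rfl⟩ := List.mem_map.1 hu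
      have := f.2
      omega
    | inr f =>
      obtain ⟨w, -, rfl⟩ := List.mem_map.1 hu
      have := w.2
      omega
  constructor
  · intro hs i
    have key : ∀ a < γ.len, ∀ u < γ.len, _ := hs i (h.inst_lt_len i x) (by rw [h.insts]; exact i.2)
    refine List.ext_getElem? fun a => Option.ext fun u => ?_
    by_cases ha : a < γ.len
    · by_cases hu : u < γ.len
      · rw [← h0 a u, ← h.pos_iff i hx]
        exact key a ha u hu
      · exact ⟨fun h' => absurd (hval _ _ (List.mem_of_getElem? h')) hu,
          fun h' => absurd (hval _ _ (List.mem_of_getElem? h')) hu⟩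
    · have h1 := h.length_agentList_lt i x
      have h2 := h.length_agentList_lt ⟨0, hk⟩ x
      rw [List.getElem?_eq_none (by omega), List.getElem?_eq_none (by omega)]
  · intro hs i _ hi a _ u _
    rw [h.insts] at hi
    rw [h0, h.pos_iff ⟨i, hi⟩ hx, hs]

theorem better_iff (h : γ.Encodes C) {E : Finset (Fin C.m × Fin C.n)}
    (hE : ∀ i, (C.inst i).edges = E) {s : Bool} {e d : Fin C.m × Fin C.n} (he : e ∈ E)
    (hd : d ∈ E) (hed : end' s e = end' s d) :
    γ.Better s (end' s e) (end' (!s) e) (end' (!s) d) ↔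
      ∃ i, (C.inst i).rank s e < (C.inst i).rank s d := by
  have hx := agentCode_endAgent s e
  have key : ∀ i, (∃ a < γ.len, ∃ b < γ.len, a < b ∧
      ((C.inst i).agentList (endAgent s e))[a]? = some (end' (!s) e) ∧
      ((C.inst i).agentList (endAgent s e))[b]? = some (end' (!s) d)) ↔
      (C.inst i).rank s e < (C.inst i).rank s d := by
    intro i
    have hlen := (h.length_agentList_lt i (endAgent s e)).le
    obtain ⟨w, f⟩ := e
    obtain ⟨w', f'⟩ := d
    rw [← hE i] at he hd
    cases s with
    | false =>
      obtain rfl : w = w' := Fin.ext hed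
      simp only [Instance.agentList, endAgent, List.length_map] at hlen ⊢
      rw [Instance.rank, Instance.rank, ← exists_lt_getElem?_iff ((C.inst i).nodup_workerPref w)
        (((C.inst i).mem_workerPref _ _).2 he) (((C.inst i).mem_workerPref _ _).2 hd) hlen]
      simp only [← getElem?_map_val]
      rfl
    | true =>
      obtain rfl : f = f' := Fin.ext hed
      simp only [Instance.agentList, endAgent, List.length_map] at hlen ⊢
      rw [Instance.rank, Instance.rank, ← exists_lt_getElem?_iff ((C.inst i).nodup_firmPref f)
        (((C.inst i).mem_firmPref _ _).2 he) (((C.inst i).mem_firmPref _ _).2 hd) hlen]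
      simp only [← getElem?_map_val]
      rfl
  simp only [← key]
  constructor
  · rintro ⟨i, -, hi, h1⟩
    rw [h.insts] at hi
    refine ⟨⟨i, hi⟩, ?_⟩
    simp only [← h.pos_iff ⟨i, hi⟩ hx]
    exact h1
  · rintro ⟨i, hi⟩
    simp only [← h.pos_iff i hx] at hi
    exact ⟨i, h.inst_lt_len i (endAgent s e), by rw [h.insts]; exact i.2, hi⟩

end Ctx.Encodes

/-- The numbers that describe a contract. -/
def ctOf {m n : ℕ} (c : (Fin m × Fin n) × ℕ) : Ct :=
  (fun s => end' s c.1, c.2)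

theorem ctOf_injective {m n : ℕ} : Function.Injective (ctOf : (Fin m × Fin n) × ℕ → Ct) := by
  intro c d h
  exact Prod.ext (end'_ext fun s => congrFun (Prod.mk.inj h).1 s) (Prod.mk.inj h).2

theorem Ctx.Encodes.allowed_iff {γ : Ctx} {C : OneAgentCollection} (h : γ.Encodes C) (hk : 0 < C.k)
    {lam : ℕ} {c : Ct} :
    γ.Allowed lam c ↔ ∃ c' ∈ levels (C.inst ⟨0, hk⟩).edges lam, ctOf c' = c := by
  constructor
  · rintro ⟨h1, h2, a, -, h3⟩
    rw [h.workers] at h2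
    have h4 := (h.pos_iff ⟨0, hk⟩ (x := .inl ⟨c.1 false, h2⟩) (s := false) rfl).1 h3
    obtain ⟨f, hf, hfc⟩ := List.mem_map.1 (List.mem_of_getElem? h4)
    refine ⟨((⟨c.1 false, h2⟩, f), c.2), ⟨((C.inst _).mem_workerPref _ _).1 hf, h1⟩, ?_⟩
    refine Prod.ext (funext fun s => ?_) rfl
    cases s
    · rfl
    · exact hfc
  · rintro ⟨⟨⟨w, f⟩, l⟩, ⟨h1, h2⟩, rfl⟩
    refine ⟨h2, by rw [h.workers]; exact w.2, ?_⟩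
    have hmem : (f : ℕ) ∈ (C.inst ⟨0, hk⟩).agentList (.inl w) :=
      List.mem_map_of_mem (((C.inst _).mem_workerPref _ _).2 h1)
    obtain ⟨a, ha⟩ := List.mem_iff_getElem?.1 hmem
    exact ⟨a, (List.getElem?_eq_some_iff.1 ha).1.trans (h.length_agentList_lt _ _),
      (h.pos_iff ⟨0, hk⟩ (x := .inl w) (s := false) rfl).2 ha⟩

end RAM

/-! ### Correctness of the formulas of the algorithm. -/

namespace MatchingPref.OneAgentCollection

variable (C : OneAgentCollection) (hk : 0 < C.k)

/-- The common edge set of the instances. -/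
abbrev edges : Finset (Fin C.m × Fin C.n) :=
  (C.inst ⟨0, hk⟩).edges

/-- The ranks of the contracts with respect to the agents of `o`. -/
noncomputable abbrev ctRank (o : RAM.Ct) : Bool → (Fin C.m × Fin C.n) × ℕ → ℕ ×ₗ ℕ ×ₗ ℕ :=
  rank₂ (hybridRank C.inst ⟨0, hk⟩ o.1)

/-- At most one contract, with numbers `o`. -/
abbrev forced (lam : ℕ) (o : RAM.Ct) : Set ((Fin C.m × Fin C.n) × ℕ) :=
  forcedContracts (C.edges hk) lam o.1 o.2

/-- The contracts that remain when `o` is forced. -/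
abbrev remaining (lam : ℕ) (o : RAM.Ct) : Set ((Fin C.m × Fin C.n) × ℕ) :=
  Contracts.truncation end₂ (C.ctRank hk o) (levels (C.edges hk) lam) o.1 (C.forced hk lam o)

end MatchingPref.OneAgentCollection

namespace RAM.Ctx.Encodes

open MatchingPref Contracts

variable {γ : Ctx} {C : OneAgentCollection} {hk : 0 < C.k} {lam : ℕ} {o : Ct} {s₀ : Bool}
  {c d : (Fin C.m × Fin C.n) × ℕ}

theorem allowed_ctOf (h : γ.Encodes C) : γ.Allowed lam (ctOf c) ↔ c ∈ levels (C.edges hk) lam := by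
  rw [h.allowed_iff hk]
  constructor
  · rintro ⟨c', h1, h2⟩
    rwa [← ctOf_injective h2]
  · exact fun h1 => ⟨c, h1, rfl⟩

theorem mem_forced_iff : c ∈ C.forced hk lam o ↔ c ∈ levels (C.edges hk) lam ∧ ctOf c = o := by
  refine and_congr_right fun _ => ⟨fun h => Prod.ext (funext h.1) h.2, ?_⟩
  rintro rfl
  exact ⟨fun _ => rfl, rfl⟩

theorem below_ctOf (h : γ.Encodes C) (hlam : lam ≤ 2) (hc : c ∈ levels (C.edges hk) lam) :
    (ctOf c).Below γ.len := by
  have hlen := h.le_len hk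
  have hl : c.2 < lam := hc.2
  refine ⟨fun s => ?_, show c.2 < γ.len by omega⟩
  have := end'_lt s c.1
  change end' s c.1 < γ.len
  cases s
  · change _ < C.m at this
    omega
  · change _ < C.n at this
    omega

/-- `Above` asks for a preference in some instance, so the hybrid order never has to be computed; by
`hybridRank_lt_iff` the two agree wherever they are compared. -/
theorem above_iff (h : γ.Encodes C) {s : Bool} (hc : c ∈ levels (C.edges hk) lam)
    (hd : d ∈ levels (C.edges hk) lam)
    (hor : ConstAt C.inst s (end₂ s c) ∨ ∀ t, end₂ t d = o.1 t) :
    γ.Above s (ctOf c) (ctOf d) ↔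
      end₂ s c = end₂ s d ∧ C.ctRank hk o s c < C.ctRank hk o s d := by
  have hE : ∀ i, (C.inst i).edges = C.edges hk := fun i => C.same_graph _ _
  refine and_congr_right fun hcd => ?_
  rw [rank₂_lt_iff, hybridRank_lt_iff hE hc.1 hcd hor, ← h.better_iff hE hc.1 hd.1 hcd]
  rfl

/-- At the varying agent `Above` is reliable only with the forced contract in second place.
Domination by `o` is therefore tested as the failure of `d` to be above `o`. -/
theorem threatens_iff (h : γ.Encodes C) : γ.Threatens lam o (ctOf d) ↔
    Threat end₂ (C.ctRank hk o) (levels (C.edges hk) lam) o.1 (C.forced hk lam o) d := by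
  rw [Ctx.Threatens, h.allowed_ctOf (hk := hk), Threat]
  refine and_congr_right fun hd => and_congr_right fun _ => not_congr ?_
  rw [h.allowed_iff hk]
  constructor
  · rintro ⟨⟨c, hc, hco⟩, s, hs, hs'⟩
    rw [← hco, h.above_iff (o := o) hd hc (Or.inr fun t => by rw [← hco]; rfl)] at hs'
    refine ⟨c, mem_forced_iff.2 ⟨hc, hco⟩, s, ?_, ?_⟩
    · rw [← hco] at hs
      exact hs
    · rw [← hco] at hs
      exact not_lt.1 fun hlt => hs' ⟨Eq.symm hs, hlt⟩
  · rintro ⟨c, hc, s, hs, hs'⟩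
    obtain ⟨hc, hco⟩ := mem_forced_iff.1 hc
    refine ⟨⟨c, hc, hco⟩, s, ?_, ?_⟩
    · rw [← hco]
      exact hs
    · rw [← hco, h.above_iff (o := o) hd hc (Or.inr fun t => by rw [← hco]; rfl)]
      exact fun hlt => hlt.2.not_ge hs'

theorem exists_of_allowed (h : γ.Encodes C) {c' : Ct} (hc : γ.Allowed lam c') :
    ∃ c ∈ levels (C.edges hk) lam, ctOf c = c' :=
  (h.allowed_iff hk).1 hc

theorem constAt_of_not_touches (ho : ConstExcept C.inst s₀ (o.1 s₀)) (hc : ¬ Touches end₂ o.1 c)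
    (s : Bool) : ConstAt C.inst s (end₂ s c) :=
  ho _ _ fun ⟨hs, hz⟩ => hc ⟨s, by rw [hz, hs]⟩

theorem remains_iff (h : γ.Encodes C) (ho : ConstExcept C.inst s₀ (o.1 s₀)) (hlam : lam ≤ 2) :
    γ.Remains lam o (ctOf c) ↔ c ∈ C.remaining hk lam o := by
  rw [Ctx.Remains, h.allowed_ctOf (hk := hk)]
  refine and_congr_right fun hc => and_congr_right fun hct => ?_
  constructor
  · intro H d hd s hs
    have := H (ctOf d) (h.below_ctOf hlam hd.1) (h.threatens_iff.2 hd) s hs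
    rw [h.above_iff (o := o) hc hd.1 (Or.inl (constAt_of_not_touches ho hct s))] at this
    exact this.2
  · intro H d' _ hd s hs
    obtain ⟨d, hdl, rfl⟩ := h.exists_of_allowed (hk := hk) hd.1
    rw [h.above_iff (o := o) hc hdl (Or.inl (constAt_of_not_touches ho hct s))]
    exact ⟨hs, H d (h.threatens_iff.1 hd) s hs⟩

theorem above_iff_of_remaining (h : γ.Encodes C) (ho : ConstExcept C.inst s₀ (o.1 s₀)) {s : Bool}
    (hc : c ∈ C.remaining hk lam o) (hd : d ∈ C.remaining hk lam o) :
    γ.Above s (ctOf c) (ctOf d) ↔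
      end₂ s c = end₂ s d ∧ C.ctRank hk o s c < C.ctRank hk o s d :=
  h.above_iff hc.1 hd.1 (Or.inl (constAt_of_not_touches ho hc.2.1 s))

theorem exists_of_remains (h : γ.Encodes C) (ho : ConstExcept C.inst s₀ (o.1 s₀)) (hlam : lam ≤ 2)
    {c' : Ct} (hc : γ.Remains lam o c') : ∃ c ∈ C.remaining hk lam o, ctOf c = c' := by
  obtain ⟨c, -, rfl⟩ := h.exists_of_allowed (hk := hk) hc.1
  exact ⟨c, (h.remains_iff ho hlam).1 hc, rfl⟩

theorem proposedTo_iff (h : γ.Encodes C) (ho : ConstExcept C.inst s₀ (o.1 s₀)) (hlam : lam ≤ 2)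
    (hc : c ∈ C.remaining hk lam o) : γ.ProposedTo lam o (ctOf c) ↔
      Proposed end₂ (C.ctRank hk o) (C.remaining hk lam o) (fun d => γ.Marked lam o (ctOf d)) c := by
  constructor
  · intro H d hd h1 h2
    exact H (ctOf d) (h.below_ctOf hlam hd.1) ((h.remains_iff ho hlam).2 hd)
      ((h.above_iff_of_remaining ho hd hc).2 ⟨h1, h2⟩)
  · intro H d' _ hd' h1
    obtain ⟨d, hd, rfl⟩ := h.exists_of_remains (hk := hk) ho hlam hd'
    obtain ⟨h2, h3⟩ := (h.above_iff_of_remaining ho hd hc).1 h1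
    exact H d hd h2 h3

theorem rejectedBy_iff (h : γ.Encodes C) (ho : ConstExcept C.inst s₀ (o.1 s₀)) (hlam : lam ≤ 2)
    (hc : c ∈ C.remaining hk lam o) : γ.RejectedBy lam o (ctOf c) ↔
      Rejected end₂ (C.ctRank hk o) (C.remaining hk lam o) (fun d => γ.Marked lam o (ctOf d)) c := by
  constructor
  · rintro ⟨d', -, hd', h1, h2⟩
    obtain ⟨d, hd, rfl⟩ := h.exists_of_remains (hk := hk) ho hlam hd'
    obtain ⟨h3, h4⟩ := (h.above_iff_of_remaining ho hd hc).1 h1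
    exact ⟨d, hd, h3, h4, (h.proposedTo_iff ho hlam hd).1 h2⟩
  · rintro ⟨d, hd, h1, h2, h3⟩
    exact ⟨ctOf d, h.below_ctOf hlam hd.1, (h.remains_iff ho hlam).2 hd,
      (h.above_iff_of_remaining ho hd hc).2 ⟨h1, h2⟩, (h.proposedTo_iff ho hlam hd).2 h3⟩

/-- The marks are a fixpoint of rejection in the truncated system, so the held contracts are stable
there by `isStable_held`; the forcing criterion then applies to them. -/
theorem safe_iff (h : γ.Encodes C) (hk : 0 < C.k) (hm : γ.IsMarked)
    (ho : ConstExcept C.inst s₀ (o.1 s₀)) (hlam : lam ≤ 2) (hob : o.Below γ.len) :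
    γ.Safe lam o ↔ ∃ S, IsStable end₂ (C.ctRank hk o) (levels (C.edges hk) lam) S ∧
      ∀ c, c ∈ C.forced hk lam o ↔ c ∈ S ∧ Touches end₂ o.1 c := by
  have hE : ∀ i, (C.inst i).edges = C.edges hk := fun i => C.same_graph _ _
  have hinj : RankInj end₂ (C.ctRank hk o) (levels (C.edges hk) lam) :=
    rankInj_rank₂ (rankInj_hybridRank hE) hlam
  have hfin := levels_finite (C.edges hk) lam
  have hsub : C.remaining hk lam o ⊆ levels (C.edges hk) lam := fun c hc => hc.1
  have hlen : lam < γ.len := by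
    have := h.le_len hk
    omega
  have hN := isStable_held (hfin.subset hsub)
    (fun c hc d hd => hinj c (hsub hc) d (hsub hd))
    (D := fun d => γ.Marked lam o (ctOf d)) fun c hc => by
      rw [hm lam hlen o hob _ (h.below_ctOf hlam hc.1), h.rejectedBy_iff ho hlam hc]
  rw [exists_isStable_forced_iff hfin hinj (fun c hc => hc.1) (fun c hc => hc.2.1)
    (fun c hc d hd => ctOf_injective
      ((mem_forced_iff.1 hc).2.trans (mem_forced_iff.1 hd).2.symm)) hN]
  constructor
  · intro H d hd
    obtain ⟨c', -, ⟨h1, h2, h3⟩, s, hs⟩ :=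
      H (ctOf d) (h.below_ctOf hlam hd.1) (h.threatens_iff.2 hd)
    obtain ⟨c, hc, rfl⟩ := h.exists_of_remains (hk := hk) ho hlam h1
    exact ⟨c, ⟨hc, h2, (h.proposedTo_iff ho hlam hc).1 h3⟩, s, hs⟩
  · intro H d' _ hd
    obtain ⟨d, hdl, rfl⟩ := h.exists_of_allowed (hk := hk) hd.1
    obtain ⟨c, ⟨hc, h2, h3⟩, s, hs⟩ := H d (h.threatens_iff.1 hd)
    exact ⟨ctOf c, h.below_ctOf hlam hc.1, ⟨(h.remains_iff ho hlam).2 hc, h2,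
      (h.proposedTo_iff ho hlam hc).2 h3⟩, s, hs⟩

theorem size_eq (h : γ.Encodes C) (s : Bool) : γ.mem 0 (cond s 1 0) = sideSize C.m C.n s := by
  cases s
  · exact h.workers
  · exact h.firms

theorem sideSize_lt (h : γ.Encodes C) (hk : 0 < C.k) (s : Bool) : sideSize C.m C.n s < γ.len := by
  have := h.le_len hk
  cases s
  · change C.m < _
    omega
  · change C.n < _
    omega

theorem exists_constExcept (h : γ.Encodes C) (hk : 0 < C.k) (ho : γ.OthersSame o) :
    ∃ s₀, ConstExcept C.inst s₀ (o.1 s₀) := by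
  obtain ⟨s₀, H⟩ := ho
  refine ⟨s₀, fun s z hsz => ?_⟩
  by_cases hz : z < sideSize C.m C.n s
  · obtain ⟨x, hx⟩ := exists_agentCode hz
    have := (h.same_iff hk hx).1
      (H s z (hz.trans (h.sideSize_lt hk s)) (by rwa [h.size_eq]) hsz)
    exact constAt_of_agentList_eq (fun i j => (this i).trans (this j).symm) hx
  · intro i j e he
    exact absurd (he ▸ end'_lt s e) hz

theorem othersSame (h : γ.Encodes C) (hk : 0 < C.k)
    (ho : ∀ x : Agent C.m C.n, agentCode x ≠ (s₀, o.1 s₀) →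
      ∀ i j, (C.inst i).pref x = (C.inst j).pref x) : γ.OthersSame o := by
  refine ⟨s₀, fun s z _ hz hsz => ?_⟩
  rw [h.size_eq] at hz
  obtain ⟨x, hx⟩ := exists_agentCode hz
  rw [h.same_iff hk hx]
  refine fun i => Instance.agentList_eq_of_pref_eq (ho x (fun hx' => hsz ?_) _ _)
  rw [hx] at hx'
  exact Prod.mk.inj hx'

/-- The search over `o` ranges over pairs of agents, including the nonexistent ones that stand for
"unmatched"; their indices are still below the input length. -/
theorem answer_iff (h : γ.Encodes C) (hk : 0 < C.k) (hm : γ.IsMarked) (dom : Bool) :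
    γ.Answer dom ↔ ∃ M, ∀ i, (C.inst i).IsGood dom M := by
  have hE : ∀ i, (C.inst i).edges = C.edges hk := fun i => C.same_graph _ _
  have hle : ∀ {lam}, LevelsFor dom lam → lam ≤ 2 := by
    rintro lam (rfl | ⟨rfl, -⟩) <;> omega
  constructor
  · rintro ⟨lam, hlen, o, hob, hlam, -, ho, hsafe⟩
    obtain ⟨s₀, hs₀⟩ := h.exists_constExcept hk ho
    obtain ⟨S, hS, hSo⟩ := (h.safe_iff hk hm hs₀ (hle hlam) hob).1 hsafe
    exact isGood_of_isStable hE hs₀ hlam hS hSo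
  · rintro ⟨M, hM⟩
    obtain ⟨s₀, z₀, hz₀, hpref⟩ : ∃ s₀ z₀, z₀ ≤ sideSize C.m C.n s₀ ∧
        ∀ x : Agent C.m C.n, agentCode x ≠ (s₀, z₀) →
          ∀ i j, (C.inst i).pref x = (C.inst j).pref x := by
      by_cases hex : ∃ x : Agent C.m C.n, ∃ i j, (C.inst i).pref x ≠ (C.inst j).pref x
      · obtain ⟨x, hx⟩ := hex
        refine ⟨(agentCode x).1, (agentCode x).2, (agentCode_lt x).le, fun y hy => ?_⟩
        by_contra hno
        push Not at hno
        exact hy (congrArg agentCode (C.one_agent y x hno hx))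
      · push Not at hex
        -- If no agent varies, the nonexistent worker with index `C.m` plays that role.
        exact ⟨false, _, le_rfl, fun x _ => hex x⟩
    have hconst : ConstExcept C.inst s₀ z₀ := by
      intro s z hsz
      by_cases hz : z < sideSize C.m C.n s
      · obtain ⟨x, hx⟩ := exists_agentCode hz
        refine constAt_of_agentList_eq (fun i j => Instance.agentList_eq_of_pref_eq
          (hpref x (fun hx' => hsz ?_) i j)) hx
        rw [hx] at hx'
        exact Prod.mk.inj hx'
      · intro i j e he
        exact absurd (he ▸ end'_lt s e) hz
    obtain ⟨x, rfl, hxle, lam, l₀, S, hlam, hl₀, hS, hSx⟩ :=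
      exists_isStable_of_isGood hE ⟨0, hk⟩ hz₀ hconst hM
    have hlam2 := hle hlam
    have hlen := h.le_len hk
    have hob : Ct.Below (x, l₀) γ.len :=
      ⟨fun s => (hxle s).trans_lt (h.sideSize_lt hk s), show l₀ < γ.len by omega⟩
    exact ⟨lam, by omega, (x, l₀), hob, hlam, hl₀, h.othersSame hk hpref,
      (h.safe_iff hk hm hconst hlam2 hob).2 ⟨S, hS, hSx⟩⟩

end RAM.Ctx.Encodes

theorem mainTheorem2 :
    RAM.DecidesInPolyTime MatchingPref.OneAgentCollection.encode
      MatchingPref.OneAgentCollection.HasCommonPopular ∧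
    RAM.DecidesInPolyTime MatchingPref.OneAgentCollection.encode
      MatchingPref.OneAgentCollection.HasCommonDominant := by
  have h0 : ∀ C : MatchingPref.OneAgentCollection, C.k = 0 → ∀ i : Fin C.k, False := by
    intro C hk i
    exact absurd i.2 (by omega)
  exact ⟨RAM.decidesInPolyTime_of_answer false (fun C hk => ⟨∅, fun i => (h0 C hk i).elim⟩)
      fun C γ hk h hm => h.answer_iff hk hm false,
    RAM.decidesInPolyTime_of_answer true (fun C hk => ⟨∅, fun i => (h0 C hk i).elim⟩)
      fun C γ hk h hm => h.answer_iff hk hm true⟩
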